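/- Let $A=\bigoplus_{m\ge 0}A_m$ be a standard graded algebra over a field $A_0=k$ (generated by finitely many elements of degree $1$), with $\dim A=d\ge 1$ and $\operatorname{depth}A>0$ (depth with respect to $\bigoplus_{m\ge1}A_m$). Let $(I_n)_{n\in\mathbb N}$ be a filtration of homogeneous ideals of $A$: $I_0=A$, $I_{n+1}\subseteq I_n$, $I_mI_n\subseteq I_{m+n}$. Let $R=\bigoplus_{n}I_nt^n\subseteq A[t]$, bigraded by $R_{m,n}=(I_n)_mt^n$, let $r,s\in\mathbb N$ and $(d_1,e_1),\dots,(d_s,e_s)\in\mathbb N\times\mathbb N_{>0}$, and assume that one of the following holds. (a) The filtration is Noetherian (there is $m\ge1$ with $I_nI_m=I_{n+m}$ for all $n\ge m$), $A$ is generated over $k$ by $r$ elements of degree $1$, and $R$ is generated as an $A$-algebra by $s$ elements of bidegrees $(d_1,e_1),\dots,(d_s,e_s)$. (b) There is $p\in\mathbb Z[x,y]$ such that $$\sum_{(m,n)\in\mathbb N^2}\ell_k\big((I_n)_m\big)x^my^n=\frac{p(x,y)}{(1-x)^r\prod_{i=1}^s(1-x^{d_i}y^{e_i})}.\qquad(*)$$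 Then in both cases there is a polynomial $p\in\mathbb Z[x,y]$ satisfying $(*)$. For such $p$, let $N\subset\mathbb N^2$ be the set of exponents $(\alpha,\beta)$ of the monomials $x^\alpha y^\beta$ with non-zero coefficient in $p$. Renumber the bidegrees so that $d_1/e_1<\dots<d_l/e_l$ are all the distinct values among the $d_i/e_i$, $1\le i\le s$. For $1\le j<l$ let $\mathfrak C_j\subset\mathbb R^2$ be the closed convex cone spanned by $(d_j,e_j)$ and $(d_{j+1},e_{j+1})$, let $\mathfrak C_l$ be the one spanned by $(d_l,e_l)$ and $(1,0)$, and put $\mathfrak RC_j=\bigcap_{(\alpha,\beta)\in N}\big(\mathfrak C_j+(\alpha,\beta)\big)$. Then for every $1\le j\le l$: 1. $\mathfrak RC_j=\mathfrak C_j+(\lambda_j,\beta_j)$ for some $(\lambda_j,\beta_j)\in\mathbb Q_{\ge0}^2$, and $\mathfrak RC_j\subseteq\mathfrak C_j$. 2. There are a homogeneous polynomial $P_j\in\mathbb Q[X,Y]$ of degree at most $d-1$ and a quasi-polynomial $Q_j$ in two variables with rational coefficients (finitely many polynomials in $\mathbb Q[X,Y]$, one for each pair of residue classes of $(m,n)$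 modulo a common period; its degree is the largest of their degrees), with $\deg Q_j<\deg P_j$ unless $P_j=Q_j=0$, such that $$\ell_k\big((I_n)_m\big)=P_j(m,n)+Q_j(m,n)\qquad\text{for all }(m,n)\in\mathfrak RC_j\cap\mathbb N^2.$$ 3. If $e_i=1$ for all $i$ and $j=l$, then $Q_l$ is a polynomial. 4. If $A$ is a domain which is generated over $k$ by $r$ elements of degree $1$, and $R$ is generated as an $A$-algebra by $s$ non-zero elements of bidegrees $(d_1,e_1),\dots,(d_s,e_s)$ (for example, $I_n=I^n$ for an ideal $I$ generated by non-zero homogeneous elements of degrees $d_1,\dots,d_s$, with $s\geq 1$ and all $e_i=1$), then $\deg P_j=d-1$. -/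

import Mathlib

/-- `A = ⨁ Aₘ` is a standard graded algebra over the field `k = A₀`: it is generated as a
`k`-algebra by its degree one piece, which is finite dimensional. -/
structure IsStandardGraded {k A : Type*} [Field k] [CommRing A] [Algebra k A]
    (𝒜 : ℕ → Submodule k A) [GradedAlgebra 𝒜] : Prop where
  zero_eq : 𝒜 0 = 1
  finite_one : Module.Finite k (𝒜 1)
  adjoin_one : Algebra.adjoin k (𝒜 1 : Set A) = ⊤

/-- The depth of a graded ring `A` with respect to its irrelevant ideal `𝔪 = ⨁_{m ≥ 1} Aₘ`: the
supremum of the lengths of the `A`-regular sequences contained in `𝔪`. -/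
noncomputable def gradedDepth {k A : Type*} [Field k] [CommRing A] [Algebra k A]
    (𝒜 : ℕ → Submodule k A) [GradedAlgebra 𝒜] : ℕ∞ :=
  ⨆ (rs : List A) (_ : RingTheory.Sequence.IsRegular A rs ∧
    ∀ x ∈ rs, x ∈ (HomogeneousIdeal.irrelevant 𝒜).toIdeal), (rs.length : ℕ∞)

/-- `(Iₙ)` is a filtration of homogeneous ideals of `A`. -/
structure IsHomogeneousFiltration {k A : Type*} [Field k] [CommRing A] [Algebra k A]
    (𝒜 : ℕ → Submodule k A) [GradedAlgebra 𝒜] (I : ℕ → Ideal A) : Prop where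
  isHomogeneous : ∀ n, (I n).IsHomogeneous 𝒜
  zero_eq_top : I 0 = ⊤
  succ_le : ∀ n, I (n + 1) ≤ I n
  mul_le : ∀ m n, I m * I n ≤ I (m + n)

/-- A filtration `(Iₙ)` is Noetherian if `Iₙ Iₘ = Iₙ₊ₘ` for some `m ≥ 1` and all `n ≥ m`. -/
def IsNoetherianFiltration {A : Type*} [CommRing A] (I : ℕ → Ideal A) : Prop :=
  ∃ m, 1 ≤ m ∧ ∀ n, m ≤ n → I n * I m = I (n + m)

/-- The Rees algebra `R = ⨁ₙ Iₙ tⁿ ⊆ A[t]` of a filtration; its component of bidegree `(m, n)` is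
`(Iₙ)ₘ tⁿ`. -/
def filtrationRees {A : Type*} [CommRing A] (I : ℕ → Ideal A) (h0 : I 0 = ⊤)
    (hmul : ∀ m n, I m * I n ≤ I (m + n)) : Subalgebra A (Polynomial A) where
  carrier := {f | ∀ n, f.coeff n ∈ I n}
  mul_mem' hf hg i := by
    rw [Polynomial.coeff_mul]
    refine Ideal.sum_mem _ ?_
    rintro ⟨a, b⟩ hab
    rw [← Finset.HasAntidiagonal.mem_antidiagonal.mp hab]
    exact hmul a b (Ideal.mul_mem_mul (hf a) (hg b))
  add_mem' hf hg i := by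
    rw [Polynomial.coeff_add]
    exact Ideal.add_mem _ (hf i) (hg i)
  algebraMap_mem' a i := by
    rw [Polynomial.algebraMap_apply, Polynomial.coeff_C]
    split_ifs with h
    · subst h
      simp [h0]
    · exact Ideal.zero_mem _

/-- `x₁, …, x_r ∈ A₁` generate `A` as a `k`-algebra, and the elements `gᵢ t^{eᵢ}` of bidegree
`(dᵢ, eᵢ)`, `gᵢ ∈ (I_{eᵢ})_{dᵢ}`, generate the Rees algebra `R = ⨁ₙ Iₙ tⁿ` as an `A`-algebra. -/
structure IsGeneratingSystem {k A : Type*} [Field k] [CommRing A] [Algebra k A]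
    (𝒜 : ℕ → Submodule k A) [GradedAlgebra 𝒜] (I : ℕ → Ideal A)
    (hI : IsHomogeneousFiltration 𝒜 I) {r s : ℕ} (d e : Fin s → ℕ)
    (x : Fin r → A) (g : Fin s → A) : Prop where
  x_mem : ∀ i, x i ∈ 𝒜 1
  adjoin_x : Algebra.adjoin k (Set.range x) = ⊤
  g_mem : ∀ i, g i ∈ I (e i)
  g_deg : ∀ i, g i ∈ 𝒜 (d i)
  adjoin_g : Algebra.adjoin A (Set.range fun i => Polynomial.monomial (e i) (g i)) =
    filtrationRees I hI.zero_eq_top hI.mul_le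

/-- `ℓ_k((Iₙ)ₘ)`, where `(Iₙ)ₘ = Iₙ ∩ Aₘ`. -/
noncomputable def bigradedLength {k A : Type*} [Field k] [CommRing A] [Algebra k A]
    (𝒜 : ℕ → Submodule k A) (I : ℕ → Ideal A) (m n : ℕ) : ℕ :=
  Module.finrank k ((I n).restrictScalars k ⊓ 𝒜 m : Submodule k A)

/-- The bigraded Hilbert series `∑ ℓ_k((Iₙ)ₘ) xᵐ yⁿ`, with `x = X 0` and `y = X 1`. -/
noncomputable def bigradedHilbertSeries {k A : Type*} [Field k] [CommRing A] [Algebra k A]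
    (𝒜 : ℕ → Submodule k A) (I : ℕ → Ideal A) : MvPowerSeries (Fin 2) ℤ :=
  fun a => (bigradedLength 𝒜 I (a 0) (a 1) : ℤ)

/-- `∑ ℓ_k((Iₙ)ₘ) xᵐ yⁿ = p(x, y) / ((1 - x)^r ∏ᵢ (1 - x^{dᵢ} y^{eᵢ}))`, with denominators
cleared. -/
def IsHilbertNumerator {k A : Type*} [Field k] [CommRing A] [Algebra k A]
    (𝒜 : ℕ → Submodule k A) (I : ℕ → Ideal A) (r : ℕ) {s : ℕ} (d e : Fin s → ℕ)
    (p : MvPolynomial (Fin 2) ℤ) : Prop :=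
  bigradedHilbertSeries 𝒜 I *
      ((1 - MvPowerSeries.X 0) ^ r *
        ∏ i, (1 - MvPowerSeries.X 0 ^ d i * MvPowerSeries.X 1 ^ e i)) =
    (p : MvPowerSeries (Fin 2) ℤ)

/-- `σ` lists, in strictly increasing order, one index for each distinct value of the slopes
`dᵢ / eᵢ`. -/
def IsSlopeEnumeration {s l : ℕ} (d e : Fin s → ℕ) (σ : Fin l → Fin s) : Prop :=
  StrictMono (fun j => (d (σ j) : ℚ) / (e (σ j) : ℚ)) ∧
    ∀ i, ∃ j, (d i : ℚ) / (e i : ℚ) = (d (σ j) : ℚ) / (e (σ j) : ℚ)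

/-- The ray vectors, indexed from `0` to `l`: the bidegrees selected by `σ`, followed by
`(1, 0)`. -/
def rayVector {s l : ℕ} (d e : Fin s → ℕ) (σ : Fin l → Fin s) (j : ℕ) : ℚ × ℚ :=
  if h : j < l then ((d (σ ⟨j, h⟩) : ℚ), (e (σ ⟨j, h⟩) : ℚ)) else (1, 0)

/-- The vectors of the rational plane inside the real plane. -/
def toRealPlane (v : ℚ × ℚ) : ℝ × ℝ := ((v.1 : ℝ), (v.2 : ℝ))

/-- The chamber `C_j`: the cone in `ℝ²` spanned by two consecutive ray vectors. -/
def chamber {s l : ℕ} (d e : Fin s → ℕ) (σ : Fin l → Fin s) (j : Fin l) : Set (ℝ × ℝ) :=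
  {v | ∃ a b : ℝ, 0 ≤ a ∧ 0 ≤ b ∧
    v = a • toRealPlane (rayVector d e σ j) + b • toRealPlane (rayVector d e σ (j + 1))}

/-- The restricted cone `RC_j`: all `v` such that `v - (α, β) ∈ C_j` for every exponent `(α, β)`
occurring in `p`, that is, the intersection of the translates `C_j + (α, β)`. -/
def restrictedCone {s l : ℕ} (d e : Fin s → ℕ) (σ : Fin l → Fin s)
    (p : MvPolynomial (Fin 2) ℤ) (j : Fin l) : Set (ℝ × ℝ) :=
  {v | ∀ a ∈ p.support, v - ((a 0 : ℝ), (a 1 : ℝ)) ∈ chamber d e σ j}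

/-- The degree of a polynomial in `ℚ[X, Y]`, with `deg 0 = ⊥`. -/
noncomputable def polyDegree (f : MvPolynomial (Fin 2) ℚ) : WithBot ℕ :=
  f.support.sup fun a => ((a 0 + a 1 : ℕ) : WithBot ℕ)

/-- A quasi-polynomial in two variables with rational coefficients: a polynomial for each pair of
residue classes modulo a common period. -/
structure QuasiPolynomial₂ where
  period : ℕ
  period_pos : 0 < period
  constituent : Fin period → Fin period → MvPolynomial (Fin 2) ℚ

/-- The constituent which is in force at `(m, n)`. -/
def QuasiPolynomial₂.constituentAt (Q : QuasiPolynomial₂) (m n : ℕ) : MvPolynomial (Fin 2) ℚ :=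
  Q.constituent ⟨m % Q.period, Nat.mod_lt m Q.period_pos⟩ ⟨n % Q.period, Nat.mod_lt n Q.period_pos⟩

/-- The value of a quasi-polynomial at `(m, n)`. -/
noncomputable def QuasiPolynomial₂.eval (Q : QuasiPolynomial₂) (m n : ℕ) : ℚ :=
  MvPolynomial.eval ![(m : ℚ), (n : ℚ)] (Q.constituentAt m n)

/-- The degree of a quasi-polynomial: the largest degree of its constituents. -/
noncomputable def QuasiPolynomial₂.degree (Q : QuasiPolynomial₂) : WithBot ℕ :=
  Finset.univ.sup fun c : Fin Q.period × Fin Q.period => polyDegree (Q.constituent c.1 c.2)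

/-- All constituents coincide, so that the quasi-polynomial is a polynomial. -/
def QuasiPolynomial₂.IsPolynomial (Q : QuasiPolynomial₂) : Prop :=
  ∃ T : MvPolynomial (Fin 2) ℚ, ∀ a b, Q.constituent a b = T

/-! ### Standard graded algebras: finiteness, positive depth and monotonicity of lengths -/

section

open DirectSum

/-! By (*) the length function is a finite combination of translates, by the exponents of p, of the
coefficients of 1/((1-x)^r ∏(1-x^{d_i}y^{e_i})). This vector partition function is quasi-polynomial
on every chamber (`exists_quasiPolySpace_eq_on_chamber`). On the restricted cone all the translated
arguments lie in the chamber at once, so the lengths agree there with a single quasi-polynomial q.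

A function on ℤ² counts as quasi-polynomial when some multiples of the two unit translations act
unipotently on it. Dividing a series by 1 - x^a y^b means summing its coefficients along v = (a,b).
If a function is a sum of quasi-polynomials, each cut off along a line det(b,·) = τ, then choosing
the indefinite sum along v that vanishes on a strip just below that line gives a representation of
the same shape (`HasRayRep.exists_sum`). Adding the vectors in a suitable order keeps every v to the
left of the cut-off rays. Inside a chamber no cut-off is visible.

That the leading form of q is an honest polynomial comes from monotonicity. Positive depth makes the
lengths increase with m, and the filtration makes them decrease with n. Along an interior ray of the
chamber the leading coefficient is thus monotone in the starting point. It is also periodic, hence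
constant (`QuasiPolynomial₂.exists_leadingForm`). Its degree is at most d-1 because the length is at
most dim A_m, which is O(m^{d-1}) by Noether normalization. In a domain, multiplication by powers of
a generator embeds graded pieces of A into those of the filtration, so growth of order d-1 occurs
along an interior ray.

Under (a), a numerator exists by a Hilbert–Serre argument with standard monomials: monomials in the
generators that are independent of lexicographically smaller ones of the same weight form a lower
set of exponents. Such a set has a rational generating function by Noetherian induction on lower
sets (`exists_polynomial_weightSeries`). -/

theorem ringKrullDim_eq_of_isIntegral_of_injective {R S : Type*} [CommRing R] [CommRing S]
    [Algebra R S] [Algebra.IsIntegral R S] (hinj : Function.Injective (algebraMap R S)) :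
    ringKrullDim S = ringKrullDim R := by
  refine le_antisymm (Order.krullDim_le_of_strictMono (PrimeSpectrum.comap (algebraMap R S)) ?_) ?_
  · intro P Q hPQ
    exact Ideal.IsIntegral.comap_lt_comap (R := R) (I := P.asIdeal) (J := Q.asIdeal) hPQ
  · refine iSup_le fun l => ?_
    obtain ⟨P, -, hP, hP'⟩ := Ideal.exists_ideal_over_prime_of_isIntegral (S := S)
      (l.head.asIdeal) ⊥ (by
        rw [show Ideal.comap (algebraMap R S) ⊥ = RingHom.ker (algebraMap R S) from rfl,
          (RingHom.injective_iff_ker_eq_bot _).1 hinj]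
        exact bot_le)
    have : P.LiesOver l.head.asIdeal := ⟨hP'.symm⟩
    obtain ⟨L, hL, -⟩ := Ideal.exists_ltSeries_of_hasGoingUp (S := S) l P
    rw [← hL]
    exact le_iSup (fun p : LTSeries (PrimeSpectrum S) => ((p.length : ℕ∞) : WithBot ℕ∞)) L

section StandardGraded

variable {k A : Type*} [Field k] [CommRing A] [Algebra k A]
    {𝒜 : ℕ → Submodule k A} [GradedAlgebra 𝒜]

theorem IsStandardGraded.eq_pow (hA : IsStandardGraded 𝒜) (m : ℕ) : 𝒜 m = 𝒜 1 ^ m := by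
  have hle : ∀ n, 𝒜 1 ^ n ≤ 𝒜 n := by
    intro n
    induction n with
    | zero => rw [pow_zero, hA.zero_eq]
    | succ n ih =>
      rw [pow_succ, Submodule.mul_le]
      intro a ha b hb
      exact SetLike.mul_mem_graded (ih ha) hb
  refine le_antisymm ?_ (hle m)
  have key : ∀ a : A, (decompose 𝒜 a m : A) ∈ 𝒜 1 ^ m := by
    intro a
    have ha : a ∈ Submodule.span k (Submonoid.closure (𝒜 1 : Set A) : Set A) := by
      rw [← Algebra.adjoin_eq_span, hA.adjoin_one]; trivial
    induction ha using Submodule.span_induction with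
    | mem x hx =>
      obtain ⟨n, hn⟩ : ∃ n, x ∈ 𝒜 1 ^ n := by
        induction hx using Submonoid.closure_induction with
        | mem x hx => exact ⟨1, by simpa using hx⟩
        | one => exact ⟨0, by simp [Submodule.mem_one]; exact ⟨1, by simp⟩⟩
        | mul x y _ _ hx hy =>
          obtain ⟨n, hn⟩ := hx
          obtain ⟨n', hn'⟩ := hy
          exact ⟨n + n', by rw [pow_add]; exact Submodule.mul_mem_mul hn hn'⟩
      by_cases h : n = m
      · subst h
        rwa [decompose_of_mem_same 𝒜 (hle _ hn)]
      · rw [decompose_of_mem_ne 𝒜 (hle _ hn) h]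
        exact zero_mem _
    | zero => simp
    | add x y _ _ hx hy => simpa using add_mem hx hy
    | smul c x _ hx =>
      rw [decompose_smul]
      exact Submodule.smul_mem _ c hx
  intro a ha
  simpa [decompose_of_mem_same 𝒜 ha] using key a

theorem IsStandardGraded.finite (hA : IsStandardGraded 𝒜) (m : ℕ) : Module.Finite k (𝒜 m) := by
  rw [hA.eq_pow, Module.Finite.iff_fg]
  have := hA.finite_one
  exact Submodule.FG.pow (Module.Finite.iff_fg.1 this) m

/-- A nonzero element is not annihilated by `A₁` if the depth is positive. -/
theorem IsStandardGraded.eq_zero_of_forall_mul_eq_zero (hA : IsStandardGraded 𝒜)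
    (hdepth : 0 < gradedDepth 𝒜) {a : A} (ha : ∀ x ∈ 𝒜 1, x * a = 0) : a = 0 := by
  obtain ⟨rs, ⟨hreg, hmem⟩, hlen⟩ : ∃ rs : List A, (RingTheory.Sequence.IsRegular A rs ∧
      ∀ x ∈ rs, x ∈ (HomogeneousIdeal.irrelevant 𝒜).toIdeal) ∧ 0 < rs.length := by
    by_contra! h
    refine hdepth.ne' ?_
    unfold gradedDepth
    simp only [ENat.iSup_eq_zero]
    intro rs hrs
    exact_mod_cast Nat.le_zero.1 (h rs hrs)
  match rs, hreg, hmem, hlen with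
  | z :: rs, hreg, hmem, _ =>
    have hz := ((RingTheory.Sequence.isRegular_cons_iff A z rs).1 hreg).1
    have hz0 : z ∈ HomogeneousIdeal.irrelevant 𝒜 := hmem z (by simp)
    rw [HomogeneousIdeal.mem_irrelevant_iff] at hz0
    -- The regular element z has only components of positive degree, and these are sums of products
    -- with a factor in A₁. So z would kill a.
    have hpos : ∀ m, 1 ≤ m → ∀ x ∈ 𝒜 m, x * a = 0 := by
      intro m hm x hx
      obtain ⟨m, rfl⟩ := Nat.exists_eq_add_of_le' hm
      rw [hA.eq_pow, pow_succ] at hx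
      induction hx using Submodule.mul_induction_on' with
      | mem_mul_mem x _ y hy => rw [mul_assoc, ha y hy, mul_zero]
      | add x _ y _ hx hy => rw [add_mul, hx, hy, add_zero]
    apply hz
    simp only [smul_eq_mul, mul_zero]
    classical
    rw [← DirectSum.sum_support_decompose 𝒜 z, Finset.sum_mul]
    refine Finset.sum_eq_zero fun m _ => ?_
    rcases Nat.eq_zero_or_pos m with rfl | hm
    · have : (decompose 𝒜 z 0 : A) = 0 := hz0
      rw [this, zero_mul]
    · exact hpos m hm _ (SetLike.coe_mem _)

/-- If a polynomial with coefficients in `S` is a nonzerodivisor, then `dim V ≤ dim W` as soon as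
`S V ⊆ W`. -/
theorem finrank_le_of_mem_nonZeroDivisors {V W : Submodule k A} [Module.Finite k V]
    [Module.Finite k W] (f : Polynomial A) (hf : f ∈ nonZeroDivisors (Polynomial A))
    (hVW : ∀ n, ∀ v ∈ V, f.coeff n * v ∈ W) : Module.finrank k V ≤ Module.finrank k W := by
  classical
  let _ : Algebra (Polynomial k) (Polynomial A) :=
    (Polynomial.mapRingHom (algebraMap k A)).toAlgebra
  have hsmul : ∀ (p : Polynomial k) (g : Polynomial A),
      p • g = Polynomial.map (algebraMap k A) p * g := fun p g => rfl
  let v := Module.finBasis k V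
  let w := Module.finBasis k W
  -- The f·v_i are independent over k[X] because f is a nonzerodivisor, and they lie in the
  -- k[X]-span of a basis of W. Comparing ranks over k[X] gives the inequality.
  let u : Fin (Module.finrank k V) → Polynomial A := fun i => f * Polynomial.C (v i : A)
  have hu : LinearIndependent (Polynomial k) u := by
    rw [Fintype.linearIndependent_iff]
    intro p hp i
    have h1 : f * ∑ i, Polynomial.map (algebraMap k A) (p i) * Polynomial.C (v i : A) = 0 := by
      rw [← hp, Finset.mul_sum]
      refine Finset.sum_congr rfl fun i _ => ?_
      rw [hsmul]; ring
    have h2 := (mem_nonZeroDivisors_iff.1 hf).1 _ h1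
    ext n
    have h3 := congrArg (fun q => Polynomial.coeff q n) h2
    simp only [Polynomial.finsetSum_coeff, Polynomial.coeff_mul_C, Polynomial.coeff_map,
      Polynomial.coeff_zero] at h3
    have h4 : ∑ i, (p i).coeff n • v i = 0 := by
      apply Subtype.ext
      simpa [Algebra.smul_def] using h3
    simpa using Fintype.linearIndependent_iff.1 v.linearIndependent _ h4 i
  let N := Submodule.span (Polynomial k)
    (Set.range fun i => (Polynomial.C (w i : A) : Polynomial A))
  have hN : ∀ x ∈ W, ∀ n, (Polynomial.monomial n x : Polynomial A) ∈ N := by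
    intro x hx n
    have : x = ∑ i, (w.repr ⟨x, hx⟩ i) • (w i : A) := by
      simpa only [map_sum, map_smul, Submodule.subtype_apply] using
        (congrArg W.subtype (w.sum_repr ⟨x, hx⟩)).symm
    rw [this, map_sum]
    refine Submodule.sum_mem _ fun i _ => ?_
    have : (Polynomial.monomial n (w.repr ⟨x, hx⟩ i • (w i : A)) : Polynomial A) =
        (Polynomial.monomial n (w.repr ⟨x, hx⟩ i) : Polynomial k) • Polynomial.C (w i : A) := by
      rw [hsmul, Polynomial.map_monomial, Polynomial.monomial_mul_C, Algebra.smul_def]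
    rw [this]
    exact Submodule.smul_mem _ _ (Submodule.subset_span ⟨i, rfl⟩)
  have huN : ∀ i, u i ∈ N := by
    intro i
    rw [(u i).as_sum_support]
    refine Submodule.sum_mem _ fun n _ => hN _ ?_ n
    simp only [u, Polynomial.coeff_mul_C]
    exact hVW n _ (v i).2
  have h5 : LinearIndependent (Polynomial k) (fun i => (⟨u i, huN i⟩ : N)) :=
    LinearIndependent.of_comp N.subtype (by exact hu)
  have : Module.Finite (Polynomial k) N := Module.Finite.span_of_finite _ (Set.finite_range _)
  calc Module.finrank k V = Fintype.card (Fin (Module.finrank k V)) := by simp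
    _ ≤ Module.finrank (Polynomial k) N := h5.fintype_card_le_finrank
    _ ≤ Fintype.card (Fin (Module.finrank k W)) := finrank_range_le_card _
    _ = _ := by simp

instance bigradedPiece_finite (𝒜 : ℕ → Submodule k A) (m : ℕ) [Module.Finite k (𝒜 m)]
    (J : Submodule k A) : Module.Finite k (J ⊓ 𝒜 m : Submodule k A) :=
  Submodule.finiteDimensional_of_le inf_le_right

/-- Over a finite field A₁ may contain no nonzerodivisor, so a generic linear form Σ v_i X^i with
coefficients a basis of A₁ takes its place. By McCoy's theorem a zero divisor in A[X] is killed by a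
nonzero constant; that constant would annihilate A₁, against positive depth. -/
theorem bigradedLength_le_succ_left (hA : IsStandardGraded 𝒜) (hdepth : 0 < gradedDepth 𝒜)
    (I : ℕ → Ideal A) (m n : ℕ) : bigradedLength 𝒜 I m n ≤ bigradedLength 𝒜 I (m + 1) n := by
  have := hA.finite
  let v := Module.finBasis k (𝒜 1)
  let f : Polynomial A := 
    ∑ i : Fin (Module.finrank k (𝒜 1)), Polynomial.monomial (i : ℕ) (v i : A)
  have hcoeff : ∀ i : Fin (Module.finrank k (𝒜 1)), f.coeff i = v i := by
    intro i
    simp [f, Polynomial.finsetSum_coeff, Polynomial.coeff_monomial, Fin.val_inj]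
  have hcoeff' : ∀ n, f.coeff n ∈ 𝒜 1 := by
    intro n
    simp only [f, Polynomial.finsetSum_coeff, Polynomial.coeff_monomial]
    refine Submodule.sum_mem _ fun i _ => ?_
    split_ifs
    exacts [(v i).2, zero_mem _]
  refine finrank_le_of_mem_nonZeroDivisors f ?_ ?_
  · by_contra hf
    obtain ⟨a, ha, haf⟩ := Polynomial.notMem_nonZeroDivisors_iff.1 hf
    refine ha (hA.eq_zero_of_forall_mul_eq_zero hdepth fun x hx => ?_)
    have hx' : x = ∑ i, (v.repr ⟨x, hx⟩ i) • (v i : A) := by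
      simpa only [map_sum, map_smul, Submodule.subtype_apply] using
        (congrArg (𝒜 1).subtype (v.sum_repr ⟨x, hx⟩)).symm
    rw [hx', Finset.sum_mul]
    refine Finset.sum_eq_zero fun i _ => ?_
    have := congrArg (fun q => Polynomial.coeff q i) haf
    simp only [Polynomial.coeff_smul, hcoeff, smul_eq_mul, Polynomial.coeff_zero] at this
    rw [smul_mul_assoc, mul_comm, this, smul_zero]
  · rintro j x ⟨hx, hx'⟩
    refine ⟨Ideal.mul_mem_left _ _ hx, ?_⟩
    rw [add_comm]
    exact SetLike.mul_mem_graded (hcoeff' j) hx'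

theorem bigradedLength_succ_right_le (hA : IsStandardGraded 𝒜)
    {I : ℕ → Ideal A} (hI : IsHomogeneousFiltration 𝒜 I) (m n : ℕ) :
    bigradedLength 𝒜 I m (n + 1) ≤ bigradedLength 𝒜 I m n := by
  have := hA.finite
  exact Submodule.finrank_mono (inf_le_inf_right _ fun x hx => hI.succ_le n hx)

theorem bigradedLength_zero_right {I : ℕ → Ideal A} (hI : IsHomogeneousFiltration 𝒜 I) (m : ℕ) :
    bigradedLength 𝒜 I m 0 = Module.finrank k (𝒜 m) := by
  unfold bigradedLength
  rw [hI.zero_eq_top, Submodule.restrictScalars_top, top_inf_eq]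

end StandardGraded

end

/-! ### Growth of the graded pieces via Noether normalization -/

section

open DirectSum

theorem MvPolynomial.finrank_restrictDegree (k : Type*) [Field k] (s t : ℕ) :
    Module.finrank k (MvPolynomial.restrictDegree (Fin s) k t) = (t + 1) ^ s := by
  classical
  let e : {a : Fin s →₀ ℕ | ∀ i, a i ≤ t} ≃ (Fin s → Fin (t + 1)) :=
    { toFun := fun a i => ⟨a.1 i, Nat.lt_succ_of_le (a.2 i)⟩
      invFun := fun f => ⟨Finsupp.equivFunOnFinite.symm fun i => (f i : ℕ),
        fun i => Nat.le_of_lt_succ (f i).2⟩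
      left_inv := fun a => by ext; simp
      right_inv := fun f => by ext; simp }
  rw [MvPolynomial.restrictDegree,
    Module.finrank_eq_nat_card_basis (MvPolynomial.basisRestrictSupport k _), Nat.card_congr e]
  simp

theorem MvPolynomial.mul_mem_restrictDegree {k σ : Type*} [Field k] {a b : ℕ}
    {p q : MvPolynomial σ k} (hp : p ∈ MvPolynomial.restrictDegree σ k a)
    (hq : q ∈ MvPolynomial.restrictDegree σ k b) :
    p * q ∈ MvPolynomial.restrictDegree σ k (a + b) := by
  classical
  rw [MvPolynomial.mem_restrictDegree] at *
  intro c hc i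
  obtain ⟨x, hx, y, hy, rfl⟩ := Finset.mem_add.1 (MvPolynomial.support_mul p q hc)
  exact add_le_add (hp x hx i) (hq y hy i)

theorem MvPolynomial.restrictDegree_mono {k σ : Type*} [Field k] {a b : ℕ} (h : a ≤ b) :
    MvPolynomial.restrictDegree σ k a ≤ MvPolynomial.restrictDegree σ k b := by
  intro p hp
  rw [MvPolynomial.mem_restrictDegree] at *
  exact fun c hc i => (hp c hc i).trans h

theorem MvPolynomial.mem_restrictDegree_totalDegree {k σ : Type*} [Field k]
    (p : MvPolynomial σ k) : p ∈ MvPolynomial.restrictDegree σ k p.totalDegree :=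
  MvPolynomial.restrictTotalDegree_le_restrictDegree _ _ _
    ((MvPolynomial.mem_restrictTotalDegree _ _ _).2 le_rfl)

section Growth

variable {k A : Type*} [Field k] [CommRing A] [Algebra k A]
    {𝒜 : ℕ → Submodule k A} [GradedAlgebra 𝒜]

/-- The sum of the graded pieces of degree at most `M`. -/
def gradedTrunc (𝒜 : ℕ → Submodule k A) (M : ℕ) : Submodule k A := ⨆ i : Fin (M + 1), 𝒜 i

theorem le_gradedTrunc (𝒜 : ℕ → Submodule k A) {i M : ℕ} (h : i ≤ M) : 𝒜 i ≤ gradedTrunc 𝒜 M :=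
  le_iSup (fun i : Fin (M + 1) => 𝒜 i) ⟨i, Nat.lt_succ_of_le h⟩

theorem gradedTrunc_mono (𝒜 : ℕ → Submodule k A) {M N : ℕ} (h : M ≤ N) :
    gradedTrunc 𝒜 M ≤ gradedTrunc 𝒜 N :=
  iSup_le fun i => le_gradedTrunc 𝒜 ((Nat.le_of_lt_succ i.2).trans h)

theorem gradedTrunc_mul_le (M N : ℕ) :
    gradedTrunc 𝒜 M * gradedTrunc 𝒜 N ≤ gradedTrunc 𝒜 (M + N) := by
  unfold gradedTrunc
  rw [Submodule.iSup_mul]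
  refine iSup_le fun i => ?_
  rw [Submodule.mul_iSup]
  refine iSup_le fun j => ?_
  refine le_trans (Submodule.mul_le.2 fun a ha b hb => SetLike.mul_mem_graded ha hb)
    (le_gradedTrunc 𝒜 (i := i + j) ?_)
  have := i.2; have := j.2; omega

theorem pow_mem_gradedTrunc {a : A} {M : ℕ} (ha : a ∈ gradedTrunc 𝒜 M) (n : ℕ) :
    a ^ n ∈ gradedTrunc 𝒜 (M * n) := by
  induction n with
  | zero => exact le_gradedTrunc 𝒜 le_rfl (by simpa using SetLike.GradedOne.one_mem)
  | succ n ih =>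
    rw [pow_succ, Nat.mul_succ]
    exact gradedTrunc_mul_le _ _ (Submodule.mul_mem_mul ih ha)

theorem exists_mem_gradedTrunc (a : A) : ∃ M, a ∈ gradedTrunc 𝒜 M := by
  classical
  refine ⟨(decompose 𝒜 a).support.sup id, ?_⟩
  have h := DirectSum.sum_support_decompose 𝒜 a
  refine (congrArg (· ∈ gradedTrunc 𝒜 _) h).mp (Submodule.sum_mem _ fun i hi => ?_)
  exact
    le_gradedTrunc 𝒜 (Finset.le_sup (f := id) hi) (SetLike.coe_mem _)

/-- The sum map from the product of the graded pieces of degree at most `M`. -/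
noncomputable def gradedSum (𝒜 : ℕ → Submodule k A) (M : ℕ) :
    (∀ i : Fin (M + 1), 𝒜 i) →ₗ[k] A :=
  ∑ i : Fin (M + 1), (𝒜 i).subtype ∘ₗ LinearMap.proj i

theorem gradedSum_apply (𝒜 : ℕ → Submodule k A) (M : ℕ) (a : ∀ i : Fin (M + 1), 𝒜 i) :
    gradedSum 𝒜 M a = ∑ i, (a i : A) := by
  simp [gradedSum]

theorem gradedSum_injective (M : ℕ) : Function.Injective (gradedSum 𝒜 M) := by
  rw [← LinearMap.ker_eq_bot, LinearMap.ker_eq_bot']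
  intro a ha
  rw [gradedSum_apply] at ha
  funext i
  have h := congrArg (GradedRing.proj 𝒜 i) ha
  rw [map_sum, map_zero, Finset.sum_eq_single i] at h
  · rw [GradedRing.proj_apply, decompose_of_mem_same 𝒜 (a i).2] at h
    exact Subtype.ext h
  · intro j _ hj
    rw [GradedRing.proj_apply, decompose_of_mem_ne 𝒜 (a j).2 fun h => hj (Fin.ext h)]
  · simp

theorem range_gradedSum (𝒜 : ℕ → Submodule k A) (M : ℕ) : LinearMap.range (gradedSum 𝒜 M) = gradedTrunc 𝒜 M := by
  apply le_antisymm
  · rintro _ ⟨a, rfl⟩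
    rw [gradedSum_apply]
    exact Submodule.sum_mem _ fun i _ =>
      le_gradedTrunc 𝒜 (Nat.le_of_lt_succ i.2) (a i).2
  · refine iSup_le fun i x hx => ⟨Pi.single i ⟨x, hx⟩, ?_⟩
    rw [gradedSum_apply, Finset.sum_eq_single i]
    · simp
    · intro j _ hj
      simp [Pi.single_eq_of_ne hj]
    · simp

theorem IsStandardGraded.finrank_gradedTrunc (hA : IsStandardGraded 𝒜) (M : ℕ) :
    Module.finrank k (gradedTrunc 𝒜 M) = ∑ i ∈ Finset.range (M + 1), Module.finrank k (𝒜 i) := by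
  have := hA.finite
  rw [← range_gradedSum 𝒜, LinearMap.finrank_range_of_inj (gradedSum_injective M),
    Module.finrank_pi_fintype, Finset.sum_range]

theorem IsStandardGraded.finite_gradedTrunc (hA : IsStandardGraded 𝒜) (M : ℕ) :
    Module.Finite k (gradedTrunc 𝒜 M) := by
  have := hA.finite
  rw [← range_gradedSum]
  infer_instance

theorem IsStandardGraded.finiteType (hA : IsStandardGraded 𝒜) : Algebra.FiniteType k A := by
  obtain ⟨S, hS⟩ := Module.Finite.iff_fg.1 hA.finite_one
  refine ⟨⟨S, ?_⟩⟩
  rw [eq_top_iff, ← hA.adjoin_one, ← hS]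
  exact Algebra.adjoin_le (Algebra.span_le_adjoin k _)

/-- The number of variables in a Noether normalization is the dimension, since integral extensions
preserve it. -/
theorem IsStandardGraded.exists_finite_injective (hA : IsStandardGraded 𝒜) {d : ℕ}
    (hd : ringKrullDim A = d) : ∃ g : MvPolynomial (Fin d) k →ₐ[k] A,
      Function.Injective g ∧ g.Finite := by
  have : Nontrivial A := by
    by_contra h
    rw [not_nontrivial_iff_subsingleton] at h
    rw [ringKrullDim_eq_bot_of_subsingleton] at hd
    simp at hd
  have := hA.finiteType
  obtain ⟨s, g, hg, hfin⟩ := exists_finite_inj_algHom_of_fg k A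
  have hs : s = d := by
    algebraize [g.toRingHom]
    have hfin' : Module.Finite (MvPolynomial (Fin s) k) A := hfin
    have h1 := ringKrullDim_eq_of_isIntegral_of_injective (R := MvPolynomial (Fin s) k) (S := A) hg
    rw [hd, MvPolynomial.ringKrullDim_of_isNoetherianRing, ringKrullDim_eq_zero_of_field] at h1
    simp only [Nat.card_eq_fintype_card, Fintype.card_fin, zero_add] at h1
    exact_mod_cast h1.symm
  subst hs
  exact ⟨g, hg, hfin⟩

/-- The normalization need not be graded. Instead A is filtered by the spaces U t of combinations of
the module generators with coefficients of degree at most t in each variable. Multiplication by A₁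
raises t by a bounded amount δ, so A_m lies in U (δ(m+1)). -/
theorem IsStandardGraded.exists_sum_finrank_le (hA : IsStandardGraded 𝒜) {d : ℕ}
    (hd : ringKrullDim A = d) :
    ∃ C, ∀ M, ∑ i ∈ Finset.range (M + 1), Module.finrank k (𝒜 i) ≤ C * (M + 1) ^ d := by
  obtain ⟨g, -, hfin⟩ := hA.exists_finite_injective hd
  algebraize [g.toRingHom]
  have hfin' : Module.Finite (MvPolynomial (Fin d) k) A := hfin
  obtain ⟨n, w, hw⟩ := Module.Finite.exists_fin (R := MvPolynomial (Fin d) k) (M := A)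
  have hrep : ∀ a : A, ∃ b : Fin n → MvPolynomial (Fin d) k, ∑ i, g (b i) * w i = a := by
    intro a
    have : a ∈ Submodule.span (MvPolynomial (Fin d) k) (Set.range w) := by rw [hw]; trivial
    obtain ⟨b, hb⟩ := (Submodule.mem_span_range_iff_exists_fun _).1 this
    exact ⟨b, hb⟩
  let Φ : (Fin n → MvPolynomial (Fin d) k) →ₗ[k] A :=
    ∑ i, LinearMap.mulRight k (w i) ∘ₗ g.toLinearMap ∘ₗ LinearMap.proj i
  have hΦ : ∀ b, Φ b = ∑ i, g (b i) * w i := fun b => by simp [Φ]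
  let U : ℕ → Submodule k A := fun t =>
    LinearMap.range (Φ ∘ₗ LinearMap.pi fun i : Fin n =>
      (MvPolynomial.restrictDegree (Fin d) k t).subtype ∘ₗ LinearMap.proj i)
  have hU : ∀ t a, a ∈ U t ↔ ∃ b : Fin n → MvPolynomial (Fin d) k,
      (∀ i, b i ∈ MvPolynomial.restrictDegree (Fin d) k t) ∧ ∑ i, g (b i) * w i = a := by
    intro t a
    constructor
    · rintro ⟨b, rfl⟩
      exact ⟨fun i => b i, fun i => (b i).2, by simp [hΦ]⟩
    · rintro ⟨b, hb, rfl⟩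
      exact ⟨fun i => ⟨b i, hb i⟩, by simp [hΦ]⟩
  have hUmono : ∀ {t t'}, t ≤ t' → U t ≤ U t' := by
    intro t t' h a ha
    obtain ⟨b, hb, rfl⟩ := (hU _ _).1 ha
    exact (hU _ _).2 ⟨b, fun i => MvPolynomial.restrictDegree_mono h (hb i), rfl⟩
  have hUex : ∀ a, ∃ t, a ∈ U t := by
    intro a
    obtain ⟨b, hb⟩ := hrep a
    refine ⟨Finset.univ.sup fun i => (b i).totalDegree, (hU _ _).2 ⟨b, fun i => ?_, hb⟩⟩
    exact MvPolynomial.restrictDegree_mono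
      (Finset.le_sup (f := fun i => (b i).totalDegree) (Finset.mem_univ i))
      (MvPolynomial.mem_restrictDegree_totalDegree _)
  have hUfin : ∀ t, Module.Finite k (U t) := fun t => Module.Finite.range _
  have hUrank : ∀ t, Module.finrank k (U t) ≤ n * (t + 1) ^ d := by
    intro t
    refine (LinearMap.finrank_range_le _).trans ?_
    rw [Module.finrank_pi_fintype]
    simp [MvPolynomial.finrank_restrictDegree]
  have hfin1 := hA.finite_one
  let v := Module.finBasis k (𝒜 1)
  choose τ hτ using hUex
  -- One bound for 1 and for all products of a basis vector of A₁ with a module generator.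
  let δ := max (τ 1) (Finset.univ.sup fun ij : Fin (Module.finrank k (𝒜 1)) × Fin n =>
    τ (v ij.1 * w ij.2))
  have hδ1 : (1 : A) ∈ U δ := hUmono (le_max_left _ _) (hτ 1)
  have hδ2 : ∀ x ∈ 𝒜 1, ∀ j, x * w j ∈ U δ := by
    intro x hx j
    have hx' : x = ∑ i, (v.repr ⟨x, hx⟩ i) • (v i : A) := by
      simpa only [map_sum, map_smul, Submodule.subtype_apply] using
        (congrArg (𝒜 1).subtype (v.sum_repr ⟨x, hx⟩)).symm
    rw [hx', Finset.sum_mul]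
    refine Submodule.sum_mem _ fun i _ => ?_
    rw [smul_mul_assoc]
    refine Submodule.smul_mem _ _ (hUmono ((Finset.le_sup (f := fun ij : Fin _ × Fin n =>
      τ (v ij.1 * w ij.2)) (Finset.mem_univ (i, j))).trans (le_max_right _ _)) (hτ _))
  have hmulg : ∀ t t' (p : MvPolynomial (Fin d) k), p ∈ MvPolynomial.restrictDegree (Fin d) k t →
      ∀ a ∈ U t', g p * a ∈ U (t + t') := by
    intro t t' p hp a ha
    obtain ⟨b, hb, rfl⟩ := (hU _ _).1 ha
    refine (hU _ _).2 ⟨fun i => p * b i, fun i => MvPolynomial.mul_mem_restrictDegree hp (hb i), ?_⟩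
    simp [Finset.mul_sum, mul_assoc]
  have hmulx : ∀ t, ∀ x ∈ 𝒜 1, ∀ a ∈ U t, a * x ∈ U (t + δ) := by
    intro t x hx a ha
    obtain ⟨b, hb, rfl⟩ := (hU _ _).1 ha
    rw [Finset.sum_mul]
    refine Submodule.sum_mem _ fun i _ => ?_
    rw [mul_assoc, mul_comm (w i)]
    exact hmulg _ _ _ (hb i) _ (hδ2 x hx i)
  have hpiece : ∀ m, 𝒜 m ≤ U (δ * (m + 1)) := by
    intro m
    induction m with
    | zero =>
      rw [hA.zero_eq]
      rintro x hx
      obtain ⟨c, rfl⟩ := Submodule.mem_one.1 hx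
      rw [zero_add, mul_one, Algebra.algebraMap_eq_smul_one]
      exact Submodule.smul_mem _ _ hδ1
    | succ m ih =>
      rw [hA.eq_pow, pow_succ, ← hA.eq_pow, Submodule.mul_le]
      intro a ha x hx
      exact hmulx _ x hx a (ih ha)
  refine ⟨n * (δ + 1) ^ d, fun M => ?_⟩
  rw [← hA.finrank_gradedTrunc]
  calc Module.finrank k (gradedTrunc 𝒜 M) ≤ Module.finrank k (U (δ * (M + 1))) :=
        Submodule.finrank_mono (iSup_le fun i => (hpiece i).trans
          (hUmono (Nat.mul_le_mul_left _ (by have := i.2; omega))))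
    _ ≤ n * (δ * (M + 1) + 1) ^ d := hUrank _
    _ ≤ n * ((δ + 1) * (M + 1)) ^ d := by
        gcongr
        nlinarith
    _ = _ := by rw [mul_pow, mul_assoc]

/-- The (t+1)^d-dimensional space of polynomials of degree at most t in each of d variables embeds
into the part of A of degree at most δdt, where δ bounds the degrees occurring in the images of the
variables. -/
theorem IsStandardGraded.exists_le_sum_finrank (hA : IsStandardGraded 𝒜) {d : ℕ}
    (hd : ringKrullDim A = d) :
    ∃ κ, ∀ t, (t + 1) ^ d ≤ ∑ i ∈ Finset.range (κ * t + 1), Module.finrank k (𝒜 i) := by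
  obtain ⟨g, hg, -⟩ := hA.exists_finite_injective hd
  choose τ hτ using fun a : A => exists_mem_gradedTrunc (𝒜 := 𝒜) a
  let δ := Finset.univ.sup fun i : Fin d => τ (g (MvPolynomial.X i))
  have hδ : ∀ i, g (MvPolynomial.X i) ∈ gradedTrunc 𝒜 δ := fun i =>
    gradedTrunc_mono 𝒜 (Finset.le_sup (f := fun i : Fin d => τ (g (MvPolynomial.X i)))
      (Finset.mem_univ i)) (hτ _)
  refine ⟨δ * d, fun t => ?_⟩
  have := hA.finite_gradedTrunc (δ * d * t)
  rw [← hA.finrank_gradedTrunc, ← MvPolynomial.finrank_restrictDegree k d t,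
    ← LinearMap.finrank_range_of_inj (f := g.toLinearMap ∘ₗ
      (MvPolynomial.restrictDegree (Fin d) k t).subtype) (hg.comp Subtype.val_injective)]
  refine Submodule.finrank_mono ?_
  rintro _ ⟨⟨p, hp⟩, rfl⟩
  rw [MvPolynomial.mem_restrictDegree] at hp
  change g p ∈ _
  rw [p.as_sum, map_sum]
  refine Submodule.sum_mem _ fun a ha => ?_
  rw [MvPolynomial.monomial_eq, map_mul, ← MvPolynomial.algebraMap_eq, AlgHom.commutes,
    ← Algebra.smul_def]
  refine Submodule.smul_mem _ _ ?_
  rw [Finsupp.prod_fintype _ _ (fun i => pow_zero _), map_prod]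
  have key : ∀ S : Finset (Fin d), ∏ i ∈ S, g (MvPolynomial.X i ^ a i) ∈
      gradedTrunc 𝒜 (S.card * (δ * t)) := by
    intro S
    induction S using Finset.induction_on with
    | empty => simpa using le_gradedTrunc 𝒜 le_rfl (SetLike.GradedOne.one_mem (A := 𝒜))
    | insert i S hi ih =>
      rw [Finset.prod_insert hi, Finset.card_insert_of_notMem hi, add_mul, one_mul, add_comm]
      refine gradedTrunc_mul_le _ _ (Submodule.mul_mem_mul ?_ ih)
      rw [map_pow]
      exact gradedTrunc_mono 𝒜 (Nat.mul_le_mul_left _ (hp a ha i)) (pow_mem_gradedTrunc (hδ i) _)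
  have := key Finset.univ
  rw [Finset.card_univ, Fintype.card_fin, ← mul_assoc, mul_comm d] at this
  exact this

/-- Monotonicity converts the bound on partial sums into one on single pieces: the m+1 pieces in
degrees m, …, 2m are all at least as large as A_m. -/
theorem IsStandardGraded.exists_finrank_le (hA : IsStandardGraded 𝒜) {d : ℕ}
    (hd : ringKrullDim A = d) (hd1 : 1 ≤ d)
    (hmono : Monotone fun m => Module.finrank k (𝒜 m)) :
    ∃ C, ∀ m, Module.finrank k (𝒜 m) ≤ C * (m + 1) ^ (d - 1) := by
  obtain ⟨C, hC⟩ := hA.exists_sum_finrank_le hd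
  refine ⟨C * 2 ^ d, fun m => ?_⟩
  have h1 : (m + 1) * Module.finrank k (𝒜 m) ≤
      ∑ i ∈ Finset.range (2 * m + 1), Module.finrank k (𝒜 i) := by
    calc (m + 1) * Module.finrank k (𝒜 m)
        = ∑ i ∈ Finset.Ico m (2 * m + 1), Module.finrank k (𝒜 m) := by
          rw [Finset.sum_const, Nat.card_Ico, smul_eq_mul]; congr 1; omega
      _ ≤ ∑ i ∈ Finset.Ico m (2 * m + 1), Module.finrank k (𝒜 i) :=
          Finset.sum_le_sum fun i hi => hmono (Finset.mem_Ico.1 hi).1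
      _ ≤ _ := Finset.sum_le_sum_of_subset fun i hi =>
          Finset.mem_range.2 (Finset.mem_Ico.1 hi).2
  refine Nat.le_of_mul_le_mul_left (h1.trans ((hC (2 * m)).trans ?_)) (Nat.succ_pos m)
  obtain ⟨e, rfl⟩ := Nat.exists_eq_add_of_le' hd1
  rw [Nat.add_sub_cancel]
  calc C * (2 * m + 1) ^ (e + 1) ≤ C * (2 * (m + 1)) ^ (e + 1) := by gcongr; omega
    _ = _ := by rw [mul_pow, pow_succ (m + 1)]; ring

/-- Conversely, the top piece is at least the average of the pieces below it, which costs a factor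
linear in t. -/
theorem IsStandardGraded.exists_le_finrank (hA : IsStandardGraded 𝒜) {d : ℕ}
    (hd : ringKrullDim A = d) (hd1 : 1 ≤ d)
    (hmono : Monotone fun m => Module.finrank k (𝒜 m)) :
    ∃ κ, 1 ≤ κ ∧ ∀ t, (t + 1) ^ (d - 1) ≤ κ * Module.finrank k (𝒜 (κ * t)) := by
  obtain ⟨κ, hκ⟩ := hA.exists_le_sum_finrank hd
  refine ⟨κ + 1, by omega, fun t => ?_⟩
  have h1 : ∑ i ∈ Finset.range (κ * t + 1), Module.finrank k (𝒜 i) ≤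
      (κ * t + 1) * Module.finrank k (𝒜 (κ * t)) := by
    calc _ ≤ ∑ i ∈ Finset.range (κ * t + 1), Module.finrank k (𝒜 (κ * t)) :=
          Finset.sum_le_sum fun i hi => hmono (Nat.le_of_lt_succ (Finset.mem_range.1 hi))
      _ = _ := by simp
  have h2 : Module.finrank k (𝒜 (κ * t)) ≤ Module.finrank k (𝒜 ((κ + 1) * t)) :=
    hmono (by nlinarith)
  refine le_of_mul_le_mul_left (a := t + 1) ?_ (Nat.succ_pos t)
  obtain ⟨e, rfl⟩ := Nat.exists_eq_add_of_le' hd1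
  rw [Nat.add_sub_cancel, mul_comm, ← pow_succ]
  refine ((hκ t).trans h1).trans ?_
  rw [← mul_assoc]
  exact Nat.mul_le_mul (by nlinarith) h2

end Growth

end

/-! ### Quasi-polynomials as functions with unipotent translations; summation along a vector -/

section

open Module Module.End

/-- Translation of functions on `ℤ²`. -/
noncomputable def translation (u : ℤ × ℤ) : Module.End ℚ (ℤ × ℤ → ℚ) :=
  LinearMap.funLeft ℚ ℚ fun w => w + u

theorem translation_apply (u : ℤ × ℤ) (f : ℤ × ℤ → ℚ) (w : ℤ × ℤ) :
    translation u f w = f (w + u) := rfl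

theorem translation_mul (u v : ℤ × ℤ) : translation u * translation v = translation (u + v) := by
  ext f w
  simp [translation_apply, add_assoc]

theorem translation_commute (u v : ℤ × ℤ) : Commute (translation u) (translation v) := by
  rw [Commute, SemiconjBy, translation_mul, translation_mul, add_comm]

theorem translation_zero : translation 0 = 1 := by
  ext f w
  simp [translation_apply]

/-- The functions on which translation by `u` acts unipotently. -/
noncomputable def unipotentSpace (u : ℤ × ℤ) : Submodule ℚ (ℤ × ℤ → ℚ) :=
  (translation u).maxGenEigenspace 1

theorem mem_unipotentSpace {u : ℤ × ℤ} {f : ℤ × ℤ → ℚ} :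
    f ∈ unipotentSpace u ↔ ∃ n : ℕ, ((translation u - 1) ^ n) f = 0 := by
  simp [unipotentSpace, Module.End.mem_maxGenEigenspace]

/-- With T_u the translation by u, T_{u+v} = (T_u - 1)T_v + T_v is a sum of commuting operators, the
first nilpotent and the second unipotent on f; generalized eigenvalues 0 and 1 add up to 1. -/
theorem unipotentSpace_add {u v : ℤ × ℤ} {f : ℤ × ℤ → ℚ} (hu : f ∈ unipotentSpace u)
    (hv : f ∈ unipotentSpace v) : f ∈ unipotentSpace (u + v) := by
  have hc : Commute (translation u - 1) (translation v) :=
    (translation_commute u v).sub_left (Commute.one_left _)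
  have hc' : Commute ((translation u - 1) * translation v) (translation v) :=
    hc.mul_left (Commute.refl _)
  have h := genEigenspace_inf_le_add ((translation u - 1) * translation v) (translation v)
    0 1 ⊤ ⊤ hc' (x := f) ⟨?_, hv⟩
  · rw [sub_mul, one_mul, sub_add_cancel, translation_mul, zero_add, top_add] at h
    exact h
  · obtain ⟨n, hn⟩ := mem_unipotentSpace.1 hu
    refine (Module.End.mem_maxGenEigenspace _ _ _).2 ⟨n, ?_⟩
    rw [zero_smul, sub_zero, hc.mul_pow, (hc.pow_pow n n).eq, Module.End.mul_apply, hn, map_zero]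

theorem unipotentSpace_neg {u : ℤ × ℤ} {f : ℤ × ℤ → ℚ} (hu : f ∈ unipotentSpace u) :
    f ∈ unipotentSpace (-u) := by
  obtain ⟨n, hn⟩ := mem_unipotentSpace.1 hu
  refine mem_unipotentSpace.2 ⟨n, ?_⟩
  have h : translation (-u) - 1 = -translation (-u) * (translation u - 1) := by
    ext f w
    simp [translation_apply]
  have hc : Commute (-translation (-u)) (translation u - 1) :=
    ((translation_commute _ _).neg_left).sub_right (Commute.one_right _)
  rw [h, hc.mul_pow, Module.End.mul_apply, hn, map_zero]

/-- The translations which act unipotently on `f` form a group. -/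
def unipotentGroup (f : ℤ × ℤ → ℚ) : AddSubgroup (ℤ × ℤ) where
  carrier := {u | f ∈ unipotentSpace u}
  zero_mem' := mem_unipotentSpace.2 ⟨1, by simp [translation_zero]⟩
  add_mem' := unipotentSpace_add
  neg_mem' := unipotentSpace_neg

theorem mem_unipotentGroup {f : ℤ × ℤ → ℚ} {u : ℤ × ℤ} :
    u ∈ unipotentGroup f ↔ f ∈ unipotentSpace u := Iff.rfl

/-- Quasi-polynomial functions on `ℤ²` of period `N`. -/
noncomputable def quasiPolySpace (N : ℤ) : Submodule ℚ (ℤ × ℤ → ℚ) :=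
  unipotentSpace (N, 0) ⊓ unipotentSpace (0, N)

theorem mem_unipotentSpace_of_mem_quasiPolySpace {N : ℤ} {f : ℤ × ℤ → ℚ}
    (hf : f ∈ quasiPolySpace N) (u : ℤ × ℤ) : f ∈ unipotentSpace (N • u) := by
  have h := add_mem (zsmul_mem (mem_unipotentGroup.2 hf.1) u.1)
    (zsmul_mem (mem_unipotentGroup.2 hf.2) u.2)
  rw [mem_unipotentGroup] at h
  convert h using 2
  ext <;> simp [mul_comm]

theorem quasiPolySpace_le_mul (N c : ℤ) : quasiPolySpace N ≤ quasiPolySpace (N * c) := by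
  intro f hf
  constructor
  · convert mem_unipotentSpace_of_mem_quasiPolySpace hf (c, 0) using 2
    simp
  · convert mem_unipotentSpace_of_mem_quasiPolySpace hf (0, c) using 2
    simp

theorem comp_translation_mem_unipotentSpace {u : ℤ × ℤ} {f : ℤ × ℤ → ℚ}
    (hf : f ∈ unipotentSpace u) (v : ℤ × ℤ) : translation v f ∈ unipotentSpace u := by
  obtain ⟨n, hn⟩ := mem_unipotentSpace.1 hf
  refine mem_unipotentSpace.2 ⟨n, ?_⟩
  have hc : Commute ((translation u - 1) ^ n) (translation v) :=
    ((translation_commute u v).sub_left (Commute.one_left _)).pow_left n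
  rw [← Module.End.mul_apply, hc.eq, Module.End.mul_apply, hn, map_zero]

theorem translation_mem_quasiPolySpace {N : ℤ} {f : ℤ × ℤ → ℚ} (hf : f ∈ quasiPolySpace N)
    (v : ℤ × ℤ) : translation v f ∈ quasiPolySpace N :=
  ⟨comp_translation_mem_unipotentSpace hf.1 v, comp_translation_mem_unipotentSpace hf.2 v⟩

theorem const_mem_quasiPolySpace (N : ℤ) (c : ℚ) : (fun _ => c) ∈ quasiPolySpace N := by
  constructor <;> refine mem_unipotentSpace.2 ⟨1, ?_⟩ <;>
  · ext w
    simp [translation_apply]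

/-- Quasi-polynomial functions on `ℤ²` of some period. -/
noncomputable def quasiPolyFunctions : Submodule ℚ (ℤ × ℤ → ℚ) where
  carrier := {f | ∃ N : ℤ, 0 < N ∧ f ∈ quasiPolySpace N}
  zero_mem' := ⟨1, one_pos, zero_mem _⟩
  add_mem' := by
    rintro f g ⟨N, hN, hf⟩ ⟨M, hM, hg⟩
    exact ⟨N * M, mul_pos hN hM, add_mem (quasiPolySpace_le_mul N M hf)
      (mul_comm M N ▸ quasiPolySpace_le_mul M N hg)⟩
  smul_mem' := by
    rintro c f ⟨N, hN, hf⟩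
    exact ⟨N, hN, Submodule.smul_mem _ c hf⟩

/-- The linear form `det (b, ·)`; it is positive to the left of `b`. -/
def detForm (b : ℤ × ℤ) : ℤ × ℤ →+ ℤ where
  toFun w := b.1 * w.2 - b.2 * w.1
  map_zero' := by simp
  map_add' x y := by simp; ring

theorem detForm_apply (b w : ℤ × ℤ) : detForm b w = b.1 * w.2 - b.2 * w.1 := rfl

/-- `G` is the indefinite sum of `g` along `v` which vanishes on the strip below the
line `ℓ_b = τ`. -/
structure IsStripSum (b : ℤ × ℤ) (τ : ℤ) (v : ℤ × ℤ) (g G : ℤ × ℤ → ℚ) : Prop where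
  sub_eq : ∀ w, G w - G (w - v) = g w
  strip : ∀ w, τ - detForm b v ≤ detForm b w → detForm b w < τ → G w = 0

/-- The strip has width det(b,v), so it meets every coset of ℤv. This is the uniqueness of strip
sums. -/
theorem eq_zero_of_strip {b v : ℤ × ℤ} {τ : ℤ} (hv : 0 < detForm b v) {K : ℤ × ℤ → ℚ}
    (hK : ∀ w, K w = K (w - v))
    (h0 : ∀ w, τ - detForm b v ≤ detForm b w → detForm b w < τ → K w = 0) : K = 0 := by
  have hK' : ∀ n : ℤ, ∀ w, K w = K (w - n • v) := by
    intro n w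
    induction n using Int.induction_on with
    | zero => simp
    | succ n ih => rw [ih, hK, add_smul, one_smul, sub_sub]
    | pred n ih => rw [ih, sub_smul, one_smul, ← sub_add, hK (w - _ + v), add_sub_cancel_right]
  funext w
  -- One step more than the quotient: the remainder then lands just below τ, not just above.
  rw [hK' ((detForm b w - τ) / detForm b v + 1) w]
  have h1 := Int.emod_nonneg (detForm b w - τ) hv.ne'
  have h2 := Int.emod_lt_of_pos (detForm b w - τ) hv
  have h3 := Int.emod_add_mul_ediv (detForm b w - τ) (detForm b v)
  apply h0 <;> rw [map_sub, map_zsmul, smul_eq_mul] <;> linarith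

theorem exists_int_sum (h : ℤ → ℚ) : ∃ S : ℤ → ℚ, S 0 = 0 ∧ ∀ n, S (n + 1) = S n + h n := by
  refine ⟨fun n => ∑ i ∈ Finset.Ico 0 n, h i - ∑ i ∈ Finset.Ico n 0, h i, by simp, fun n => ?_⟩
  beta_reduce
  rcases le_or_gt 0 n with hn | hn
  · have e : Finset.Ico 0 (n + 1) = insert n (Finset.Ico 0 n) := by ext; simp; omega
    rw [e, Finset.sum_insert (by simp), Finset.Ico_eq_empty (a := n) (by omega),
      Finset.Ico_eq_empty (a := n + 1) (by omega)]
    simp; ring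
  · have e : Finset.Ico n 0 = insert n (Finset.Ico (n + 1) 0) := by ext; simp; omega
    rw [e, Finset.sum_insert (by simp), Finset.Ico_eq_empty (b := n) (by omega),
      Finset.Ico_eq_empty (b := n + 1) (by omega)]
    simp

/-- Each line w + ℤv meets the strip exactly once. G sums g along the line from that point, in
either direction, and κ w counts the steps. -/
theorem exists_isStripSum (b : ℤ × ℤ) (τ : ℤ) {v : ℤ × ℤ} (hv : 0 < detForm b v)
    (g : ℤ × ℤ → ℚ) : ∃ G, IsStripSum b τ v g G := by
  choose S hS0 hS using exists_int_sum
  let c := detForm b v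
  let κ : ℤ × ℤ → ℤ := fun w => (detForm b w - τ) / c + 1
  refine ⟨fun w => S (fun i => g (w - κ w • v + (i + 1) • v)) (κ w), fun w => ?_,
    fun w h1 h2 => ?_⟩
  · have hκ : κ (w - v) = κ w - 1 := by
      simp only [κ]
      rw [map_sub, show detForm b w - detForm b v - τ = detForm b w - τ + (-1) * c by ring,
        Int.add_mul_ediv_right _ _ hv.ne']
      ring
    have hw : w - v - κ (w - v) • v = w - κ w • v := by
      rw [hκ, sub_smul, one_smul]; abel
    simp only [hw]
    rw [hκ]
    have := hS (fun i => g (w - κ w • v + (i + 1) • v)) (κ w - 1)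
    rw [sub_add_cancel] at this
    rw [this]
    simp
  · have : κ w = 0 := by
      simp only [κ]
      have : (detForm b w - τ) / detForm b v = -1 := by
        rw [Int.ediv_eq_iff_of_pos hv]
        constructor <;> linarith
      rw [this]
      rfl
    change S _ (κ w) = 0
    rw [this, hS0]

/-- Translation by u preserves the strip, so (T_u - 1)^n G vanishes there; it is v-invariant because
its difference along v is (T_u - 1)^n g = 0. Uniqueness forces it to be zero. -/
theorem IsStripSum.mem_unipotentSpace_of_detForm_eq_zero {b v : ℤ × ℤ} {τ : ℤ}
    {g G : ℤ × ℤ → ℚ} (hG : IsStripSum b τ v g G) (hv : 0 < detForm b v) {u : ℤ × ℤ}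
    (hu : detForm b u = 0) (hg : g ∈ unipotentSpace u) : G ∈ unipotentSpace u := by
  obtain ⟨n, hn⟩ := mem_unipotentSpace.1 hg
  refine mem_unipotentSpace.2 ⟨n, eq_zero_of_strip (τ := τ) hv (fun w => ?_) ?_⟩
  · have hc : Commute ((translation u - 1) ^ n) (1 - translation (-v)) :=
      (Commute.one_right _).sub_right
        (((translation_commute u (-v)).sub_left (Commute.one_left _)).pow_left n)
    have h1 : (1 - translation (-v)) G = g := by
      funext w
      simpa [translation_apply, sub_eq_add_neg] using hG.sub_eq w
    have h2 : (1 - translation (-v)) (((translation u - 1) ^ n) G) = 0 := by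
      rw [← Module.End.mul_apply, ← hc.eq, Module.End.mul_apply, h1, hn]
    have h3 := congrFun h2 w
    simp only [LinearMap.sub_apply, Module.End.one_apply, Pi.sub_apply, translation_apply,
      Pi.zero_apply, ← sub_eq_add_neg] at h3
    linarith
  · clear hn
    induction n with
    | zero => simpa using hG.strip
    | succ n ih =>
      intro w h1 h2
      rw [pow_succ', Module.End.mul_apply, LinearMap.sub_apply, Module.End.one_apply,
        Pi.sub_apply, translation_apply, ih w h1 h2, ih (w + u), sub_zero] <;>
      rw [map_add, hu, add_zero] <;> assumption

/-- Telescoping: (T_{nv} - 1)G is a sum of n translates of g, so one further power of the operator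
suffices. -/
theorem mem_unipotentSpace_of_sub_eq {v : ℤ × ℤ} {g G : ℤ × ℤ → ℚ}
    (hG : ∀ w, G w - G (w - v) = g w) {n : ℕ} (hg : g ∈ unipotentSpace (n • v)) :
    G ∈ unipotentSpace (n • v) := by
  obtain ⟨m, hm⟩ := mem_unipotentSpace.1 hg
  let S : Module.End ℚ (ℤ × ℤ → ℚ) := ∑ i ∈ Finset.range n, translation ((i + 1) • v)
  have h1 : (translation (n • v) - 1) G = S g := by
    funext w
    simp only [S, LinearMap.sub_apply, Module.End.one_apply, Pi.sub_apply, translation_apply,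
      LinearMap.sum_apply, Finset.sum_apply]
    have : ∀ n : ℕ, G (w + n • v) - G w = ∑ i ∈ Finset.range n, g (w + (i + 1) • v) := by
      intro n
      induction n with
      | zero => simp
      | succ n ih =>
        rw [Finset.sum_range_succ, ← ih, ← hG, add_smul n 1, one_smul,
          show w + (n • v + v) - v = w + n • v by abel]
        ring
    exact this n
  have hc : Commute ((translation (n • v) - 1) ^ m) S :=
    (Commute.sum_right _ _ _ fun i _ =>
      (translation_commute _ _).sub_left (Commute.one_left _)).pow_left m
  refine mem_unipotentSpace.2 ⟨m + 1, ?_⟩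
  rw [pow_succ, Module.End.mul_apply, h1, ← Module.End.mul_apply, hc.eq, Module.End.mul_apply, hm,
    map_zero]

/-- Both Nb and Nv act unipotently on G, and by Cramer's rule the lattice they span contains
N·det(b,v)·ℤ². The factor det(b,v) is the price in the period; it is 1 exactly when summation costs
nothing. -/
theorem IsStripSum.mem_quasiPolySpace {b v : ℤ × ℤ} {τ : ℤ} {g G : ℤ × ℤ → ℚ}
    (hG : IsStripSum b τ v g G) (hv : 0 < detForm b v) {N : ℤ} (hN : 0 < N)
    (hg : g ∈ quasiPolySpace N) : G ∈ quasiPolySpace (N * detForm b v) := by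
  have hb : N • b ∈ unipotentGroup G := hG.mem_unipotentSpace_of_detForm_eq_zero hv
    (by rw [map_zsmul, detForm_apply, mul_comm, sub_self, smul_zero])
    (mem_unipotentSpace_of_mem_quasiPolySpace hg b)
  have hv' : N • v ∈ unipotentGroup G := by
    lift N to ℕ using hN.le
    have := mem_unipotentSpace_of_mem_quasiPolySpace hg v
    rw [natCast_zsmul] at this ⊢
    exact mem_unipotentSpace_of_sub_eq hG.sub_eq this
  constructor
  · have := sub_mem (zsmul_mem hb v.2) (zsmul_mem hv' b.2)
    have e : v.2 • N • b - b.2 • N • v = (N * detForm b v, 0) := by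
      ext <;> simp [detForm_apply] <;> ring
    rwa [mem_unipotentGroup, e] at this
  · have := sub_mem (zsmul_mem hv' b.1) (zsmul_mem hb v.1)
    have e : b.1 • N • v - v.1 • N • b = (0, N * detForm b v) := by
      ext <;> simp [detForm_apply] <;> ring
    rwa [mem_unipotentGroup, e] at this

end

/-! ### Constituents of a quasi-polynomial function -/

section

open Module Module.End

/-- The polynomial whose value at `n` is `n.choose j`. -/
noncomputable def choosePoly (j : ℕ) : Polynomial ℚ :=
  Polynomial.C ((j.factorial : ℚ)⁻¹) * descPochhammer ℚ j

theorem eval_choosePoly (j n : ℕ) : (choosePoly j).eval (n : ℚ) = n.choose j := by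
  rw [choosePoly, Polynomial.eval_mul, Polynomial.eval_C, descPochhammer_eval_eq_descFactorial,
    Nat.descFactorial_eq_factorial_mul_choose]
  push_cast
  rw [inv_mul_cancel_left₀ (by positivity)]

/-- Newton's forward difference formula: the binomial expansion of (1 + (T_u - 1))^n, truncated by
nilpotency. -/
theorem apply_add_nsmul_eq_sum {u : ℤ × ℤ} {f : ℤ × ℤ → ℚ} {K : ℕ}
    (hK : ((translation u - 1) ^ K) f = 0) (w : ℤ × ℤ) (n : ℕ) :
    f (w + n • u) = ∑ j ∈ Finset.range K, (n.choose j : ℚ) * ((translation u - 1) ^ j) f w := by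
  have h1 : translation u ^ n = translation (n • u) := by
    induction n with
    | zero => rw [pow_zero, zero_smul, translation_zero]
    | succ n ih => rw [pow_succ, ih, translation_mul, succ_nsmul]
  have h2 : translation u = (translation u - 1) + 1 := by rw [sub_add_cancel]
  rw [show f (w + n • u) = translation (n • u) f w from rfl, ← h1, h2, (Commute.one_right _).add_pow]
  simp only [one_pow, mul_one, LinearMap.sum_apply, Finset.sum_apply, sub_add_cancel]
  have h3 : ∀ j, K ≤ j → ((translation u - 1) ^ j) f = 0 := by
    intro j hj
    obtain ⟨i, rfl⟩ := Nat.exists_eq_add_of_le' hj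
    rw [pow_add, Module.End.mul_apply, hK, map_zero]
  have h4 : ∀ j, (((translation u - 1) ^ j * ((n.choose j : ℕ) : Module.End ℚ (ℤ × ℤ → ℚ))) f) w =
      (n.choose j : ℚ) * ((translation u - 1) ^ j) f w := by
    intro j
    rw [← Nat.cast_commute, Module.End.mul_apply, Module.End.natCast_apply]
    simp
  simp only [h4]
  rcases le_total (n + 1) K with h | h
  · refine Finset.sum_subset (Finset.range_mono h) fun j _ hj => ?_
    rw [Finset.mem_range, not_lt] at hj
    rw [Nat.choose_eq_zero_of_lt (by omega)]
    simp
  · refine (Finset.sum_subset (Finset.range_mono h) fun j _ hj => ?_).symm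
    rw [Finset.mem_range, not_lt] at hj
    rw [h3 j hj]
    simp

/-- A quasi-polynomial function on `ℤ²` is given by a quasi-polynomial on `ℕ²`. -/
theorem exists_quasiPolynomial₂ {N : ℕ} (hN : 0 < N) {f : ℤ × ℤ → ℚ}
    (hf : f ∈ quasiPolySpace N) :
    ∃ q : QuasiPolynomial₂, q.period = N ∧ ∀ m n : ℕ, q.eval m n = f (m, n) := by
  obtain ⟨K, hK⟩ := mem_unipotentSpace.1 hf.1
  obtain ⟨L, hL⟩ := mem_unipotentSpace.1 hf.2
  let D : ℕ → ℕ → ℤ × ℤ → ℚ := fun i j =>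
    ((translation (0, (N : ℤ)) - 1) ^ j) (((translation ((N : ℤ), 0) - 1) ^ i) f)
  have hc : ∀ i j, Commute ((translation (0, (N : ℤ)) - 1) ^ j)
      ((translation ((N : ℤ), 0) - 1) ^ i) := fun i j =>
    (((translation_commute _ _).sub_left (Commute.one_left _)).sub_right
      (Commute.one_right _)).pow_pow _ _
  have hD : ∀ i, ((translation (0, (N : ℤ)) - 1) ^ L)
      (((translation ((N : ℤ), 0) - 1) ^ i : Module.End ℚ (ℤ × ℤ → ℚ)) f) = 0 := by
    intro i
    rw [← Module.End.mul_apply, (hc i L).eq, Module.End.mul_apply, hL, map_zero]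
  -- On the residue class of a modulo N this linear polynomial computes the quotient x / N, the
  -- argument of the binomial coefficients in Newton's formula.
  let lin : Fin 2 → ℕ → MvPolynomial (Fin 2) ℚ := fun v a =>
    MvPolynomial.C ((N : ℚ)⁻¹) * (MvPolynomial.X v - MvPolynomial.C (a : ℚ))
  refine ⟨⟨N, hN, fun a b => ∑ i ∈ Finset.range K, ∑ j ∈ Finset.range L,
    Polynomial.aeval (lin 0 a) (choosePoly i) * Polynomial.aeval (lin 1 b) (choosePoly j) *
      MvPolynomial.C (D i j (a, b))⟩, rfl, fun m n => ?_⟩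
  have hN' : (N : ℚ) ≠ 0 := by positivity
  have hlin : ∀ (v : Fin 2) (x : ℕ) (z : Fin 2 → ℚ), z v = x → ∀ i,
      MvPolynomial.eval z (Polynomial.aeval (lin v (x % N)) (choosePoly i)) =
        ((x / N).choose i : ℚ) := by
    intro v x z hz i
    rw [Polynomial.aeval_def, MvPolynomial.algebraMap_eq, Polynomial.hom_eval₂,
      show (MvPolynomial.eval z).comp MvPolynomial.C = RingHom.id ℚ from
        RingHom.ext fun _ => MvPolynomial.eval_C _, ← Polynomial.eval, ← eval_choosePoly]
    congr 1
    have h := congrArg (Nat.cast : ℕ → ℚ) (Nat.mod_add_div x N)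
    push_cast at h
    simp only [lin, map_mul, map_sub, MvPolynomial.eval_C, MvPolynomial.eval_X, hz]
    field_simp
    linarith
  simp only [QuasiPolynomial₂.eval, QuasiPolynomial₂.constituentAt, map_sum, map_mul,
    MvPolynomial.eval_C]
  have e : ((m : ℤ), (n : ℤ)) = (((m % N : ℕ) : ℤ), ((n % N : ℕ) : ℤ)) +
      (n / N) • ((0 : ℤ), (N : ℤ)) + (m / N) • ((N : ℤ), (0 : ℤ)) := by
    have h1 := congrArg (Nat.cast : ℕ → ℤ) (Nat.mod_add_div m N)
    have h2 := congrArg (Nat.cast : ℕ → ℤ) (Nat.mod_add_div n N)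
    push_cast at h1 h2
    ext <;> simp <;> linarith
  rw [e, apply_add_nsmul_eq_sum hK]
  refine Finset.sum_congr rfl fun i _ => ?_
  rw [apply_add_nsmul_eq_sum (hD i), Finset.mul_sum]
  refine Finset.sum_congr rfl fun j _ => ?_
  rw [hlin 0 m _ (by simp), hlin 1 n _ (by simp), mul_assoc]

end

/-! ### Coefficients of bivariate power series as functions on ℤ² -/

/-- The exponent vector of `x^a y^b`. -/
noncomputable def biExponent (a b : ℕ) : Fin 2 →₀ ℕ := Finsupp.single 0 a + Finsupp.single 1 b

@[simp] theorem biExponent_zero (a b : ℕ) : biExponent a b 0 = a := by simp [biExponent]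

@[simp] theorem biExponent_one (a b : ℕ) : biExponent a b 1 = b := by simp [biExponent]

theorem biExponent_eq_iff {a b : ℕ} {c : Fin 2 →₀ ℕ} : biExponent a b = c ↔ a = c 0 ∧ b = c 1 := by
  constructor
  · rintro rfl; simp
  · rintro ⟨rfl, rfl⟩
    ext i; fin_cases i <;> simp

theorem biExponent_self (c : Fin 2 →₀ ℕ) : biExponent (c 0) (c 1) = c :=
  biExponent_eq_iff.2 ⟨rfl, rfl⟩

theorem le_iff_biExponent {c c' : Fin 2 →₀ ℕ} : c ≤ c' ↔ c 0 ≤ c' 0 ∧ c 1 ≤ c' 1 := by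
  rw [Finsupp.le_def, Fin.forall_fin_two]

/-- The point of `ℤ²` with the coordinates of an exponent vector. -/
def latticePoint (c : Fin 2 →₀ ℕ) : ℤ × ℤ := (c 0, c 1)

/-- The coefficients of a power series in two variables, extended by zero to `ℤ²`. -/
noncomputable def coeffFunction (φ : MvPowerSeries (Fin 2) ℚ) (w : ℤ × ℤ) : ℚ :=
  if 0 ≤ w.1 ∧ 0 ≤ w.2 then MvPowerSeries.coeff (biExponent w.1.toNat w.2.toNat) φ else 0

theorem coeffFunction_natCast (φ : MvPowerSeries (Fin 2) ℚ) (m n : ℕ) :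
    coeffFunction φ (m, n) = MvPowerSeries.coeff (biExponent m n) φ := by
  simp [coeffFunction]

theorem coeffFunction_of_neg (φ : MvPowerSeries (Fin 2) ℚ) {w : ℤ × ℤ} (h : w.1 < 0 ∨ w.2 < 0) :
    coeffFunction φ w = 0 := by
  rw [coeffFunction, if_neg]; omega

theorem coeffFunction_add (φ ψ : MvPowerSeries (Fin 2) ℚ) (w : ℤ × ℤ) :
    coeffFunction (φ + ψ) w = coeffFunction φ w + coeffFunction ψ w := by
  unfold coeffFunction
  split_ifs <;> simp

theorem coeffFunction_sum {ι : Type*} (s : Finset ι) (φ : ι → MvPowerSeries (Fin 2) ℚ)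
    (w : ℤ × ℤ) : coeffFunction (∑ i ∈ s, φ i) w = ∑ i ∈ s, coeffFunction (φ i) w := by
  unfold coeffFunction
  split_ifs <;> simp

theorem coeffFunction_monomial_mul (c : Fin 2 →₀ ℕ) (t : ℚ) (φ : MvPowerSeries (Fin 2) ℚ)
    (w : ℤ × ℤ) :
    coeffFunction (MvPowerSeries.monomial c t * φ) w = t * coeffFunction φ (w - latticePoint c) := by
  classical
  unfold coeffFunction latticePoint
  rw [MvPowerSeries.coeff_monomial_mul]
  simp only [le_iff_biExponent, biExponent_zero, biExponent_one, Prod.fst_sub, Prod.snd_sub]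
  by_cases h : 0 ≤ w.1 - (c 0 : ℤ) ∧ 0 ≤ w.2 - (c 1 : ℤ)
  · rw [if_pos (by omega), if_pos (by omega), if_pos h]
    congr 3
    symm
    rw [biExponent_eq_iff]
    simp only [Finsupp.tsub_apply, biExponent_zero, biExponent_one]
    omega
  · rw [if_neg h, mul_zero]
    split_ifs <;> first | rfl | omega

theorem X_pow_mul_X_pow_eq_monomial {R : Type*} [CommSemiring R] (a b : ℕ) :
    (MvPowerSeries.X 0 ^ a * MvPowerSeries.X 1 ^ b : MvPowerSeries (Fin 2) R) =
      MvPowerSeries.monomial (biExponent a b) 1 := by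
  rw [MvPowerSeries.X_pow_eq, MvPowerSeries.X_pow_eq, MvPowerSeries.monomial_mul_monomial, one_mul,
    biExponent]

theorem coeffFunction_sub_eq {φ ψ : MvPowerSeries (Fin 2) ℚ} {a b : ℕ}
    (h : (1 - MvPowerSeries.X 0 ^ a * MvPowerSeries.X 1 ^ b) * φ = ψ) (w : ℤ × ℤ) :
    coeffFunction φ w - coeffFunction φ (w - ((a : ℤ), (b : ℤ))) = coeffFunction ψ w := by
  have h' : φ = ψ + MvPowerSeries.monomial (biExponent a b) 1 * φ := by
    rw [← h, X_pow_mul_X_pow_eq_monomial]; ring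
  nth_rw 1 [h']
  rw [coeffFunction_add, coeffFunction_monomial_mul, one_mul, latticePoint, biExponent_zero,
    biExponent_one, add_sub_cancel_right]

theorem eventually_coeffFunction_eq_zero (φ : MvPowerSeries (Fin 2) ℚ) {v : ℤ × ℤ}
    (hv : 0 ≤ v.1 ∧ 0 ≤ v.2 ∧ 0 < v.1 + v.2) (w : ℤ × ℤ) :
    ∀ᶠ n : ℕ in Filter.atTop, coeffFunction φ (w - n • v) = 0 := by
  obtain ⟨h1, h2, h3⟩ := hv
  filter_upwards [Filter.eventually_gt_atTop (w.1.natAbs + w.2.natAbs)] with n hn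
  apply coeffFunction_of_neg
  have hn' : w.1 < n ∧ w.2 < n := by omega
  simp only [Prod.fst_sub, Prod.snd_sub, Prod.smul_fst, Prod.smul_snd]
  rw [nsmul_eq_mul, nsmul_eq_mul]
  rcases h1.lt_or_eq with h | h
  · left; nlinarith
  · right
    have : 0 < v.2 := by omega
    nlinarith

/-- A function which is invariant under `v` on a region stable under subtraction of `v` and vanishes
far out vanishes on the region. -/
theorem eq_zero_of_eventually {H : Set (ℤ × ℤ)} {v : ℤ × ℤ} {K : ℤ × ℤ → ℚ}
    (hH : ∀ w ∈ H, w - v ∈ H) (hK : ∀ w ∈ H, K w = K (w - v))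
    (h0 : ∀ w, ∀ᶠ n : ℕ in Filter.atTop, K (w - n • v) = 0) : ∀ w ∈ H, K w = 0 := by
  have key : ∀ n : ℕ, ∀ w ∈ H, K w = K (w - n • v) := by
    intro n
    induction n with
    | zero => simp
    | succ n ih =>
      intro w hw
      rw [hK w hw, ih _ (hH w hw), succ_nsmul', sub_sub]
  intro w hw
  obtain ⟨n, hn⟩ := (h0 w).exists
  rw [key n w hw, hn]

/-! ### The vector partition function on the chambers -/

/-- A representation of `f` on the half plane to the right of `a`, as a sum of functions in `𝒬`
cut off along lines through rays in `B`. -/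
def HasRayRep (𝒬 : Submodule ℚ (ℤ × ℤ → ℚ)) (B : Set (ℤ × ℤ)) (a : ℤ × ℤ)
    (f : ℤ × ℤ → ℚ) : Prop :=
  ∃ (ι : Type) (_ : Fintype ι) (b : ι → ℤ × ℤ) (τ : ι → ℤ) (g : ι → ℤ × ℤ → ℚ),
    (∀ i, b i ∈ B ∧ (τ i = 0 ∨ τ i = 1) ∧ g i ∈ 𝒬) ∧
    ∀ w, detForm a w ≤ 0 → f w = ∑ i, if τ i ≤ detForm (b i) w then g i w else 0

theorem HasRayRep.mono {𝒬 : Submodule ℚ (ℤ × ℤ → ℚ)} {B B' : Set (ℤ × ℤ)} {a a' : ℤ × ℤ}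
    {f : ℤ × ℤ → ℚ} (h : HasRayRep 𝒬 B a f) (hB : B ⊆ B')
    (ha : ∀ w, detForm a' w ≤ 0 → detForm a w ≤ 0) : HasRayRep 𝒬 B' a' f := by
  obtain ⟨ι, _, b, τ, g, h1, h2⟩ := h
  exact ⟨ι, inferInstance, b, τ, g, fun i => ⟨hB (h1 i).1, (h1 i).2⟩, fun w hw => h2 w (ha w hw)⟩

/-- Summation along a vector `v` to the left of the rays, with the additional information that on
the far side of the cut-off lines the summands extend to quasi-polynomial ones. -/
theorem HasRayRep.exists_sum {𝒬 : Submodule ℚ (ℤ × ℤ → ℚ)} {B : Set (ℤ × ℤ)} {a v : ℤ × ℤ}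
    {f f' : ℤ × ℤ → ℚ} (h : HasRayRep 𝒬 B a f) (hB : ∀ b ∈ B, 0 < detForm b v)
    (ha : 0 ≤ detForm a v)
    (h𝒬 : ∀ b ∈ B, ∀ τ g G, g ∈ 𝒬 → IsStripSum b τ v g G → G ∈ 𝒬)
    (hf : ∀ w, f' w - f' (w - v) = f w)
    (hf0 : ∀ w, ∀ᶠ n : ℕ in Filter.atTop, f' (w - n • v) = 0) :
    HasRayRep 𝒬 B a f' ∧
      ∃ G ∈ 𝒬, ∀ w, detForm a w ≤ 0 → (∀ b ∈ B, 0 ≤ detForm b w) → f' w = G w := by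
  obtain ⟨ι, _, b, τ, g, h1, h2⟩ := h
  choose G hG using fun i => exists_isStripSum (b i) (τ i) (hB _ (h1 i).1) (g i)
  have hG𝒬 : ∀ i, G i ∈ 𝒬 := fun i => h𝒬 _ (h1 i).1 _ _ _ (h1 i).2.2 (hG i)
  have main : ∀ w, detForm a w ≤ 0 →
      f' w = ∑ i, if τ i ≤ detForm (b i) w then G i w else 0 := by
    -- The difference of the two sides is v-invariant on the half plane, which is stable under
    -- subtraction of v as det(a,v) ≥ 0, and both sides vanish far back along -v.
    have hz := eq_zero_of_eventually (H := {w | detForm a w ≤ 0}) (v := v)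
      (K := fun w => f' w - ∑ i, if τ i ≤ detForm (b i) w then G i w else 0) ?_ ?_ ?_
    · intro w hw
      exact sub_eq_zero.1 (hz w hw)
    · intro w hw
      simp only [Set.mem_ofPred_eq, map_sub] at hw ⊢
      linarith
    · intro w hw
      have e : ∑ i, (if τ i ≤ detForm (b i) w then G i w else 0) -
          ∑ i, (if τ i ≤ detForm (b i) (w - v) then G i (w - v) else 0) = f w := by
        rw [h2 w hw, ← Finset.sum_sub_distrib]
        refine Finset.sum_congr rfl fun i _ => ?_
        have hs := (hG i).sub_eq w
        have hpos := hB _ (h1 i).1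
        by_cases c1 : τ i ≤ detForm (b i) w
        · rw [if_pos c1, if_pos c1, ← hs]
          split_ifs with c2
          · rfl
          -- The step from w - v to w crosses the cut-off line, so w - v lies in the strip, where G
          -- i is zero anyway.
          · rw [(hG i).strip (w - v) (by rw [map_sub]; linarith) (not_le.1 c2)]
        · rw [if_neg c1, if_neg c1, if_neg (by rw [map_sub]; linarith), sub_zero]
      have := hf w
      linarith
    · intro w
      have h3 : ∀ᶠ n : ℕ in Filter.atTop, ∀ i, detForm (b i) (w - n • v) < τ i := by
        rw [Filter.eventually_all]
        intro i
        have hpos := hB _ (h1 i).1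
        filter_upwards [Filter.eventually_gt_atTop (detForm (b i) w - τ i).natAbs] with n hn
        rw [map_sub, map_nsmul, nsmul_eq_mul]
        have : detForm (b i) w - τ i < n := by omega
        nlinarith
      filter_upwards [hf0 w, h3] with n hn hn'
      rw [hn, zero_sub, neg_eq_zero]
      exact Finset.sum_eq_zero fun i _ => if_neg (not_le.2 (hn' i))
  refine ⟨⟨ι, inferInstance, b, τ, G, fun i => ⟨(h1 i).1, (h1 i).2.1, hG𝒬 i⟩, main⟩,
    ∑ i, G i, Submodule.sum_mem _ fun i _ => hG𝒬 i, fun w hw hw' => ?_⟩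
  rw [main w hw, Finset.sum_apply]
  refine Finset.sum_congr rfl fun i _ => ?_
  have hpos := hB _ (h1 i).1
  have h0 := hw' _ (h1 i).1
  have hτ := (h1 i).2.1
  split_ifs with c
  · rfl
  -- As τ ≤ 1 ≤ det(b,v), a point with 0 ≤ det(b,w) < τ lies in the strip; hence the cut-off can be
  -- dropped up to and including the ray b.
  · exact ((hG i).strip w (by omega) (not_le.1 c)).symm

/-- The Plücker relation for four vectors in the plane. -/
theorem detForm_mul_detForm (a b v w : ℤ × ℤ) :
    detForm b w * detForm a v = detForm w v * detForm b a + detForm a w * detForm b v := by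
  simp only [detForm_apply]; ring

/-- Rotating the half plane to the left past the support of the function. -/
theorem HasRayRep.rotate {𝒬 : Submodule ℚ (ℤ × ℤ → ℚ)} {B : Set (ℤ × ℤ)} {a v : ℤ × ℤ}
    {f : ℤ × ℤ → ℚ} (h : HasRayRep 𝒬 B v f) (hf : ∀ w, 0 < detForm v w → f w = 0)
    (hav : detForm a v < 0) (hB : ∀ b ∈ B, 0 < detForm b v ∧ 0 < detForm b a) :
    HasRayRep 𝒬 (insert v B) a f := by
  obtain ⟨ι, _, b, τ, g, h1, h2⟩ := h
  -- In the sector strictly left of v and not left of a, f vanishes while every other cut-off is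
  -- active. One more summand, minus the sum of all g i, cut off at τ = 1 (strictly left of v),
  -- cancels them there.
  refine ⟨Option ι, inferInstance, fun i => i.elim v b, fun i => i.elim 1 τ,
    fun i => i.elim (-∑ i, g i) g, ?_, fun w hw => ?_⟩
  · rintro (_ | i)
    · exact ⟨Set.mem_insert _ _, Or.inr rfl,
        neg_mem (Submodule.sum_mem _ fun i _ => (h1 i).2.2)⟩
    · exact ⟨Set.mem_insert_of_mem _ (h1 i).1, (h1 i).2⟩
  · refine Eq.trans ?_ (Fintype.sum_option _).symm
    change f w = (if 1 ≤ detForm v w then (-∑ i, g i) w else 0) +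
      ∑ i, if τ i ≤ detForm (b i) w then g i w else 0
    by_cases c : 0 < detForm v w
    · rw [hf w c, if_pos (by omega), Pi.neg_apply, Finset.sum_apply, eq_comm, neg_add_eq_zero]
      refine Finset.sum_congr rfl fun i _ => ?_
      obtain ⟨p1, p2⟩ := hB _ (h1 i).1
      have hτ := (h1 i).2.1
      have hb : 0 < detForm (b i) w := by
        have e := detForm_mul_detForm a (b i) v w
        have e' : detForm w v = -detForm v w := by simp only [detForm_apply]; ring
        rw [e'] at e
        by_contra hneg
        nlinarith [mul_pos c p2, mul_nonneg (neg_nonneg.2 hw) p1.le,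
          mul_nonneg_of_nonpos_of_nonpos (not_lt.1 hneg) hav.le]
      rw [if_pos (by omega)]
    · rw [if_neg (by omega), zero_add]
      exact h2 w (not_lt.1 c)

theorem quasiPolySpace_one_le : quasiPolySpace 1 ≤ quasiPolyFunctions := fun _ hf =>
  ⟨1, one_pos, hf⟩

/-- The coefficients of `(1 - x)^{-(r+1)}`. -/
theorem exists_coeffFunction_eq (r : ℕ) : ∃ g ∈ quasiPolySpace 1, ∀ w,
    coeffFunction (((1 - MvPowerSeries.X 0) ^ (r + 1))⁻¹) w =
      if w.2 = 0 ∧ 0 ≤ w.1 then g w else 0 := by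
  have hunit : MvPowerSeries.constantCoeff (1 - MvPowerSeries.X 0 : MvPowerSeries (Fin 2) ℚ) ≠ 0 := by
    simp
  have hrec : ∀ n : ℕ, (1 - MvPowerSeries.X 0 ^ 1 * MvPowerSeries.X 1 ^ 0) *
      ((1 - MvPowerSeries.X 0 : MvPowerSeries (Fin 2) ℚ) ^ (n + 1))⁻¹ =
      ((1 - MvPowerSeries.X 0) ^ n)⁻¹ := by
    intro n
    rw [pow_one, pow_zero, mul_one, pow_succ, MvPowerSeries.mul_inv_rev, ← mul_assoc,
      MvPowerSeries.mul_inv_cancel _ hunit, one_mul]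
  have key : ∀ (n : ℕ) (T : ℤ × ℤ → ℚ),
      (∀ w, T w - T (w - (1, 0)) = coeffFunction (((1 - MvPowerSeries.X 0) ^ n)⁻¹) w) →
      (∀ w, w.1 < 0 → T w = 0) →
      ∀ w, coeffFunction (((1 - MvPowerSeries.X 0) ^ (n + 1))⁻¹) w = T w := by
    intro n T hT hT0 w
    refine sub_eq_zero.1 (eq_zero_of_eventually (H := Set.univ) (v := (1, 0))
      (K := fun w => coeffFunction (((1 - MvPowerSeries.X 0) ^ (n + 1))⁻¹) w - T w)
      (fun _ _ => trivial) (fun w _ => ?_) (fun w => ?_) w trivial)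
    · have := coeffFunction_sub_eq (hrec n) w
      rw [← hT w] at this
      simp only [Nat.cast_one, Nat.cast_zero] at this
      linarith
    · filter_upwards [eventually_coeffFunction_eq_zero
        (((1 - MvPowerSeries.X 0) ^ (n + 1))⁻¹) (v := (1, 0)) (by simp) w,
        Filter.eventually_gt_atTop w.1.natAbs] with m hm hm'
      rw [hm, hT0, sub_zero]
      simp
      omega
  induction r with
  | zero =>
    refine ⟨fun _ => 1, const_mem_quasiPolySpace 1 1, ?_⟩
    refine key 0 (fun w => if w.2 = 0 ∧ 0 ≤ w.1 then 1 else 0) (fun w => ?_)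
      (fun w hw => if_neg (by omega))
    have h1 : ((1 - MvPowerSeries.X 0 : MvPowerSeries (Fin 2) ℚ) ^ 0)⁻¹ =
        MvPowerSeries.monomial 0 1 * 1 := by
      rw [pow_zero, mul_one, MvPowerSeries.monomial_zero_one]
      exact (MvPowerSeries.inv_eq_iff_mul_eq_one (by simp)).2 (one_mul 1)
    have h2 : coeffFunction 1 w = if w.1 = 0 ∧ w.2 = 0 then 1 else 0 := by
      unfold coeffFunction
      rw [MvPowerSeries.coeff_one]
      simp only [biExponent_eq_iff, Finsupp.coe_zero, Pi.zero_apply]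
      split_ifs <;> first | rfl | omega
    rw [h1, MvPowerSeries.monomial_zero_one, mul_one, h2]
    simp only [Prod.fst_sub, Prod.snd_sub]
    split_ifs <;> first | omega | norm_num
  | succ r ih =>
    obtain ⟨g, hg, hgw⟩ := ih
    -- The form det((0,-1),·) is the first coordinate, so the strip is the column of points with
    -- first coordinate -1. Its value at (1,0) is 1, so the period stays 1.
    have hpos : 0 < detForm (0, -1) (1, 0) := by simp [detForm_apply]
    obtain ⟨G, hG⟩ := exists_isStripSum (0, -1) 0 hpos g
    refine ⟨G, by simpa [detForm_apply] using hG.mem_quasiPolySpace hpos one_pos hg, ?_⟩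
    refine key (r + 1) (fun w => if w.2 = 0 ∧ 0 ≤ w.1 then G w else 0) (fun w => ?_)
      (fun w hw => if_neg (by omega))
    rw [hgw, ← hG.sub_eq]
    have hs := hG.strip (w - (1, 0))
    simp only [detForm_apply, Prod.fst_sub, Prod.snd_sub] at hs ⊢
    by_cases c : w.2 = 0 ∧ 0 ≤ w.1
    · rw [if_pos c, if_pos c]
      split_ifs with c'
      · rfl
      · rw [hs (by omega) (by omega)]
    · rw [if_neg c, if_neg c, if_neg (by omega), sub_zero]

/-- The vector `(dᵢ, eᵢ)`. -/
def degVec {s : ℕ} (d e : Fin s → ℕ) (i : Fin s) : ℤ × ℤ := (d i, e i)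

/-- The power series `1 / ((1 - x)^r ∏_{i ∈ U} (1 - x^{dᵢ} y^{eᵢ}))`. -/
noncomputable def partitionSeries (r : ℕ) {s : ℕ} (d e : Fin s → ℕ) (U : Finset (Fin s)) :
    MvPowerSeries (Fin 2) ℚ :=
  ((1 - MvPowerSeries.X 0) ^ r *
    ∏ i ∈ U, (1 - MvPowerSeries.X 0 ^ d i * MvPowerSeries.X 1 ^ e i))⁻¹

theorem partitionSeries_mul (r : ℕ) {s : ℕ} {d e : Fin s → ℕ} (he : ∀ i, 0 < e i)
    (U : Finset (Fin s)) :
    (1 - MvPowerSeries.X 0) ^ r *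
    (∏ i ∈ U, (1 - MvPowerSeries.X 0 ^ d i * MvPowerSeries.X 1 ^ e i)) *
      partitionSeries r d e U = 1 := by
  refine MvPowerSeries.mul_inv_cancel _ ?_
  rw [map_mul, map_pow, map_prod]
  simp [(he _).ne']

theorem partitionSeries_insert (r : ℕ) {s : ℕ} {d e : Fin s → ℕ} (he : ∀ i, 0 < e i)
    {U : Finset (Fin s)} {i : Fin s} (hi : i ∉ U) :
    (1 - MvPowerSeries.X 0 ^ d i * MvPowerSeries.X 1 ^ e i) * partitionSeries r d e (insert i U) =
      partitionSeries r d e U := by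
  have h1 := partitionSeries_mul r he (d := d) (insert i U)
  have h2 := partitionSeries_mul r he (d := d) U
  rw [Finset.prod_insert hi] at h1
  calc _ = (1 - MvPowerSeries.X 0 ^ d i * MvPowerSeries.X 1 ^ e i) *
        partitionSeries r d e (insert i U) * ((1 - MvPowerSeries.X 0) ^ r *
    (∏ i ∈ U, (1 - MvPowerSeries.X 0 ^ d i * MvPowerSeries.X 1 ^ e i)) *
      partitionSeries r d e U) := by rw [h2, mul_one]
    _ = ((1 - MvPowerSeries.X 0) ^ r *
        ((1 - MvPowerSeries.X 0 ^ d i * MvPowerSeries.X 1 ^ e i) *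
          ∏ i ∈ U, (1 - MvPowerSeries.X 0 ^ d i * MvPowerSeries.X 1 ^ e i)) *
        partitionSeries r d e (insert i U)) * partitionSeries r d e U := by ring
    _ = _ := by rw [h1, one_mul]

/-- The support lies in the cone spanned by (1,0) and the vectors of U, none of which is to the left
of a. -/
theorem eq_zero_of_detForm_pos (r : ℕ) {s : ℕ} {d e : Fin s → ℕ} (he : ∀ i, 0 < e i)
    (U : Finset (Fin s)) {a : ℤ × ℤ} (ha : 0 < a.2) (hU : ∀ i ∈ U, detForm a (degVec d e i) ≤ 0) :
    ∀ w, 0 < detForm a w → coeffFunction (partitionSeries (r + 1) d e U) w = 0 := by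
  induction U using Finset.induction_on with
  | empty =>
    intro w hw
    obtain ⟨g, -, hg⟩ := exists_coeffFunction_eq r
    rw [partitionSeries, Finset.prod_empty, mul_one, hg, if_neg]
    rintro ⟨h1, h2⟩
    rw [detForm_apply, h1] at hw
    nlinarith
  | insert i U hi ih =>
    refine eq_zero_of_eventually (H := {w | 0 < detForm a w}) (v := degVec d e i) ?_ ?_ ?_
    · intro w hw
      have := hU i (Finset.mem_insert_self i U)
      simp only [Set.mem_ofPred_eq, map_sub] at hw ⊢
      linarith
    · intro w hw
      have h1 := ih (fun j hj => hU j (Finset.mem_insert_of_mem hj)) w hw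
      have h2 := coeffFunction_sub_eq (partitionSeries_insert (r + 1) (d := d) he hi) w
      rw [h1] at h2
      exact sub_eq_zero.1 h2
    · refine eventually_coeffFunction_eq_zero _ ?_
      have := he i
      simp only [degVec]
      omega

/-- The rays strictly to the right of `a`. -/
def rightRays {s : ℕ} (d e : Fin s → ℕ) (U : Finset (Fin s)) (a : ℤ × ℤ) : Set (ℤ × ℤ) :=
  {b | b = (1, 0) ∨ ∃ i ∈ U, detForm a (degVec d e i) < 0 ∧ b = degVec d e i}

/-- The coefficients live on the nonnegative first axis. To the right of a, that half line is cut
out by second coordinate 0, which is the difference of the cut-offs w.2 ≥ 0 and w.2 ≥ 1. -/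
theorem hasRayRep_empty (r : ℕ) {s : ℕ} (d e : Fin s → ℕ) {a : ℤ × ℤ} (ha : 0 ≤ a.1 ∧ 0 < a.2)
    {B : Set (ℤ × ℤ)} (hB : (1, 0) ∈ B) :
    HasRayRep (quasiPolySpace 1) B a (coeffFunction (partitionSeries (r + 1) d e ∅)) := by
  obtain ⟨g, hg, hgw⟩ := exists_coeffFunction_eq r
  refine ⟨Bool, inferInstance, fun _ => (1, 0), fun i => if i then 0 else 1,
    fun i => if i then g else -g, ?_, fun w hw => ?_⟩
  · rintro (_ | _)
    · exact ⟨hB, Or.inr rfl, neg_mem hg⟩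
    · exact ⟨hB, Or.inl rfl, hg⟩
  · rw [partitionSeries, Finset.prod_empty, mul_one, hgw, Fintype.sum_bool]
    simp only [detForm_apply, one_mul, zero_mul, sub_zero, if_true, Bool.false_eq_true, if_false,
      Pi.neg_apply] at hw ⊢
    rcases lt_trichotomy w.2 0 with h | h | h
    · rw [if_neg (by omega), if_neg (by omega), if_neg (by omega), add_zero]
    · rw [h, mul_zero, zero_sub] at hw
      have : 0 ≤ w.1 := by nlinarith
      rw [if_pos ⟨h, this⟩, if_pos h.ge, if_neg (by omega), add_zero]
    · rw [if_neg (by omega), if_pos h.le, if_pos (by omega), add_neg_cancel]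

theorem detForm_trans {a b c : ℤ × ℤ} (ha : 0 < a.2) (hb : 0 < b.2) (hc : 0 < c.2)
    (hab : detForm a b ≤ 0) (hbc : detForm b c < 0) : detForm a c < 0 := by
  have e : b.2 * detForm a c = a.2 * detForm b c + c.2 * detForm a b := by
    simp only [detForm_apply]; ring
  by_contra h
  nlinarith [mul_nonneg hb.le (not_lt.1 h), mul_neg_of_pos_of_neg ha hbc,
    mul_nonpos_of_nonneg_of_nonpos hc.le hab]

theorem detForm_swap (a b : ℤ × ℤ) : detForm a b = -detForm b a := by
  simp only [detForm_apply]; ring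

theorem quasiPolyFunctions_stripSum {b v : ℤ × ℤ} {τ : ℤ} {g G : ℤ × ℤ → ℚ}
    (hv : 0 < detForm b v) (hg : g ∈ quasiPolyFunctions) (hG : IsStripSum b τ v g G) :
    G ∈ quasiPolyFunctions := by
  obtain ⟨N, hN, hg⟩ := hg
  exact ⟨_, mul_pos hN hv, hG.mem_quasiPolySpace hv hN hg⟩

/-- The vectors are added in order of decreasing slope d/e, so the new v_i is strictly left of the
rays right of it. Summation along v_i gives a representation right of v_i. As the support stays
right of v_i, it can be rotated to a. -/
theorem hasRayRep_partitionSeries (r : ℕ) {s : ℕ} {d e : Fin s → ℕ} (he : ∀ i, 0 < e i)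
    (U : Finset (Fin s)) : ∀ a : ℤ × ℤ, 0 ≤ a.1 → 0 < a.2 →
      (∀ i ∈ U, detForm a (degVec d e i) ≤ 0) →
      HasRayRep quasiPolyFunctions (rightRays d e U a) a
        (coeffFunction (partitionSeries (r + 1) d e U)) := by
  have he' : ∀ i, 0 < (degVec d e i).2 := fun i => by simpa [degVec] using he i
  have hd' : ∀ i, 0 ≤ (degVec d e i).1 := fun i => by simp [degVec]
  induction U using Finset.induction_on_min_value (fun i => (d i : ℚ) / e i) with
  | empty =>
    intro a h1 h2 _
    obtain ⟨ι, hι, b, τ, g, h3, h4⟩ := hasRayRep_empty r d e ⟨h1, h2⟩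
      (B := rightRays d e ∅ a) (Or.inl rfl)
    exact ⟨ι, hι, b, τ, g, fun i => ⟨(h3 i).1, (h3 i).2.1, quasiPolySpace_one_le (h3 i).2.2⟩, h4⟩
  | insert i U hi hmin ih =>
    intro a h1 h2 hU
    have hv : ∀ x ∈ U, detForm (degVec d e i) (degVec d e x) ≤ 0 := by
      intro x hx
      have := hmin x hx
      rw [div_le_div_iff₀ (by exact_mod_cast he i) (by exact_mod_cast he x)] at this
      have : d i * e x ≤ d x * e i := by exact_mod_cast this
      simp only [detForm_apply, degVec]
      have h' : (d i : ℤ) * e x ≤ d x * e i := by exact_mod_cast this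
      linarith
    have hB : ∀ b ∈ rightRays d e U (degVec d e i), 0 < detForm b (degVec d e i) := by
      rintro b (rfl | ⟨x, hx, hlt, rfl⟩)
      · simpa [detForm_apply] using he' i
      · rw [detForm_swap]; linarith
    have hrep := ((ih (degVec d e i) (hd' i) (he' i) hv).exists_sum hB
      (by rw [detForm_apply, mul_comm, sub_self])
      (fun b hb τ g G hg hG => quasiPolyFunctions_stripSum (hB b hb) hg hG)
      (coeffFunction_sub_eq (partitionSeries_insert (r + 1) (d := d) he hi))
      (eventually_coeffFunction_eq_zero _ (by
        have := he i
        change 0 ≤ (d i : ℤ) ∧ 0 ≤ (e i : ℤ) ∧ 0 < (d i : ℤ) + (e i : ℤ)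
        omega))).1
    have hai := hU i (Finset.mem_insert_self i U)
    -- If v_i is parallel to a, the two half planes coincide and no rotation is needed.
    rcases hai.lt_or_eq with hlt | heq
    · refine (hrep.rotate ?_ hlt ?_).mono ?_ (fun w hw => hw)
      · exact eq_zero_of_detForm_pos r he _ (he' i) (by
          intro x hx
          rcases Finset.mem_insert.1 hx with rfl | hx
          · rw [detForm_apply, mul_comm, sub_self]
          · exact hv x hx)
      · intro b hb
        refine ⟨hB b hb, ?_⟩
        rcases hb with rfl | ⟨x, hx, hlt', rfl⟩
        · simpa [detForm_apply] using h2
        · rw [detForm_swap]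
          linarith [detForm_trans h2 (he' i) (he' x) hai hlt']
      · rintro b (rfl | rfl | ⟨x, hx, hlt', rfl⟩)
        · exact Or.inr ⟨i, Finset.mem_insert_self i U, hlt, rfl⟩
        · exact Or.inl rfl
        · exact Or.inr ⟨x, Finset.mem_insert_of_mem hx,
            detForm_trans h2 (he' i) (he' x) hai hlt', rfl⟩
    · refine hrep.mono ?_ fun w hw => ?_
      · rintro b (rfl | ⟨x, hx, hlt', rfl⟩)
        · exact Or.inl rfl
        · exact Or.inr ⟨x, Finset.mem_insert_of_mem hx,
            detForm_trans h2 (he' i) (he' x) hai hlt', rfl⟩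
      · have e1 : a.2 * detForm (degVec d e i) w =
            (degVec d e i).2 * detForm a w - w.2 * detForm a (degVec d e i) := by
          simp only [detForm_apply]; ring
        rw [heq, mul_zero, sub_zero] at e1
        have := mul_nonpos_of_nonneg_of_nonpos (he' i).le hw
        rw [← e1] at this
        exact nonpos_of_mul_nonpos_right this h2

/-- On a chamber the vector partition function is quasi-polynomial. -/
theorem exists_eq_on_chamber (r : ℕ) {s : ℕ} {d e : Fin s → ℕ} (he : ∀ i, 0 < e i) (j : Fin s)
    {𝒬 : Submodule ℚ (ℤ × ℤ → ℚ)}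
    (h𝒬 : ∀ b ∈ rightRays d e Finset.univ (degVec d e j), ∀ i, 0 < detForm b (degVec d e i) →
      ∀ τ g G, g ∈ 𝒬 → IsStripSum b τ (degVec d e i) g G → G ∈ 𝒬)
    (hrep : HasRayRep 𝒬 (rightRays d e Finset.univ (degVec d e j)) (degVec d e j)
      (coeffFunction (partitionSeries (r + 1) d e
        (Finset.univ.filter fun i => detForm (degVec d e j) (degVec d e i) < 0)))) :
    ∃ G ∈ 𝒬, ∀ w, detForm (degVec d e j) w ≤ 0 →
      (∀ b ∈ rightRays d e Finset.univ (degVec d e j), 0 ≤ detForm b w) →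
        coeffFunction (partitionSeries (r + 1) d e Finset.univ) w = G w := by
  classical
  have he' : ∀ i, 0 < (degVec d e i).2 := fun i => by simpa [degVec] using he i
  have hB : ∀ i, 0 ≤ detForm (degVec d e j) (degVec d e i) →
      ∀ b ∈ rightRays d e Finset.univ (degVec d e j), 0 < detForm b (degVec d e i) := by
    rintro i hi b (rfl | ⟨x, -, hlt, rfl⟩)
    · simpa [detForm_apply] using he' i
    · rw [detForm_swap]
      rw [detForm_swap] at hi
      have := detForm_trans (he' i) (he' j) (he' x) (by linarith) hlt
      linarith
  have hv : ∀ i, 0 ≤ ((d i : ℤ), (e i : ℤ)).1 ∧ 0 ≤ ((d i : ℤ), (e i : ℤ)).2 ∧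
      0 < ((d i : ℤ), (e i : ℤ)).1 + ((d i : ℤ), (e i : ℤ)).2 := by
    intro i
    have := he i
    change 0 ≤ (d i : ℤ) ∧ 0 ≤ (e i : ℤ) ∧ 0 < (d i : ℤ) + (e i : ℤ)
    omega
  let U₀ := Finset.univ.filter fun i => detForm (degVec d e j) (degVec d e i) < 0
  -- A vector not strictly right of v_j is left of all cut-off rays, so these vectors may be added
  -- in any order without creating new rays.
  have step : ∀ T : Finset (Fin s),
      (∀ i ∈ T, 0 ≤ detForm (degVec d e j) (degVec d e i)) →
      HasRayRep 𝒬 (rightRays d e Finset.univ (degVec d e j)) (degVec d e j)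
        (coeffFunction (partitionSeries (r + 1) d e (T ∪ U₀))) := by
    intro T
    induction T using Finset.induction_on with
    | empty => intro _; rw [Finset.empty_union]; exact hrep
    | insert i T hi ih =>
      intro hT
      have hi0 := hT i (Finset.mem_insert_self i T)
      have hi' : i ∉ T ∪ U₀ := by
        rw [Finset.mem_union]
        rintro (h | h)
        · exact hi h
        · exact absurd (Finset.mem_filter.1 h).2 (not_lt.2 hi0)
      rw [Finset.insert_union]
      exact ((ih fun x hx => hT x (Finset.mem_insert_of_mem hx)).exists_sum
        (hB i hi0) hi0 (fun b hb => h𝒬 b hb i (hB i hi0 b hb))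
        (coeffFunction_sub_eq (partitionSeries_insert (r + 1) (d := d) he hi'))
        (eventually_coeffFunction_eq_zero _ (hv i))).1
  -- v_j is held back for the last summation. Performing one summation at the end yields the
  -- function G valid on the closed chamber, and holding back v_j ensures that this step exists.
  let T := (Finset.univ.filter fun i => 0 ≤ detForm (degVec d e j) (degVec d e i)).erase j
  have hjj : 0 ≤ detForm (degVec d e j) (degVec d e j) := by
    rw [detForm_apply, mul_comm, sub_self]
  have hj : j ∉ T ∪ U₀ := by
    rw [Finset.mem_union]
    rintro (h | h)
    · exact Finset.notMem_erase _ _ h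
    · exact absurd (Finset.mem_filter.1 h).2 (not_lt.2 hjj)
  have huniv : insert j (T ∪ U₀) = Finset.univ := by
    ext i
    simp only [T, U₀, Finset.mem_insert, Finset.mem_union, Finset.mem_erase, Finset.mem_filter,
      Finset.mem_univ, true_and, iff_true]
    by_cases h : i = j
    · exact Or.inl h
    · rcases le_or_gt 0 (detForm (degVec d e j) (degVec d e i)) with h' | h'
      · exact Or.inr (Or.inl ⟨h, h'⟩)
      · exact Or.inr (Or.inr h')
  have hfin := ((step T fun i hi => (Finset.mem_filter.1 (Finset.mem_of_mem_erase hi)).2).exists_sum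
    (hB j hjj) hjj (fun b hb => h𝒬 b hb j (hB j hjj b hb))
    (coeffFunction_sub_eq (partitionSeries_insert (r + 1) (d := d) he hj))
    (eventually_coeffFunction_eq_zero _ (hv j))).2
  rwa [huniv] at hfin

/-! ### From the Hilbert series to the length function -/

section Numerator

variable {k A : Type*} [Field k] [CommRing A] [Algebra k A]
    {𝒜 : ℕ → Submodule k A} {I : ℕ → Ideal A}

theorem coeff_bigradedHilbertSeries (𝒜 : ℕ → Submodule k A) (I : ℕ → Ideal A) (m n : ℕ) :
    MvPowerSeries.coeff (biExponent m n) (bigradedHilbertSeries 𝒜 I) =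
      (bigradedLength 𝒜 I m n : ℤ) := by
  change ((bigradedLength 𝒜 I (biExponent m n 0) (biExponent m n 1) : ℕ) : ℤ) = _
  rw [biExponent_zero, biExponent_one]

theorem coe_eq_sum_monomial {R : Type*} [CommSemiring R] (p : MvPolynomial (Fin 2) R) :
    (p : MvPowerSeries (Fin 2) R) =
      ∑ a ∈ p.support, MvPowerSeries.monomial a (MvPolynomial.coeff a p) := by
  nth_rw 1 [p.as_sum]
  rw [← MvPolynomial.coeToMvPowerSeries.ringHom_apply, map_sum]
  simp

theorem IsHilbertNumerator.bigradedLength_eq_sum {r s : ℕ} {d e : Fin s → ℕ} (he : ∀ i, 0 < e i)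
    {p : MvPolynomial (Fin 2) ℤ} (hp : IsHilbertNumerator 𝒜 I r d e p) (m n : ℕ) :
    (bigradedLength 𝒜 I m n : ℚ) = ∑ a ∈ p.support, ((MvPolynomial.coeff a p : ℤ) : ℚ) *
      coeffFunction (partitionSeries r d e Finset.univ) (((m : ℤ), (n : ℤ)) - latticePoint a) := by
  let φ := MvPowerSeries.map (σ := Fin 2) (Int.castRingHom ℚ)
  have h1 := congrArg φ hp
  rw [map_mul, map_mul, map_pow, map_prod] at h1
  simp only [map_sub, map_one, map_mul, map_pow, φ, MvPowerSeries.map_X] at h1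
  have h2 : φ (bigradedHilbertSeries 𝒜 I) =
      φ (p : MvPowerSeries (Fin 2) ℤ) * partitionSeries r d e Finset.univ := by
    rw [← h1, mul_assoc, partitionSeries_mul r he Finset.univ, mul_one]
  have h3 : coeffFunction (φ (bigradedHilbertSeries 𝒜 I)) (m, n) = bigradedLength 𝒜 I m n := by
    rw [coeffFunction_natCast, MvPowerSeries.coeff_map, coeff_bigradedHilbertSeries]
    simp
  rw [← h3, h2, coe_eq_sum_monomial, map_sum, Finset.sum_mul, coeffFunction_sum]
  refine Finset.sum_congr rfl fun a _ => ?_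
  rw [show φ (MvPowerSeries.monomial a (MvPolynomial.coeff a p)) =
    MvPowerSeries.monomial a ((MvPolynomial.coeff a p : ℤ) : ℚ) from MvPowerSeries.map_monomial _ _ _,
    coeffFunction_monomial_mul]

/-- If the vector partition function agrees with a quasi-polynomial on `C`, then so do the lengths on
the intersection of the translates of `C`. -/
theorem IsHilbertNumerator.exists_quasiPoly {r s : ℕ} {d e : Fin s → ℕ} (he : ∀ i, 0 < e i)
    {p : MvPolynomial (Fin 2) ℤ} (hp : IsHilbertNumerator 𝒜 I r d e p)
    {𝒬 : Submodule ℚ (ℤ × ℤ → ℚ)} (h𝒬 : ∀ f ∈ 𝒬, ∀ v, translation v f ∈ 𝒬) {C : Set (ℤ × ℤ)}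
    {G : ℤ × ℤ → ℚ} (hG : G ∈ 𝒬)
    (hC : ∀ w ∈ C, coeffFunction (partitionSeries r d e Finset.univ) w = G w) :
    ∃ f ∈ 𝒬, ∀ m n : ℕ, (∀ a ∈ p.support, ((m : ℤ), (n : ℤ)) - latticePoint a ∈ C) →
      (bigradedLength 𝒜 I m n : ℚ) = f (m, n) := by
  refine ⟨∑ a ∈ p.support, ((MvPolynomial.coeff a p : ℤ) : ℚ) • translation (-latticePoint a) G,
    Submodule.sum_mem _ fun a _ => Submodule.smul_mem _ _ (h𝒬 G hG _), fun m n hmn => ?_⟩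
  rw [hp.bigradedLength_eq_sum he, Finset.sum_apply]
  refine Finset.sum_congr rfl fun a ha => ?_
  rw [hC _ (hmn a ha), Pi.smul_apply, translation_apply, smul_eq_mul, ← sub_eq_add_neg]

variable [GradedAlgebra 𝒜]

theorem IsStandardGraded.finrank_zero [Nontrivial A] (hA : IsStandardGraded 𝒜) :
    Module.finrank k (𝒜 0) = 1 := by
  rw [hA.zero_eq, Submodule.one_eq_span, finrank_span_singleton one_ne_zero]

theorem IsHilbertNumerator.zero_mem_support [Nontrivial A] (hA : IsStandardGraded 𝒜)
    (hI : IsHomogeneousFiltration 𝒜 I) {r s : ℕ} {d e : Fin s → ℕ} (he : ∀ i, 0 < e i)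
    {p : MvPolynomial (Fin 2) ℤ} (hp : IsHilbertNumerator 𝒜 I r d e p) : 0 ∈ p.support := by
  have h := congrArg MvPowerSeries.constantCoeff hp
  rw [map_mul, map_mul, map_pow, map_prod] at h
  simp only [map_sub, map_one, map_mul, map_pow, MvPowerSeries.constantCoeff_X,
    zero_pow (he _).ne', mul_zero, sub_zero, one_pow, Finset.prod_const_one, mul_one] at h
  have h0 : MvPowerSeries.constantCoeff (bigradedHilbertSeries 𝒜 I) = 1 := by
    rw [← MvPowerSeries.coeff_zero_eq_constantCoeff_apply,
      ← (biExponent_eq_iff (a := 0) (b := 0) (c := 0)).2 (by simp), coeff_bigradedHilbertSeries,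
      bigradedLength_zero_right hI, hA.finrank_zero, Nat.cast_one]
  rw [h0] at h
  rw [MvPolynomial.mem_support_iff, ← MvPolynomial.coeff_coe,
    MvPowerSeries.coeff_zero_eq_constantCoeff_apply, ← h]
  exact one_ne_zero

theorem monotone_finrank (hA : IsStandardGraded 𝒜) (hdepth : 0 < gradedDepth 𝒜)
    (hI : IsHomogeneousFiltration 𝒜 I) : Monotone fun m => Module.finrank k (𝒜 m) := by
  refine monotone_nat_of_le_succ fun m => ?_
  rw [← bigradedLength_zero_right hI, ← bigradedLength_zero_right hI]
  exact bigradedLength_le_succ_left hA hdepth I m 0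

/-- Since every e_i is positive, the factors are 1 modulo y. -/
theorem coeff_mul_prod_of_eq_zero {R : Type*} [CommRing R] {s : ℕ} {d e : Fin s → ℕ}
    (he : ∀ i, 0 < e i) (φ : MvPowerSeries (Fin 2) R) (m : ℕ) (U : Finset (Fin s)) :
    MvPowerSeries.coeff (biExponent m 0)
      (φ * ∏ i ∈ U, (1 - MvPowerSeries.X 0 ^ d i * MvPowerSeries.X 1 ^ e i)) =
      MvPowerSeries.coeff (biExponent m 0) φ := by
  classical
  induction U using Finset.induction_on with
  | empty => simp
  | insert i U hi ih =>
    rw [Finset.prod_insert hi, mul_comm (1 - _), ← mul_assoc, mul_sub, mul_one, map_sub, ih,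
      X_pow_mul_X_pow_eq_monomial, MvPowerSeries.coeff_mul_monomial, if_neg, sub_zero]
    rw [le_iff_biExponent]
    have := he i
    simp
    omega

/-- If r were 0, the coefficients of p at y^0 would be the numbers dim A_m, which are at least dim
A_0 = 1 for every m; but p has finite support. -/
theorem IsHilbertNumerator.ne_zero [Nontrivial A] (hA : IsStandardGraded 𝒜)
    (hdepth : 0 < gradedDepth 𝒜) (hI : IsHomogeneousFiltration 𝒜 I) {r s : ℕ} {d e : Fin s → ℕ}
    (he : ∀ i, 0 < e i) {p : MvPolynomial (Fin 2) ℤ} (hp : IsHilbertNumerator 𝒜 I r d e p) :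
    r ≠ 0 := by
  rintro rfl
  have hmem : ∀ m : ℕ, biExponent m 0 ∈ p.support := by
    intro m
    have h := congrArg (MvPowerSeries.coeff (biExponent m 0)) hp
    rw [pow_zero, one_mul, coeff_mul_prod_of_eq_zero he, coeff_bigradedHilbertSeries,
      bigradedLength_zero_right hI, MvPolynomial.coeff_coe] at h
    rw [MvPolynomial.mem_support_iff, ← h]
    have : Module.finrank k (𝒜 0) ≤ Module.finrank k (𝒜 m) :=
      monotone_finrank hA hdepth hI (Nat.zero_le m)
    rw [hA.finrank_zero] at this
    omega
  refine Set.infinite_of_injective_forall_mem (f := fun m => biExponent m 0) ?_ hmem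
    p.support.finite_toSet
  intro m m' h
  simpa using DFunLike.congr_fun h 0

theorem IsHomogeneousFiltration.pow_mem (hI : IsHomogeneousFiltration 𝒜 I) {g : A} {e : ℕ}
    (hg : g ∈ I e) (a : ℕ) : g ^ a ∈ I (a * e) := by
  induction a with
  | zero => rw [zero_mul, hI.zero_eq_top]; trivial
  | succ a ih =>
    rw [pow_succ, Nat.succ_mul]
    exact hI.mul_le _ _ (Ideal.mul_mem_mul ih hg)

/-- Multiplication by g^a is injective in a domain. -/
theorem finrank_le_bigradedLength [IsDomain A] (hA : IsStandardGraded 𝒜)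
    (hI : IsHomogeneousFiltration 𝒜 I) {g : A} {d e : ℕ} (hg : g ∈ I e) (hg' : g ∈ 𝒜 d)
    (hg0 : g ≠ 0) (a m : ℕ) :
    Module.finrank k (𝒜 m) ≤ bigradedLength 𝒜 I (a * d + m) (a * e) := by
  have := hA.finite
  have hinj : Function.Injective (LinearMap.mulLeft k (g ^ a)) :=
    mul_right_injective₀ (pow_ne_zero a hg0)
  rw [(Submodule.equivMapOfInjective _ hinj (𝒜 m)).finrank_eq]
  refine Submodule.finrank_mono ?_
  rintro _ ⟨x, hx, rfl⟩
  refine ⟨Ideal.mul_mem_right _ _ (hI.pow_mem hg a), ?_⟩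
  have h := SetLike.pow_mem_graded a hg'
  rw [smul_eq_mul] at h
  exact SetLike.mul_mem_graded h hx

end Numerator

/-! ### Leading forms of monotone quasi-polynomials -/

section

open Filter

/-- The restriction of a polynomial in two variables to the line `t ↦ x + t p`. -/
noncomputable def lineRestrict (c : MvPolynomial (Fin 2) ℚ) (x p : Fin 2 → ℚ) : Polynomial ℚ :=
  MvPolynomial.aeval (fun i => Polynomial.C (x i) + Polynomial.C (p i) * Polynomial.X) c

theorem eval_lineRestrict (c : MvPolynomial (Fin 2) ℚ) (x p : Fin 2 → ℚ) (t : ℚ) :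
    (lineRestrict c x p).eval t = MvPolynomial.eval (fun i => x i + p i * t) c := by
  unfold lineRestrict
  induction c using MvPolynomial.induction_on with
  | C r => simp
  | add f g hf hg => simp [hf, hg]
  | mul_X f i hf => simp [hf]

theorem natDegree_lineRestrict_monomial (a : Fin 2 →₀ ℕ) (r : ℚ) (x p : Fin 2 → ℚ) :
    (lineRestrict (MvPolynomial.monomial a r) x p).natDegree ≤ a 0 + a 1 ∧
    (lineRestrict (MvPolynomial.monomial a r) x p).coeff (a 0 + a 1) =
      MvPolynomial.eval p (MvPolynomial.monomial a r) := by
  have h1 : ∀ i, (Polynomial.C (x i) + Polynomial.C (p i) * Polynomial.X).natDegree ≤ 1 := by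
    intro i
    rw [add_comm]
    exact Polynomial.natDegree_linear_le
  have h2 : ∀ i, ((Polynomial.C (x i) + Polynomial.C (p i) * Polynomial.X) ^ a i).natDegree ≤ a i :=
    fun i => by simpa using Polynomial.natDegree_pow_le_of_le (a i) (h1 i)
  have h3 : ∀ i, ((Polynomial.C (x i) + Polynomial.C (p i) * Polynomial.X) ^ a i).coeff (a i) =
      p i ^ a i := by
    intro i
    have := Polynomial.coeff_pow_of_natDegree_le (m := a i) (h1 i)
    rw [mul_one] at this
    rw [this]
    simp
  have h4 : lineRestrict (MvPolynomial.monomial a r) x p =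
      Polynomial.C r * ((Polynomial.C (x 0) + Polynomial.C (p 0) * Polynomial.X) ^ a 0 *
        (Polynomial.C (x 1) + Polynomial.C (p 1) * Polynomial.X) ^ a 1) := by
    rw [lineRestrict, MvPolynomial.aeval_monomial, Finsupp.prod_fintype _ _ fun _ => pow_zero _,
      Fin.prod_univ_two, Polynomial.algebraMap_eq]
  rw [h4]
  constructor
  · refine (Polynomial.natDegree_C_mul_le _ _).trans (Polynomial.natDegree_mul_le.trans ?_)
    exact add_le_add (h2 0) (h2 1)
  · rw [Polynomial.coeff_C_mul, Polynomial.coeff_mul_add_eq_of_natDegree_le (h2 0) (h2 1), h3, h3,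
      MvPolynomial.eval_monomial, Finsupp.prod_fintype _ _ fun _ => pow_zero _, Fin.prod_univ_two]

theorem degree_eq_add (a : Fin 2 →₀ ℕ) : a.degree = a 0 + a 1 := by
  rw [Finsupp.degree_eq_sum, Fin.sum_univ_two]

theorem natDegree_lineRestrict_le {c : MvPolynomial (Fin 2) ℚ} {D : ℕ} (hc : c.totalDegree ≤ D)
    (x p : Fin 2 → ℚ) : (lineRestrict c x p).natDegree ≤ D := by
  rw [c.as_sum, lineRestrict, map_sum]
  refine Polynomial.natDegree_sum_le_of_forall_le _ _ fun a ha => ?_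
  refine (natDegree_lineRestrict_monomial a _ x p).1.trans ?_
  rw [← degree_eq_add]
  exact (MvPolynomial.le_totalDegree ha).trans hc

/-- The point is that the coefficient of t^D sees only the direction p and not the base point x,
which makes leading forms on different residue classes comparable. -/
theorem coeff_lineRestrict {c : MvPolynomial (Fin 2) ℚ} {D : ℕ} (hc : c.totalDegree ≤ D)
    (x p : Fin 2 → ℚ) : (lineRestrict c x p).coeff D =
      MvPolynomial.eval p (MvPolynomial.homogeneousComponent D c) := by
  rw [MvPolynomial.homogeneousComponent_apply, map_sum, Finset.sum_filter]
  nth_rw 1 [c.as_sum]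
  rw [lineRestrict, map_sum, Polynomial.finsetSum_coeff]
  refine Finset.sum_congr rfl fun a ha => ?_
  have h := natDegree_lineRestrict_monomial a (MvPolynomial.coeff a c) x p
  have hle : a.degree ≤ D := (MvPolynomial.le_totalDegree ha).trans hc
  split_ifs with ha'
  · rw [← ha', degree_eq_add]
    exact h.2
  · refine Polynomial.coeff_eq_zero_of_natDegree_lt (h.1.trans_lt ?_)
    rw [← degree_eq_add]
    omega

theorem coeff_le_coeff_of_eventually_le {φ ψ : Polynomial ℚ} {D : ℕ} (hφ : φ.natDegree ≤ D)
    (hψ : ψ.natDegree ≤ D) (h : ∀ᶠ t : ℕ in atTop, φ.eval (t : ℚ) ≤ ψ.eval (t : ℚ)) :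
    φ.coeff D ≤ ψ.coeff D := by
  by_contra! hlt
  have hc : (φ - ψ).coeff D = φ.coeff D - ψ.coeff D := Polynomial.coeff_sub _ _ _
  have hdeg : (φ - ψ).natDegree ≤ D := (Polynomial.natDegree_sub_le _ _).trans (max_le hφ hψ)
  have hpos : 0 < (φ - ψ).coeff D := by rw [hc]; linarith
  have hD : (φ - ψ).natDegree = D :=
    le_antisymm hdeg (Polynomial.le_natDegree_of_ne_zero hpos.ne')
  rcases Nat.eq_zero_or_pos D with rfl | hD0
  · obtain ⟨t, ht⟩ := h.exists
    rw [Polynomial.eq_C_of_natDegree_le_zero hφ, Polynomial.eq_C_of_natDegree_le_zero hψ,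
      Polynomial.eval_C, Polynomial.eval_C] at ht
    linarith
  · have ht := ((φ - ψ).tendsto_atTop_of_leadingCoeff_nonneg
      (Polynomial.natDegree_pos_iff_degree_pos.1 (by omega))
      (by rw [Polynomial.leadingCoeff, hD]; exact hpos.le)).comp
        (tendsto_natCast_atTop_atTop (R := ℚ))
    obtain ⟨t, h1, h2⟩ := (h.and (ht.eventually_gt_atTop 0)).exists
    simp only [Function.comp_apply, Polynomial.eval_sub] at h2
    linarith

theorem homogeneousComponent_totalDegree_ne_zero {c : MvPolynomial (Fin 2) ℚ} (hc : c ≠ 0) :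
    MvPolynomial.homogeneousComponent c.totalDegree c ≠ 0 := by
  obtain ⟨a, ha, ha'⟩ := Finset.exists_mem_eq_sup c.support
    (MvPolynomial.support_nonempty.2 hc) (fun s => s.sum fun _ e => e)
  intro h
  have h2 := congrArg (MvPolynomial.coeff a) h
  rw [MvPolynomial.coeff_homogeneousComponent, 
    if_pos (show a.degree = c.totalDegree from ha'.symm), MvPolynomial.coeff_zero] at h2
  exact MvPolynomial.mem_support_iff.1 ha h2

theorem polyDegree_eq_of_isHomogeneous {P : MvPolynomial (Fin 2) ℚ} {D : ℕ}
    (hP : P.IsHomogeneous D) (hP0 : P ≠ 0) : polyDegree P = (D : WithBot ℕ) := by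
  have h : ∀ a ∈ P.support, ((a 0 + a 1 : ℕ) : WithBot ℕ) = D := by
    intro a ha
    rw [← degree_eq_add, Finsupp.degree_eq_weight_one]
    exact congrArg _ (hP (MvPolynomial.mem_support_iff.1 ha))
  rw [polyDegree, Finset.sup_congr rfl h, Finset.sup_const (MvPolynomial.support_nonempty.2 hP0)]

theorem polyDegree_sub_homogeneousComponent_lt {c : MvPolynomial (Fin 2) ℚ} {D : ℕ}
    (hc : c.totalDegree ≤ D) :
    polyDegree (c - MvPolynomial.homogeneousComponent D c) < (D : WithBot ℕ) := by
  refine (Finset.sup_lt_iff (WithBot.bot_lt_coe D)).2 fun a ha => ?_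
  rw [MvPolynomial.mem_support_iff, MvPolynomial.coeff_sub,
    MvPolynomial.coeff_homogeneousComponent] at ha
  rw [← degree_eq_add]
  split_ifs at ha with h
  · simp at ha
  · rw [sub_zero] at ha
    have := (MvPolynomial.le_totalDegree (MvPolynomial.mem_support_iff.2 ha)).trans hc
    exact WithBot.coe_lt_coe.2 (lt_of_le_of_ne this h)

/-- A polynomial which vanishes on enough lattice points is zero. -/
theorem eq_zero_of_eval_eq_zero {h : MvPolynomial (Fin 2) ℚ} {N : ℕ} (hN : 0 < N)
    {S : Set (ℕ × ℕ)} {p₀ : ℕ × ℕ}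
    (hp₀ : ∀ x : ℕ × ℕ, ∀ᶠ t : ℕ in atTop, (x.1 + t * p₀.1, x.2 + t * p₀.2) ∈ S)
    (h0 : ∀ p ∈ S, MvPolynomial.eval ![(N * p.1 : ℚ), (N * p.2 : ℚ)] h = 0) : h = 0 := by
  have key : ∀ x : ℕ × ℕ, MvPolynomial.eval ![(N * x.1 : ℚ), (N * x.2 : ℚ)] h = 0 := by
    intro x
    -- The line through x in direction p₀ eventually runs inside S, so h vanishes at infinitely many
    -- of its points and therefore also at x.
    let φ := lineRestrict h ![(N * x.1 : ℚ), (N * x.2 : ℚ)] ![(N * p₀.1 : ℚ), (N * p₀.2 : ℚ)]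
    have hφ : φ = 0 := by
      obtain ⟨T, hT⟩ := eventually_atTop.1 (hp₀ x)
      refine Polynomial.eq_zero_of_infinite_isRoot φ ?_
      refine Set.infinite_of_injective_forall_mem (f := fun t : ℕ => ((T + t : ℕ) : ℚ))
        (fun a b hab => by simpa using hab) fun t => ?_
      have := h0 _ (hT (T + t) (Nat.le_add_right _ _))
      change φ.eval _ = 0
      rw [eval_lineRestrict, ← this]
      congr 2
      funext i
      fin_cases i <;> simp <;> ring
    have := eval_lineRestrict h ![(N * x.1 : ℚ), (N * x.2 : ℚ)]
      ![(N * p₀.1 : ℚ), (N * p₀.2 : ℚ)] 0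
    simp only [mul_zero, add_zero] at this
    rw [← this]
    change φ.eval 0 = 0
    rw [hφ, Polynomial.eval_zero]
  refine MvPolynomial.funext_set (fun _ => Set.range fun n : ℕ => (N * n : ℚ)) (fun _ => ?_)
    fun y hy => ?_
  · exact Set.infinite_range_of_injective fun a b hab => by
      have : (N : ℚ) ≠ 0 := by positivity
      simpa [this] using hab
  · obtain ⟨m, hm⟩ := hy 0 trivial
    obtain ⟨n, hn⟩ := hy 1 trivial
    rw [map_zero, ← key (m, n)]
    congr 2
    funext i
    fin_cases i
    · exact hm.symm
    · exact hn.symm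

/-- Squeezing: g i ≤ g (i+1) ≤ g (i+N) = g i. -/
theorem eq_of_monotone_of_periodic {g : ℕ → ℚ} {N : ℕ} (hN : 0 < N) (hg : Monotone g)
    (hper : ∀ i, g (i + N) = g i) (i : ℕ) : g i = g 0 := by
  induction i with
  | zero => rfl
  | succ i ih =>
    rw [← ih]
    exact le_antisymm ((hg (by omega : i + 1 ≤ i + N)).trans (hper i).le) (hg i.le_succ)

theorem QuasiPolynomial₂.constituentAt_add_mul (q : QuasiPolynomial₂) (m n t u v : ℕ) :
    q.constituentAt (m + t * (q.period * u)) (n + t * (q.period * v)) = q.constituentAt m n := by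
  unfold QuasiPolynomial₂.constituentAt
  congr 2 <;>
  · rw [show ∀ a b c : ℕ, a * (b * c) = b * (a * c) from fun a b c => by ring,
      Nat.add_mul_mod_self_left]

theorem QuasiPolynomial₂.constituentAt_val (q : QuasiPolynomial₂) (a b : Fin q.period) :
    q.constituentAt a b = q.constituent a b := by
  unfold QuasiPolynomial₂.constituentAt
  congr 1 <;> exact Fin.ext (Nat.mod_eq_of_lt (Fin.is_lt _))

/-- The values of a quasi-polynomial along an arithmetic progression. -/
theorem QuasiPolynomial₂.eval_add_mul (q : QuasiPolynomial₂) (x p : ℕ × ℕ) (t : ℕ) :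
    q.eval (x.1 + t * (q.period * p.1)) (x.2 + t * (q.period * p.2)) =
      (lineRestrict (q.constituentAt x.1 x.2) ![(x.1 : ℚ), (x.2 : ℚ)]
        ![(q.period * p.1 : ℚ), (q.period * p.2 : ℚ)]).eval (t : ℚ) := by
  rw [QuasiPolynomial₂.eval, q.constituentAt_add_mul, eval_lineRestrict]
  congr 2
  funext i
  fin_cases i <;> simp <;> ring

/-- A function with quasi-polynomial values on a region which is monotone in the first and antitone in
the second variable has a polynomial as its leading form. -/
theorem QuasiPolynomial₂.exists_leadingForm (q : QuasiPolynomial₂) {H : ℕ → ℕ → ℕ}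
    {Ω : ℕ → ℕ → Prop} (hq : ∀ m n, Ω m n → (H m n : ℚ) = q.eval m n)
    (hm : ∀ m n, H m n ≤ H (m + 1) n) (hn : ∀ m n, H m (n + 1) ≤ H m n)
    {C δ : ℕ} (hC : ∀ m n, H m n ≤ C * (m + 1) ^ δ) {S : Set (ℕ × ℕ)}
    (hS : ∀ p ∈ S, ∀ x : ℕ × ℕ, ∀ᶠ t : ℕ in atTop, Ω (x.1 + t * p.1) (x.2 + t * p.2))
    {p₀ : ℕ × ℕ}
    (hp₀ : ∀ x : ℕ × ℕ, ∀ᶠ t : ℕ in atTop, (x.1 + t * p₀.1, x.2 + t * p₀.2) ∈ S) :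
    ∃ (P : MvPolynomial (Fin 2) ℚ) (Q : QuasiPolynomial₂) (t : ℕ), Q.period = q.period ∧
      P.IsHomogeneous t ∧ t ≤ δ ∧ (Q.degree < polyDegree P ∨ (P = 0 ∧ Q.degree = ⊥)) ∧
      (∀ m n, Ω m n → (H m n : ℚ) = MvPolynomial.eval ![(m : ℚ), (n : ℚ)] P + Q.eval m n) ∧
      ((∃ p ∈ S, ∃ κ : ℕ, ∀ t : ℕ, t ^ δ ≤ κ * H (t * p.1) (t * p.2)) →
        polyDegree P = (δ : WithBot ℕ)) := by
  have hN := q.period_pos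
  set N := q.period with hNdef
  have hN' : (0 : ℚ) < N := by exact_mod_cast hN
  let D := Finset.univ.sup fun c : Fin q.period × Fin q.period =>
    (q.constituent c.1 c.2).totalDegree
  have hD : ∀ m n, (q.constituentAt m n).totalDegree ≤ D := fun m n =>
    Finset.le_sup (f := fun c : Fin q.period × Fin q.period =>
      (q.constituent c.1 c.2).totalDegree) (b := (⟨m % q.period,
        Nat.mod_lt m q.period_pos⟩, ⟨n % q.period, Nat.mod_lt n q.period_pos⟩)) (Finset.mem_univ _)
  let φ : ℕ × ℕ → ℕ × ℕ → Polynomial ℚ := fun x p =>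
    lineRestrict (q.constituentAt x.1 x.2) ![(x.1 : ℚ), (x.2 : ℚ)] ![(N * p.1 : ℚ), (N * p.2 : ℚ)]
  have hφdeg : ∀ x p, (φ x p).natDegree ≤ D := fun x p => natDegree_lineRestrict_le (hD _ _) _ _
  have hφ : ∀ x, ∀ p ∈ S, ∀ᶠ t : ℕ in atTop,
      (H (x.1 + t * (N * p.1)) (x.2 + t * (N * p.2)) : ℚ) = (φ x p).eval (t : ℚ) := by
    intro x p hp
    -- Steps by multiples of the period N keep the residue class, so a single constituent governs
    -- the whole progression.
    have h := (tendsto_id.atTop_mul_const' hN).eventually (hS p hp x)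
    filter_upwards [h] with t ht
    rw [id, mul_assoc, mul_assoc] at ht
    rw [hq _ _ ht, q.eval_add_mul]
  let h : ℕ → ℕ → MvPolynomial (Fin 2) ℚ := fun m n =>
    MvPolynomial.homogeneousComponent D (q.constituentAt m n)
  have hφD : ∀ x p, (φ x p).coeff D =
      MvPolynomial.eval ![(N * p.1 : ℚ), (N * p.2 : ℚ)] (h x.1 x.2) := fun x p =>
    coeff_lineRestrict (hD _ _) _ _
  -- For p in S the value of the leading form at p is increasing in m, decreasing in n and periodic
  -- in both, hence constant. Agreement on S suffices for equality of the forms.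
  have hh : ∀ m n, h m n = h 0 0 := by
    have hmono : ∀ n, ∀ p ∈ S, Monotone fun m => (φ (m, n) p).coeff D := by
      intro n p hp
      refine monotone_nat_of_le_succ fun m => ?_
      refine coeff_le_coeff_of_eventually_le (hφdeg _ _) (hφdeg _ _) ?_
      filter_upwards [hφ (m, n) p hp, hφ (m + 1, n) p hp] with t h1 h2
      rw [← h1, ← h2]
      have := hm (m + t * (N * p.1)) (n + t * (N * p.2))
      rw [add_right_comm] at this
      exact_mod_cast this
    have hanti : ∀ m, ∀ p ∈ S, Monotone fun n => -(φ (m, n) p).coeff D := by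
      intro m p hp
      refine monotone_nat_of_le_succ fun n => neg_le_neg ?_
      refine coeff_le_coeff_of_eventually_le (hφdeg _ _) (hφdeg _ _) ?_
      filter_upwards [hφ (m, n) p hp, hφ (m, n + 1) p hp] with t h1 h2
      rw [← h1, ← h2]
      have := hn (m + t * (N * p.1)) (n + t * (N * p.2))
      rw [add_right_comm] at this
      exact_mod_cast this
    intro m n
    rw [← sub_eq_zero]
    refine eq_zero_of_eval_eq_zero hN hp₀ fun p hp => ?_
    rw [map_sub, sub_eq_zero]
    have hper1 : ∀ m, h (m + N) n = h m n := by
      intro m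
      have := q.constituentAt_add_mul m n 1 1 0
      simp only [h]
      rw [← this]
      simp [hNdef]
    have hper2 : ∀ n, h 0 (n + N) = h 0 n := by
      intro n
      have := q.constituentAt_add_mul 0 n 1 0 1
      simp only [h]
      rw [← this]
      simp [hNdef]
    have e1 := eq_of_monotone_of_periodic hN (hmono n p hp)
      (fun i => by simp only [hφD, hper1]) m
    have e2 := eq_of_monotone_of_periodic hN (hanti 0 p hp)
      (fun i => by simp only [hφD, hper2]) n
    simp only [hφD, neg_inj] at e1 e2
    rw [e1, e2]
  have hcomp : ∀ c : Fin q.period × Fin q.period,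
      MvPolynomial.homogeneousComponent D (q.constituent c.1 c.2) = h 0 0 := by
    intro c
    rw [← q.constituentAt_val]
    exact hh _ _
  by_cases hzero : ∀ c : Fin q.period × Fin q.period, q.constituent c.1 c.2 = 0
  · have hconst : ∀ m n, q.constituentAt m n = 0 := fun m n => hzero (⟨_, _⟩, ⟨_, _⟩)
    refine ⟨0, q, 0, rfl, MvPolynomial.isHomogeneous_zero _ _ _, Nat.zero_le _,
      Or.inr ⟨rfl, ?_⟩, fun m n hmn => by rw [hq m n hmn, map_zero, zero_add], ?_⟩
    · rw [QuasiPolynomial₂.degree, Finset.sup_eq_bot_iff]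
      intro c _
      rw [hzero c, polyDegree, MvPolynomial.support_zero, Finset.sup_empty]
    · rintro ⟨p, hp, κ, hκ⟩
      obtain ⟨t, ht1, ht⟩ := ((hφ (0, 0) p hp).and (eventually_ge_atTop 1)).exists
      have h1 := hκ (t * N)
      simp only [zero_add, φ, hconst, lineRestrict, map_zero, Polynomial.eval_zero,
        Nat.cast_eq_zero] at ht1
      rw [mul_assoc, mul_assoc, ht1, mul_zero] at h1
      have : 0 < (t * N) ^ δ := by positivity
      omega
  · have hP0 : h 0 0 ≠ 0 := by
      push Not at hzero
      obtain ⟨c₀, hc₀⟩ := hzero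
      obtain ⟨c, -, hc⟩ := Finset.exists_mem_eq_sup (Finset.univ :
        Finset (Fin q.period × Fin q.period)) ⟨c₀, Finset.mem_univ _⟩
        fun c => (q.constituent c.1 c.2).totalDegree
      -- The zero polynomial has total degree 0, so the maximum may be attained by a zero
      -- constituent; then D = 0 and every nonzero constituent is a constant.
      rcases eq_or_ne (q.constituent c.1 c.2) 0 with h0 | h0
      · have hD0 : D = 0 := by
          change Finset.univ.sup _ = 0
          rw [hc, h0, MvPolynomial.totalDegree_zero]
        rw [← hcomp c₀]
        have : (q.constituent c₀.1 c₀.2).totalDegree = D := by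
          have := hD c₀.1 c₀.2
          rw [q.constituentAt_val] at this
          omega
        rw [← this]
        exact homogeneousComponent_totalDegree_ne_zero hc₀
      · rw [← hcomp c, show D = (q.constituent c.1 c.2).totalDegree from hc]
        exact homogeneousComponent_totalDegree_ne_zero h0
    have hPhom : (h 0 0).IsHomogeneous D := MvPolynomial.homogeneousComponent_isHomogeneous _ _
    have hPdeg := polyDegree_eq_of_isHomogeneous hPhom hP0
    -- Otherwise the coefficient of t^D along any ray in S is squeezed between 0 and that of a
    -- polynomial of degree at most δ < D, so the leading form would vanish on S.
    have hDδ : D ≤ δ := by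
      by_contra! hlt
      obtain ⟨p, hp, hpne⟩ : ∃ p ∈ S,
          MvPolynomial.eval ![(N * p.1 : ℚ), (N * p.2 : ℚ)] (h 0 0) ≠ 0 := by
        by_contra! hall
        exact hP0 (eq_zero_of_eval_eq_zero hN hp₀ hall)
      rw [← hφD (0, 0)] at hpne
      let ψ : Polynomial ℚ := Polynomial.C (C : ℚ) *
        (Polynomial.C (N * p.1 : ℚ) * Polynomial.X + Polynomial.C 1) ^ δ
      have hψ : ψ.natDegree ≤ δ := by
        refine (Polynomial.natDegree_C_mul_le _ _).trans ?_
        simpa using Polynomial.natDegree_pow_le_of_le δ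
          (Polynomial.natDegree_linear_le (a := (N * p.1 : ℚ)) (b := 1))
      have h1 : (φ (0, 0) p).coeff D ≤ ψ.coeff D := by
        refine coeff_le_coeff_of_eventually_le (hφdeg _ _) (hψ.trans hlt.le) ?_
        filter_upwards [hφ (0, 0) p hp] with t ht
        rw [← ht]
        have := hC (0 + t * (N * p.1)) (0 + t * (N * p.2))
        have h2 : ψ.eval (t : ℚ) = ((C * (0 + t * (N * p.1) + 1) ^ δ : ℕ) : ℚ) := by
          simp only [ψ, Polynomial.eval_mul, Polynomial.eval_pow, Polynomial.eval_add,
            Polynomial.eval_C, Polynomial.eval_X]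
          push_cast
          ring
        rw [h2]
        exact_mod_cast this
      have h2 : (0 : Polynomial ℚ).coeff D ≤ (φ (0, 0) p).coeff D := by
        refine coeff_le_coeff_of_eventually_le (by simp) (hφdeg _ _) ?_
        filter_upwards [hφ (0, 0) p hp] with t ht
        rw [← ht, Polynomial.eval_zero]
        exact Nat.cast_nonneg _
      rw [Polynomial.coeff_eq_zero_of_natDegree_lt (hψ.trans_lt hlt)] at h1
      rw [Polynomial.coeff_zero] at h2
      exact hpne (le_antisymm h1 h2)
    refine ⟨h 0 0, ⟨N, hN, fun a b => q.constituent a b - h 0 0⟩, D, rfl, hPhom, hDδ,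
      Or.inl ?_, fun m n hmn => ?_, ?_⟩
    · rw [hPdeg, QuasiPolynomial₂.degree]
      refine (Finset.sup_lt_iff (WithBot.bot_lt_coe D)).2 fun c _ => ?_
      have := polyDegree_sub_homogeneousComponent_lt (c := q.constituent c.1 c.2) (D := D)
        (by rw [← q.constituentAt_val]; exact hD _ _)
      rwa [hcomp c] at this
    · rw [hq m n hmn]
      simp [QuasiPolynomial₂.eval, QuasiPolynomial₂.constituentAt, hNdef]
    · rintro ⟨p, hp, κ, hκ⟩
      rw [hPdeg]
      congr 1
      refine le_antisymm hDδ ?_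
      by_contra! hlt
      -- With D < δ the lengths along p would be too small: the t^δ coefficients compare as N^δ ≤ 0.
      have h1 : (Polynomial.C ((N : ℚ) ^ δ) * Polynomial.X ^ δ).coeff δ ≤
          (Polynomial.C (κ : ℚ) * φ (0, 0) p).coeff δ := by
        refine coeff_le_coeff_of_eventually_le (Polynomial.natDegree_C_mul_X_pow_le _ _)
          ((Polynomial.natDegree_C_mul_le _ _).trans ((hφdeg _ _).trans hlt.le)) ?_
        filter_upwards [hφ (0, 0) p hp] with t ht
        have h2 := hκ (t * N)
        rw [Polynomial.eval_mul, Polynomial.eval_mul, ← ht]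
        simp only [Polynomial.eval_C, Polynomial.eval_pow, Polynomial.eval_X, zero_add]
        rw [mul_assoc, mul_assoc, mul_pow, mul_comm (t ^ δ)] at h2
        exact_mod_cast h2
      rw [Polynomial.coeff_C_mul_X_pow, if_pos rfl, Polynomial.coeff_C_mul,
        Polynomial.coeff_eq_zero_of_natDegree_lt ((hφdeg _ _).trans_lt hlt), mul_zero] at h1
      exact absurd h1 (not_le.2 (by positivity))

end

/-! ### Hilbert–Serre by standard monomials -/

/-- The dimension of the span of a finite family is the number of members which are not in the span
of the smaller ones. -/
theorem finrank_span_image_eq_card {k V X Y : Type*} [Field k] [AddCommGroup V] [Module k V]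
    [LinearOrder Y] [DecidableEq X] {o : X → Y} (ho : Function.Injective o) (f : X → V)
    (T : Finset X) :
    Module.finrank k (Submodule.span k (f '' T)) =
      {x ∈ (T : Set X) | f x ∉ Submodule.span k (f '' {y ∈ (T : Set X) | o y < o x})}.ncard := by
  induction T using Finset.induction_on_max_value o with
  | empty =>
    rw [Finset.coe_empty, Set.image_empty, Submodule.span_empty, finrank_bot]
    simp
  | insert a T ha hmax ih =>
    have hlt : ∀ x ∈ T, o x < o a := fun x hx =>
      lt_of_le_of_ne (hmax x hx) fun h => ha (ho h ▸ hx)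
    -- The added member is the largest, so it sees all the old ones below it and changes nothing for
    -- them.
    have e1 : {y ∈ ((insert a T : Finset X) : Set X) | o y < o a} = T := by
      ext y
      simp only [Finset.coe_insert, Set.mem_insert_iff, Finset.mem_coe, Set.mem_ofPred_eq]
      constructor
      · rintro ⟨rfl | hy, h⟩
        · exact absurd h (lt_irrefl _)
        · exact hy
      · exact fun hy => ⟨Or.inr hy, hlt y hy⟩
    have e2 : ∀ x ∈ T, {y ∈ ((insert a T : Finset X) : Set X) | o y < o x} =
        {y ∈ (T : Set X) | o y < o x} := by
      intro x hx
      ext y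
      simp only [Finset.coe_insert, Set.mem_insert_iff, Finset.mem_coe, Set.mem_ofPred_eq]
      constructor
      · rintro ⟨rfl | hy, h⟩
        · exact absurd h (hlt x hx).asymm
        · exact ⟨hy, h⟩
      · exact fun hy => ⟨Or.inr hy.1, hy.2⟩
    have hfin : ({x ∈ (T : Set X) |
        f x ∉ Submodule.span k (f '' {y ∈ (T : Set X) | o y < o x})}).Finite :=
      T.finite_toSet.subset fun x hx => hx.1
    have hTfin : Module.Finite k (Submodule.span k (f '' T)) :=
      Module.Finite.span_of_finite k (T.finite_toSet.image f)
    by_cases hmem : f a ∈ Submodule.span k (f '' T)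
    · have e3 : {x ∈ ((insert a T : Finset X) : Set X) |
          f x ∉ Submodule.span k (f '' {y ∈ ((insert a T : Finset X) : Set X) | o y < o x})} =
          {x ∈ (T : Set X) | f x ∉ Submodule.span k (f '' {y ∈ (T : Set X) | o y < o x})} := by
        ext x
        constructor
        · rintro ⟨hx, hx'⟩
          rcases Finset.mem_insert.1 hx with rfl | hx
          · rw [e1] at hx'
            exact absurd hmem hx'
          · rw [e2 x hx] at hx'
            exact ⟨hx, hx'⟩
        · rintro ⟨hx, hx'⟩
          refine ⟨Finset.mem_insert_of_mem hx, ?_⟩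
          rwa [e2 x hx]
      rw [e3, ← ih, Finset.coe_insert, Set.image_insert_eq, Submodule.span_insert_eq_span hmem]
    · have e3 : {x ∈ ((insert a T : Finset X) : Set X) |
          f x ∉ Submodule.span k (f '' {y ∈ ((insert a T : Finset X) : Set X) | o y < o x})} =
          insert a {x ∈ (T : Set X) |
            f x ∉ Submodule.span k (f '' {y ∈ (T : Set X) | o y < o x})} := by
        ext x
        constructor
        · rintro ⟨hx, hx'⟩
          rcases Finset.mem_insert.1 hx with rfl | hx
          · exact Set.mem_insert _ _
          · rw [e2 x hx] at hx'
            exact Set.mem_insert_of_mem _ ⟨hx, hx'⟩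
        · rintro (rfl | ⟨hx, hx'⟩)
          · refine ⟨Finset.mem_insert_self _ _, ?_⟩
            rwa [e1]
          · refine ⟨Finset.mem_insert_of_mem hx, ?_⟩
            rwa [e2 x hx]
      rw [e3, Set.ncard_insert_of_notMem (fun h => ha h.1) hfin, ← ih, Finset.coe_insert,
        Set.image_insert_eq, Submodule.span_insert]
      have hne : f a ≠ 0 := fun h => hmem (h ▸ zero_mem _)
      have h1 := Submodule.finrank_sup_add_finrank_inf_eq (Submodule.span k {f a})
        (Submodule.span k (f '' T))
      rw [disjoint_iff.1 ((Submodule.disjoint_span_singleton' hne).2 hmem).symm, finrank_bot,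
        finrank_span_singleton hne] at h1
      omega

/-- In a strictly descending chain choose a_n in L_n but not in L_{n+1}. A pair i < j with a_i ≤ a_j
puts a_i into L_{i+1}, a contradiction. For exponents this is Dickson's lemma. -/
theorem wellFounded_lowerSet (α : Type*) [PartialOrder α] [WellQuasiOrderedLE α] :
    WellFoundedLT (LowerSet α) := by
  rw [WellFoundedLT, isWellFounded_iff, RelEmbedding.wellFounded_iff_isEmpty]
  refine ⟨fun L => ?_⟩
  have hlt : ∀ n, L (n + 1) < L n := fun n => L.map_rel_iff.2 (Nat.lt_succ_self n)
  have hanti : Antitone L := antitone_nat_of_succ_le fun n => (hlt n).le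
  choose a ha ha' using fun n => Set.exists_of_ssubset (LowerSet.coe_ssubset_coe.2 (hlt n))
  obtain ⟨i, j, hij, hle⟩ := wellQuasiOrdered_le a
  exact ha' i ((L (i + 1)).lower hle (hanti hij (ha j)))

section LowerSetSeries

variable {σ : Type*}

theorem finite_weight_eq [Fintype σ] {γ : σ → Fin 2 →₀ ℕ} (hγ : ∀ i, γ i ≠ 0) (w : Fin 2 →₀ ℕ) :
    {a : σ →₀ ℕ | Finsupp.weight γ a = w}.Finite := by
  refine (Finsupp.finite_of_nat_weight_eq (fun i => (γ i).degree)
    (fun i => by rw [Ne, Finsupp.degree_eq_zero_iff]; exact hγ i) w.degree).subset ?_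
  rintro a rfl
  simp [Finsupp.weight_eq_sum]

/-- The generating function by weight of a set of exponents. -/
noncomputable def weightSeries (γ : σ → Fin 2 →₀ ℕ) (L : Set (σ →₀ ℕ)) :
    MvPowerSeries (Fin 2) ℤ :=
  fun w => ({a ∈ L | Finsupp.weight γ a = w}.ncard : ℤ)

theorem coeff_weightSeries (γ : σ → Fin 2 →₀ ℕ) (L : Set (σ →₀ ℕ)) (w : Fin 2 →₀ ℕ) :
    MvPowerSeries.coeff w (weightSeries γ L) = ({a ∈ L | Finsupp.weight γ a = w}.ncard : ℤ) := rfl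

/-- Exponents are split by whether the i-th entry vanishes; the others are shifted down by one.
Finiteness of the fibres of the weight is what makes the counts additive. -/
theorem weightSeries_eq_add [Fintype σ] {γ : σ → Fin 2 →₀ ℕ} (hγ : ∀ i, γ i ≠ 0) (L : Set (σ →₀ ℕ)) (i : σ) :
    weightSeries γ L = weightSeries γ {a ∈ L | a i = 0} +
      MvPowerSeries.monomial (γ i) 1 * weightSeries γ {a | a + Finsupp.single i 1 ∈ L} := by
  classical
  ext w
  rw [map_add, MvPowerSeries.coeff_monomial_mul]
  simp only [coeff_weightSeries, one_mul]
  have hfin : ∀ L : Set (σ →₀ ℕ), {a ∈ L | Finsupp.weight γ a = w}.Finite := fun L =>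
    (finite_weight_eq hγ w).subset fun a ha => ha.2
  have hsplit : {a ∈ L | Finsupp.weight γ a = w} =
      {a ∈ {a ∈ L | a i = 0} | Finsupp.weight γ a = w} ∪
      (fun a => a + Finsupp.single i 1) ''
        {a ∈ {a | a + Finsupp.single i 1 ∈ L} | Finsupp.weight γ a + γ i = w} := by
    ext a
    constructor
    · rintro ⟨ha, hw⟩
      by_cases hi : a i = 0
      · exact Or.inl ⟨⟨ha, hi⟩, hw⟩
      · have h1 : a - Finsupp.single i 1 + Finsupp.single i 1 = a := by
          refine tsub_add_cancel_of_le ?_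
          rw [Finsupp.single_le_iff]
          omega
        refine Or.inr ⟨a - Finsupp.single i 1, ⟨?_, ?_⟩, h1⟩
        · change _ ∈ L
          rwa [h1]
        · have := congrArg (Finsupp.weight γ) h1
          rw [map_add, Finsupp.weight_single, one_smul] at this
          rw [this, hw]
    · rintro (⟨⟨ha, -⟩, hw⟩ | ⟨b, ⟨hb, hw⟩, rfl⟩)
      · exact ⟨ha, hw⟩
      · refine ⟨hb, ?_⟩
        rw [map_add, Finsupp.weight_single, one_smul, hw]
  have hdisj : Disjoint {a ∈ {a ∈ L | a i = 0} | Finsupp.weight γ a = w}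
      ((fun a => a + Finsupp.single i 1) ''
        {a ∈ {a | a + Finsupp.single i 1 ∈ L} | Finsupp.weight γ a + γ i = w}) := by
    rw [Set.disjoint_left]
    rintro _ ⟨⟨-, h⟩, -⟩ ⟨b, -, rfl⟩
    simp at h
  have himg := Set.ncard_image_of_injective
    {a ∈ {a | a + Finsupp.single i 1 ∈ L} | Finsupp.weight γ a + γ i = w}
    (add_left_injective (Finsupp.single i 1))
  have hfin2 : ((fun a => a + Finsupp.single i 1) ''
      {a ∈ {a | a + Finsupp.single i 1 ∈ L} | Finsupp.weight γ a + γ i = w}).Finite :=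
    (hfin L).subset (by rw [hsplit]; exact Set.subset_union_right)
  rw [hsplit, Set.ncard_union_eq hdisj (hfin _) hfin2, himg, Nat.cast_add]
  congr 1
  split_ifs with h
  · simp only [eq_tsub_iff_add_eq_of_le h]
  · rw [Nat.cast_eq_zero, Set.ncard_eq_zero ((finite_weight_eq hγ (w - γ i)).subset fun a ha => ?_)]
    · ext a
      simp only [Set.mem_ofPred_eq, Set.mem_empty_iff_false, iff_false, not_and]
      rintro - rfl
      exact h le_add_self
    · exact (h (ha.2 ▸ le_add_self)).elim

/-- Let L₀ be the slice a_i = 0 and L₁ ⊆ L the shift of L down by one in direction i. If L₁ is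
strictly smaller, Noetherian induction on L applies to it. If L₁ = L, the splitting of the series
reads (1 - x^{γ_i})·W(L) = W(L₀), where W is the generating series, and one variable fewer is
involved. -/
theorem exists_polynomial_weightSeries [Fintype σ] {γ : σ → Fin 2 →₀ ℕ} (hγ : ∀ i, γ i ≠ 0) (s : Finset σ) :
    ∀ L : LowerSet (σ →₀ ℕ), (∀ a ∈ L, ∀ i ∉ s, a i = 0) →
      ∃ p : MvPolynomial (Fin 2) ℤ,
        weightSeries γ (L : Set (σ →₀ ℕ)) * ∏ i ∈ s, (1 - MvPowerSeries.monomial (γ i) 1) =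
          (p : MvPowerSeries (Fin 2) ℤ) := by
  classical
  induction s using Finset.induction_on with
  | empty =>
    intro L hL
    have h0 : ∀ a ∈ L, a = 0 := fun a ha => Finsupp.ext fun i => hL a ha i (Finset.notMem_empty i)
    by_cases h : (0 : σ →₀ ℕ) ∈ L
    · refine ⟨1, ?_⟩
      rw [Finset.prod_empty, mul_one, MvPolynomial.coe_one]
      ext w
      rw [coeff_weightSeries, MvPowerSeries.coeff_one]
      split_ifs with hw
      · have : {a ∈ (L : Set (σ →₀ ℕ)) | Finsupp.weight γ a = w} = {0} := by
          ext a
          constructor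
          · exact fun ha => h0 a ha.1
          · rintro rfl
            exact ⟨h, by rw [map_zero, hw]⟩
        rw [this, Set.ncard_singleton, Nat.cast_one]
      · have : {a ∈ (L : Set (σ →₀ ℕ)) | Finsupp.weight γ a = w} = ∅ := by
          ext a
          simp only [Set.mem_ofPred_eq, Set.mem_empty_iff_false, iff_false]
          rintro ⟨ha, ha'⟩
          rw [h0 a ha, map_zero] at ha'
          exact hw ha'.symm
        rw [this, Set.ncard_empty, Nat.cast_zero]
    · refine ⟨0, ?_⟩
      rw [Finset.prod_empty, mul_one, MvPolynomial.coe_zero]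
      ext w
      rw [coeff_weightSeries, map_zero]
      have : {a ∈ (L : Set (σ →₀ ℕ)) | Finsupp.weight γ a = w} = ∅ := by
        ext a
        simp only [Set.mem_ofPred_eq, Set.mem_empty_iff_false, iff_false]
        rintro ⟨ha, -⟩
        exact h (h0 a ha ▸ ha)
      rw [this, Set.ncard_empty, Nat.cast_zero]
  | insert i s hi ih =>
    intro L
    have := wellFounded_lowerSet (σ →₀ ℕ)
    induction L using WellFoundedLT.induction with
    | ind L ihL =>
      intro hL
      let L₀ : LowerSet (σ →₀ ℕ) := ⟨{a ∈ (L : Set (σ →₀ ℕ)) | a i = 0}, fun a b hba ha =>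
        ⟨L.lower hba ha.1, Nat.le_zero.1 ((hba i).trans_eq ha.2)⟩⟩
      let L₁ : LowerSet (σ →₀ ℕ) := ⟨{a | a + Finsupp.single i 1 ∈ L}, fun a b hba ha =>
        L.lower (add_le_add_left hba _) ha⟩
      obtain ⟨p, hp⟩ := ih L₀ (by
        intro a ha j hj
        by_cases hji : j = i
        · rw [hji]; exact ha.2
        · exact hL a ha.1 j (by simp [hji, hj]))
      have hL₁ : L₁ ≤ L := fun a ha => L.lower le_self_add ha
      have hrec : weightSeries γ (L : Set (σ →₀ ℕ)) = weightSeries γ (L₀ : Set (σ →₀ ℕ)) +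
          MvPowerSeries.monomial (γ i) 1 * weightSeries γ (L₁ : Set (σ →₀ ℕ)) :=
        weightSeries_eq_add hγ _ i
      rw [Finset.prod_insert hi]
      rcases hL₁.lt_or_eq with hlt | heq
      · obtain ⟨q, hq⟩ := ihL L₁ hlt fun a ha j hj => hL a (hL₁ ha) j hj
        rw [Finset.prod_insert hi] at hq
        refine ⟨p * (1 - MvPolynomial.monomial (γ i) 1) + MvPolynomial.monomial (γ i) 1 * q, ?_⟩
        have hsub : ((1 - MvPolynomial.monomial (γ i) 1 : MvPolynomial (Fin 2) ℤ) :
            MvPowerSeries (Fin 2) ℤ) = 1 - MvPowerSeries.monomial (γ i) 1 := by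
          rw [← MvPolynomial.coe_monomial, ← MvPolynomial.coe_one, eq_sub_iff_add_eq,
            ← MvPolynomial.coe_add, sub_add_cancel]
        rw [MvPolynomial.coe_add, MvPolynomial.coe_mul, MvPolynomial.coe_mul, hsub,
          MvPolynomial.coe_monomial, ← hp, ← hq, hrec]
        ring
      · rw [heq] at hrec
        refine ⟨p, ?_⟩
        rw [← hp]
        linear_combination (∏ j ∈ s, (1 - MvPowerSeries.monomial (γ j) (1 : ℤ))) * hrec

end LowerSetSeries

/-- The product of powers of the `y i`. -/
def monomialValue {σ A : Type*} [CommRing A] (y : σ → A) (a : σ →₀ ℕ) : A :=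
  a.prod fun i n => y i ^ n

theorem monomialValue_add {σ A : Type*} [CommRing A] (y : σ → A) (a b : σ →₀ ℕ) :
    monomialValue y (a + b) = monomialValue y a * monomialValue y b :=
  Finsupp.prod_add_index' (fun _ => pow_zero _) fun _ _ _ => pow_add _ _ _

/-- The span of the monomials in the `y i` of weight `w`. -/
def weightSpan (k : Type*) {σ A : Type*} [Field k] [CommRing A] [Algebra k A] (y : σ → A)
    (γ : σ → Fin 2 →₀ ℕ) (w : Fin 2 →₀ ℕ) : Submodule k A :=
  Submodule.span k (monomialValue y '' {a | Finsupp.weight γ a = w})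

/-- The generating function of the dimensions of the spans of the monomials of given weight. -/
noncomputable def weightSpanSeries (k : Type*) {σ A : Type*} [Field k] [CommRing A] [Algebra k A]
    (y : σ → A) (γ : σ → Fin 2 →₀ ℕ) : MvPowerSeries (Fin 2) ℤ :=
  fun w => (Module.finrank k (weightSpan k y γ w) : ℤ)

/-- The standard exponents, whose monomials are not in the span of lexicographically smaller ones of
equal weight, form a lower set, as multiplying a dependency by a monomial preserves weights and
order. In each weight their number is the dimension of the span. -/
theorem exists_numerator_weightSpan (k : Type*) {σ A : Type*} [Field k] [CommRing A] [Algebra k A]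
    [Fintype σ] (y : σ → A) {γ : σ → Fin 2 →₀ ℕ} (hγ : ∀ i, γ i ≠ 0) :
    ∃ p : MvPolynomial (Fin 2) ℤ,
      weightSpanSeries k y γ * ∏ i, (1 - MvPowerSeries.monomial (γ i) 1) = (p : MvPowerSeries (Fin 2) ℤ) := by
  classical
  let _ : LinearOrder σ := LinearOrder.lift' (Fintype.equivFin σ) (Equiv.injective _)
  let L : LowerSet (σ →₀ ℕ) :=
    ⟨{a | monomialValue y a ∉ Submodule.span k (monomialValue y ''
      {b | Finsupp.weight γ b = Finsupp.weight γ a ∧ toLex b < toLex a})}, by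
      intro a b hba ha hb
      obtain ⟨c, rfl⟩ := exists_add_of_le hba
      refine ha ?_
      rw [monomialValue_add, mul_comm]
      have h1 := Submodule.mem_map_of_mem (f := LinearMap.mulLeft k (monomialValue y c)) hb
      rw [Submodule.map_span, ← Set.image_comp] at h1
      refine Submodule.span_mono ?_ h1
      rintro _ ⟨x, ⟨hx, hx'⟩, rfl⟩
      refine ⟨x + c, ⟨by rw [map_add, map_add, hx], ?_⟩, ?_⟩
      · rw [toLex_add, toLex_add]
        exact add_lt_add_left hx' _
      · rw [monomialValue_add, mul_comm]
        rfl⟩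
  obtain ⟨p, hp⟩ := exists_polynomial_weightSeries hγ Finset.univ L fun _ _ i hi =>
    absurd (Finset.mem_univ i) hi
  refine ⟨p, ?_⟩
  rw [← hp]
  have hseries : weightSpanSeries k y γ = weightSeries γ (L : Set (σ →₀ ℕ)) := ?_
  · rw [hseries]
  funext w
  change (Module.finrank k (weightSpan k y γ w) : ℤ) = (({a ∈ (L : Set (σ →₀ ℕ)) | Finsupp.weight γ a = w}.ncard : ℕ) : ℤ)
  congr 1
  have h := finrank_span_image_eq_card (k := k) (o := fun a : σ →₀ ℕ => toLex a)
    toLex.injective (monomialValue y) (finite_weight_eq hγ w).toFinset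
  rw [Set.Finite.coe_toFinset] at h
  rw [weightSpan, h]
  congr 1
  ext a
  constructor
  · rintro ⟨rfl, ha⟩
    exact ⟨ha, rfl⟩
  · rintro ⟨ha, rfl⟩
    exact ⟨rfl, ha⟩

section Generation

variable {k A σ : Type*} [Field k] [CommRing A] [Algebra k A] {y : σ → A} {γ : σ → Fin 2 →₀ ℕ}

theorem mul_mem_weightSpan {w w' : Fin 2 →₀ ℕ} {a b : A} (ha : a ∈ weightSpan k y γ w)
    (hb : b ∈ weightSpan k y γ w') : a * b ∈ weightSpan k y γ (w + w') := by
  have h := Submodule.mul_mem_mul ha hb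
  rw [weightSpan, weightSpan, Submodule.span_mul_span] at h
  refine Submodule.span_mono ?_ h
  rintro _ ⟨_, ⟨x, rfl, rfl⟩, _, ⟨z, rfl, rfl⟩, rfl⟩
  exact ⟨x + z, map_add _ _ _, monomialValue_add y x z⟩

theorem mem_weightSpan_self (i : σ) : y i ∈ weightSpan k y γ (γ i) :=
  Submodule.subset_span ⟨Finsupp.single i 1, by simp [Finsupp.weight_single],
    by simp [monomialValue]⟩

theorem one_mem_weightSpan : (1 : A) ∈ weightSpan k y γ 0 :=
  Submodule.subset_span ⟨0, map_zero _, by simp [monomialValue]⟩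

theorem biExponent_add (a b c d : ℕ) :
    biExponent a b + biExponent c d = biExponent (a + c) (b + d) := by
  symm
  rw [biExponent_eq_iff]
  simp

/-- The sum of the spans of the monomials whose weight has second component `n`. -/
noncomputable def secondWeightSpan (k : Type*) [Field k] [Algebra k A] (y : σ → A) (γ : σ → Fin 2 →₀ ℕ)
    (n : ℕ) : Submodule k A :=
  ⨆ m, weightSpan k y γ (biExponent m n)

theorem mul_mem_secondWeightSpan {n n' : ℕ} {a b : A} (ha : a ∈ secondWeightSpan k y γ n)
    (hb : b ∈ secondWeightSpan k y γ n') : a * b ∈ secondWeightSpan k y γ (n + n') := by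
  have h := Submodule.mul_mem_mul ha hb
  rw [secondWeightSpan, secondWeightSpan, Submodule.iSup_mul] at h
  refine (iSup_le fun m => ?_ : _ ≤ secondWeightSpan k y γ (n + n')) h
  rw [Submodule.mul_iSup]
  refine iSup_le fun m' => le_iSup_of_le (m + m') (Submodule.mul_le.2 fun a ha b hb => ?_)
  rw [← biExponent_add]
  exact mul_mem_weightSpan ha hb

theorem mem_secondWeightSpan_self (i : σ) : y i ∈ secondWeightSpan k y γ (γ i 1) :=
  Submodule.mem_iSup_of_mem (γ i 0) (by rw [biExponent_self]; exact mem_weightSpan_self i)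

theorem one_mem_secondWeightSpan : (1 : A) ∈ secondWeightSpan k y γ 0 :=
  Submodule.mem_iSup_of_mem 0
    (by rw [show biExponent 0 0 = 0 from biExponent_eq_iff.2 ⟨rfl, rfl⟩]; exact one_mem_weightSpan)

theorem monomialValue_mem {𝒜 : ℕ → Submodule k A} [GradedAlgebra 𝒜] {I : ℕ → Ideal A}
    (hI : IsHomogeneousFiltration 𝒜 I) (h𝒜 : ∀ i, y i ∈ 𝒜 (γ i 0)) (hyI : ∀ i, y i ∈ I (γ i 1))
    (a : σ →₀ ℕ) : monomialValue y a ∈ 𝒜 (Finsupp.weight γ a 0) ∧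
      monomialValue y a ∈ I (Finsupp.weight γ a 1) := by
  classical
  induction a using Finsupp.induction_linear with
  | zero =>
    refine ⟨?_, ?_⟩
    · simpa [monomialValue] using SetLike.GradedOne.one_mem (A := 𝒜)
    · simp [hI.zero_eq_top]
  | add a b ha hb =>
    rw [monomialValue_add, map_add]
    exact ⟨SetLike.mul_mem_graded ha.1 hb.1, hI.mul_le _ _ (Ideal.mul_mem_mul ha.2 hb.2)⟩
  | single i n =>
    rw [Finsupp.weight_single, monomialValue,
      Finsupp.prod_single_index (h := fun i n => y i ^ n) (pow_zero _)]
    exact ⟨SetLike.pow_mem_graded n (h𝒜 i), hI.pow_mem (hyI i) n⟩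

theorem decompose_mem_weightSpan {𝒜 : ℕ → Submodule k A} [GradedAlgebra 𝒜]
    (h𝒜 : ∀ w, weightSpan k y γ w ≤ 𝒜 (w 0)) {n : ℕ} {a : A}
    (ha : a ∈ secondWeightSpan k y γ n) (m : ℕ) :
    (DirectSum.decompose 𝒜 a m : A) ∈ weightSpan k y γ (biExponent m n) := by
  classical
  rw [secondWeightSpan] at ha
  induction ha using Submodule.iSup_induction' with
  | mem m' x hx =>
    have hx' : x ∈ 𝒜 m' := by simpa using h𝒜 _ hx
    rw [DirectSum.decompose_of_mem 𝒜 hx']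
    by_cases h : m' = m
    · subst h
      rwa [DirectSum.of_eq_same]
    · rw [DirectSum.of_eq_of_ne _ _ _ (Ne.symm h)]
      exact zero_mem _
  | zero => simp
  | add x z _ _ hx hz =>
    rw [DirectSum.decompose_add]
    exact add_mem hx hz

theorem mem_secondWeightSpan_of_adjoin {X : Set A} (hX : ∀ a ∈ X, a ∈ secondWeightSpan k y γ 0)
    (htop : Algebra.adjoin k X = ⊤) (a : A) : a ∈ secondWeightSpan k y γ 0 := by
  have ha : a ∈ Algebra.adjoin k X := htop ▸ Algebra.mem_top
  induction ha using Algebra.adjoin_induction with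
  | mem a ha => exact hX a ha
  | algebraMap c =>
    rw [Algebra.algebraMap_eq_smul_one]
    exact Submodule.smul_mem _ _ one_mem_secondWeightSpan
  | add a b _ _ ha hb => exact add_mem ha hb
  | mul a b _ _ ha hb =>
    rw [← add_zero 0]
    exact mul_mem_secondWeightSpan ha hb

theorem coeff_mem_secondWeightSpan {X : Set (Polynomial A)}
    (h0 : ∀ a : A, a ∈ secondWeightSpan k y γ 0)
    (hX : ∀ f ∈ X, ∀ n, f.coeff n ∈ secondWeightSpan k y γ n) {f : Polynomial A}
    (hf : f ∈ Algebra.adjoin A X) (n : ℕ) : f.coeff n ∈ secondWeightSpan k y γ n := by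
  induction hf using Algebra.adjoin_induction generalizing n with
  | mem a ha => exact hX a ha n
  | algebraMap c =>
    rw [Polynomial.algebraMap_apply, Polynomial.coeff_C]
    split_ifs with h
    · rw [h]
      exact h0 _
    · exact zero_mem _
  | add a b _ _ ha hb =>
    rw [Polynomial.coeff_add]
    exact add_mem (ha n) (hb n)
  | mul a b _ _ ha hb =>
    rw [Polynomial.coeff_mul]
    refine Submodule.sum_mem _ fun c hc => ?_
    rw [← Finset.HasAntidiagonal.mem_antidiagonal.1 hc]
    exact mul_mem_secondWeightSpan (ha _) (hb _)

end Generation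

/-- The Hilbert–Serre theorem for the Rees algebra of a filtration. -/
theorem IsGeneratingSystem.exists_numerator {k A : Type*} [Field k] [CommRing A] [Algebra k A]
    {𝒜 : ℕ → Submodule k A} [GradedAlgebra 𝒜] {I : ℕ → Ideal A}
    {hI : IsHomogeneousFiltration 𝒜 I} {r s : ℕ} {d e : Fin s → ℕ} {x : Fin r → A} {g : Fin s → A}
    (h : IsGeneratingSystem 𝒜 I hI d e x g) (he : ∀ i, 0 < e i) :
    ∃ p : MvPolynomial (Fin 2) ℤ, IsHilbertNumerator 𝒜 I r d e p := by
  classical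
  let y : Fin r ⊕ Fin s → A := Sum.elim x g
  let γ : Fin r ⊕ Fin s → Fin 2 →₀ ℕ :=
    Sum.elim (fun _ => biExponent 1 0) fun i => biExponent (d i) (e i)
  have hγ : ∀ i, γ i ≠ 0 := by
    rintro (i | i) h0
    · simpa using (biExponent_eq_iff.1 h0).1
    · exact (he i).ne' (biExponent_eq_iff.1 h0).2
  have hmem := monomialValue_mem (y := y) (γ := γ) hI
    (by rintro (i | i) <;> simp [y, γ, h.x_mem, h.g_deg])
    (by rintro (i | i) <;> simp [y, γ, hI.zero_eq_top, h.g_mem])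
  have hle : ∀ w, weightSpan k y γ w ≤ (I (w 1)).restrictScalars k ⊓ 𝒜 (w 0) := by
    intro w
    rw [weightSpan, Submodule.span_le]
    rintro _ ⟨a, rfl, rfl⟩
    exact ⟨(hmem a).2, (hmem a).1⟩
  have h0 : ∀ a : A, a ∈ secondWeightSpan k y γ 0 := by
    refine mem_secondWeightSpan_of_adjoin ?_ h.adjoin_x
    rintro _ ⟨i, rfl⟩
    simpa [y, γ] using mem_secondWeightSpan_self (k := k) (y := y) (γ := γ) (Sum.inl i)
  have hspan : ∀ w, weightSpan k y γ w = (I (w 1)).restrictScalars k ⊓ 𝒜 (w 0) := by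
    intro w
    refine le_antisymm (hle w) fun a ha => ?_
    -- An element a of (I_n)_m gives a tⁿ in the Rees algebra, so a is a combination of monomials
    -- with second weight n; its component of degree m keeps only those of weight (m,n).
    have hrees : Polynomial.monomial (w 1) a ∈ Algebra.adjoin A
        (Set.range fun i => Polynomial.monomial (e i) (g i)) := by
      rw [h.adjoin_g]
      intro n
      rw [Polynomial.coeff_monomial]
      split_ifs with hn
      · exact hn ▸ ha.1
      · exact zero_mem _
    have hcoeff := coeff_mem_secondWeightSpan (k := k) (y := y) (γ := γ) h0 (by
      rintro _ ⟨i, rfl⟩ n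
      rw [Polynomial.coeff_monomial]
      split_ifs with hn
      · rw [← hn]
        simpa [y, γ] using mem_secondWeightSpan_self (k := k) (y := y) (γ := γ) (Sum.inr i)
      · exact zero_mem _) hrees (w 1)
    rw [Polynomial.coeff_monomial_same] at hcoeff
    have := decompose_mem_weightSpan (𝒜 := 𝒜) (fun w => (hle w).trans inf_le_right) hcoeff (w 0)
    rwa [DirectSum.decompose_of_mem_same 𝒜 ha.2, biExponent_self] at this
  obtain ⟨p, hp⟩ := exists_numerator_weightSpan k y hγ
  refine ⟨p, ?_⟩
  rw [IsHilbertNumerator, ← hp, Fintype.prod_sum_type]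
  have hseries : weightSpanSeries k y γ = bigradedHilbertSeries 𝒜 I := by
    funext w
    change (Module.finrank k (weightSpan k y γ w) : ℤ) = _
    rw [hspan]
    rfl
  have hx : (MvPowerSeries.X 0 : MvPowerSeries (Fin 2) ℤ) =
      MvPowerSeries.monomial (biExponent 1 0) 1 := by
    rw [← X_pow_mul_X_pow_eq_monomial, pow_one, pow_zero, mul_one]
  rw [hseries]
  congr 2
  · rw [hx]
    simp [γ]
  · exact Finset.prod_congr rfl fun i _ => by rw [X_pow_mul_X_pow_eq_monomial]; rfl

/-! ### Geometry of the chambers and restricted cones -/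

section Chamber

variable {s l : ℕ} {d e : Fin s → ℕ} {σ : Fin l → Fin s}

/-- The ray vector which follows the one with index `j`. -/
def nextVec (d e : Fin s → ℕ) (σ : Fin l → Fin s) (j : Fin l) : ℤ × ℤ :=
  if h : (j : ℕ) + 1 < l then degVec d e (σ ⟨j + 1, h⟩) else (1, 0)

theorem detForm_degVec_nonpos_iff (he : ∀ i, 0 < e i) (i i' : Fin s) :
    detForm (degVec d e i) (degVec d e i') ≤ 0 ↔ (d i : ℚ) / e i ≤ (d i' : ℚ) / e i' := by
  rw [div_le_div_iff₀ (by exact_mod_cast he i) (by exact_mod_cast he i')]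
  change (d i : ℤ) * (e i' : ℤ) - (e i : ℤ) * (d i' : ℤ) ≤ 0 ↔ _
  rw [sub_nonpos, mul_comm (e i : ℤ)]
  norm_cast

theorem detForm_degVec_neg_iff (he : ∀ i, 0 < e i) (i i' : Fin s) :
    detForm (degVec d e i) (degVec d e i') < 0 ↔ (d i : ℚ) / e i < (d i' : ℚ) / e i' := by
  rw [← not_le, ← not_le, ← detForm_degVec_nonpos_iff he, detForm_swap, neg_nonneg]

theorem detForm_nextVec_pos (he : ∀ i, 0 < e i) (hσ : IsSlopeEnumeration d e σ) (j : Fin l) :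
    0 < detForm (nextVec d e σ j) (degVec d e (σ j)) := by
  unfold nextVec
  split_ifs with h
  · rw [detForm_swap, neg_pos, detForm_degVec_neg_iff he]
    exact hσ.1 (Fin.mk_lt_mk.2 (Nat.lt_succ_self _) : j < ⟨j + 1, h⟩)
  · simpa [detForm_apply, degVec] using he (σ j)

theorem nextVec_nonneg (j : Fin l) : 0 ≤ (nextVec d e σ j).1 ∧ 0 ≤ (nextVec d e σ j).2 := by
  unfold nextVec
  split_ifs <;> simp [degVec]

/-- No slope lies strictly between two consecutive ones, so a vector strictly right of the j-th ray
is not left of the next one; in particular j is not the last index. -/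
theorem detForm_neg_of_mem_rightRays (he : ∀ i, 0 < e i) (hσ : IsSlopeEnumeration d e σ) {j : Fin l}
    {i : Fin s} (hi : detForm (degVec d e (σ j)) (degVec d e i) < 0) :
    ∃ h : (j : ℕ) + 1 < l, 0 ≤ detForm (degVec d e i) (degVec d e (σ ⟨j + 1, h⟩)) := by
  rw [detForm_degVec_neg_iff he] at hi
  obtain ⟨j', hj'⟩ := hσ.2 i
  rw [hj'] at hi
  have hlt : j < j' := hσ.1.lt_iff_lt.1 hi
  have hlt' : (j : ℕ) + 1 ≤ j' := hlt
  refine ⟨hlt'.trans_lt j'.2, ?_⟩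
  rw [detForm_swap, neg_nonneg, detForm_degVec_nonpos_iff he, hj']
  exact hσ.1.monotone hlt'

theorem detForm_of_mem_rightRays (he : ∀ i, 0 < e i) (hσ : IsSlopeEnumeration d e σ) {j : Fin l}
    {x : ℤ × ℤ} (hx : x ∈ rightRays d e Finset.univ (degVec d e (σ j))) :
    0 < detForm x (degVec d e (σ j)) ∧ 0 ≤ detForm x (nextVec d e σ j) := by
  rcases hx with rfl | ⟨i, -, hi, rfl⟩
  · refine ⟨?_, ?_⟩
    · simpa [detForm_apply, degVec] using he (σ j)
    · simpa [detForm_apply] using (nextVec_nonneg (d := d) (e := e) (σ := σ) j).2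
  · refine ⟨?_, ?_⟩
    · rw [detForm_swap]
      omega
    · obtain ⟨h, h'⟩ := detForm_neg_of_mem_rightRays he hσ hi
      rwa [nextVec, dif_pos h]

/-- The closed chamber lies on the nonnegative side of every cut-off ray: by the Plücker relation
det(x,w) is a nonnegative combination of its values on the two spanning rays. -/
theorem detForm_nonneg_of_mem_rightRays (he : ∀ i, 0 < e i) (hσ : IsSlopeEnumeration d e σ)
    {j : Fin l} {x w : ℤ × ℤ} (hx : x ∈ rightRays d e Finset.univ (degVec d e (σ j)))
    (h1 : detForm (degVec d e (σ j)) w ≤ 0) (h2 : 0 ≤ detForm (nextVec d e σ j) w) :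
    0 ≤ detForm x w := by
  obtain ⟨h3, h4⟩ := detForm_of_mem_rightRays he hσ hx
  have h5 := detForm_nextVec_pos he hσ j
  have key : detForm (nextVec d e σ j) (degVec d e (σ j)) * detForm x w =
      detForm (nextVec d e σ j) w * detForm x (degVec d e (σ j)) +
        -detForm (degVec d e (σ j)) w * detForm x (nextVec d e σ j) := by
    simp only [detForm_apply]; ring
  refine nonneg_of_mul_nonneg_right ?_ h5
  rw [key]
  exact add_nonneg (mul_nonneg h2 h3.le) (mul_nonneg (neg_nonneg.2 h1) h4)

/-- The real linear form `det (b, ·)`. -/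
def realDet (b : ℤ × ℤ) (v : ℝ × ℝ) : ℝ := b.1 * v.2 - b.2 * v.1

theorem realDet_intCast (b w : ℤ × ℤ) : realDet b ((w.1 : ℝ), (w.2 : ℝ)) = detForm b w := by
  simp [realDet, detForm_apply]

theorem realDet_sub (b : ℤ × ℤ) (v w : ℝ × ℝ) : realDet b (v - w) = realDet b v - realDet b w := by
  simp only [realDet, Prod.fst_sub, Prod.snd_sub]; ring

theorem toRealPlane_rayVector (d e : Fin s → ℕ) (σ : Fin l → Fin s) (j : Fin l) :
    toRealPlane (rayVector d e σ j) =
      (((degVec d e (σ j)).1 : ℝ), ((degVec d e (σ j)).2 : ℝ)) := by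
  simp [toRealPlane, rayVector, degVec]

theorem toRealPlane_rayVector_succ (d e : Fin s → ℕ) (σ : Fin l → Fin s) (j : Fin l) :
    toRealPlane (rayVector d e σ (j + 1)) =
      (((nextVec d e σ j).1 : ℝ), ((nextVec d e σ j).2 : ℝ)) := by
  unfold toRealPlane rayVector nextVec
  split_ifs <;> simp [degVec]

theorem mem_chamber_iff (he : ∀ i, 0 < e i) (hσ : IsSlopeEnumeration d e σ) {j : Fin l}
    {v : ℝ × ℝ} : v ∈ chamber d e σ j ↔
      realDet (degVec d e (σ j)) v ≤ 0 ∧ 0 ≤ realDet (nextVec d e σ j) v := by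
  have hD : (0 : ℝ) < detForm (nextVec d e σ j) (degVec d e (σ j)) := by
    exact_mod_cast detForm_nextVec_pos he hσ j
  simp only [chamber, Set.mem_ofPred_eq, toRealPlane_rayVector, toRealPlane_rayVector_succ]
  rw [← realDet_intCast] at hD
  generalize degVec d e (σ j) = a at *
  generalize nextVec d e σ j = b at *
  simp only [realDet] at *
  constructor
  · rintro ⟨α, β, hα, hβ, rfl⟩
    simp only [Prod.fst_add, Prod.snd_add, Prod.smul_fst, Prod.smul_snd, smul_eq_mul]
    constructor
    · linarith [mul_nonneg hβ hD.le]
    · linarith [mul_nonneg hα hD.le]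
  · rintro ⟨h1, h2⟩
    -- Cramer's rule in the basis a, b.
    refine ⟨(b.1 * v.2 - b.2 * v.1) / (b.1 * a.2 - b.2 * a.1),
      -(a.1 * v.2 - a.2 * v.1) / (b.1 * a.2 - b.2 * a.1), div_nonneg h2 hD.le,
      div_nonneg (neg_nonneg.2 h1) hD.le, ?_⟩
    ext
    · simp only [Prod.fst_add, Prod.smul_fst, smul_eq_mul]
      field_simp
      ring
    · simp only [Prod.snd_add, Prod.smul_snd, smul_eq_mul]
      field_simp
      ring

theorem mem_restrictedCone_iff (he : ∀ i, 0 < e i) (hσ : IsSlopeEnumeration d e σ) {j : Fin l}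
    {p : MvPolynomial (Fin 2) ℤ} {v : ℝ × ℝ} : v ∈ restrictedCone d e σ p j ↔
      ∀ c ∈ p.support, realDet (degVec d e (σ j)) v ≤ detForm (degVec d e (σ j)) (latticePoint c) ∧
        detForm (nextVec d e σ j) (latticePoint c) ≤ realDet (nextVec d e σ j) v := by
  refine forall₂_congr fun c _ => ?_
  have hc : (((c 0 : ℕ) : ℝ), ((c 1 : ℕ) : ℝ)) =
      (((latticePoint c).1 : ℝ), ((latticePoint c).2 : ℝ)) := by simp [latticePoint]
  rw [mem_chamber_iff he hσ, realDet_sub, realDet_sub, hc, realDet_intCast, realDet_intCast,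
    sub_nonpos, sub_nonneg]

theorem natCast_mem_restrictedCone_iff (he : ∀ i, 0 < e i) (hσ : IsSlopeEnumeration d e σ)
    {j : Fin l} {p : MvPolynomial (Fin 2) ℤ} {m n : ℕ} :
    ((m : ℝ), (n : ℝ)) ∈ restrictedCone d e σ p j ↔ ∀ c ∈ p.support,
      detForm (degVec d e (σ j)) (((m : ℤ), (n : ℤ)) - latticePoint c) ≤ 0 ∧
        0 ≤ detForm (nextVec d e σ j) (((m : ℤ), (n : ℤ)) - latticePoint c) := by
  rw [mem_restrictedCone_iff he hσ]
  refine forall₂_congr fun c _ => ?_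
  have h : ((m : ℝ), (n : ℝ)) = ((((m : ℤ), (n : ℤ)).1 : ℝ), (((m : ℤ), (n : ℤ)).2 : ℝ)) := by simp
  rw [h, realDet_intCast, realDet_intCast, Int.cast_le, Int.cast_le, map_sub, map_sub, sub_nonpos,
    sub_nonneg]

theorem restrictedCone_subset_chamber (σ : Fin l → Fin s) {p : MvPolynomial (Fin 2) ℤ}
    (hp : 0 ∈ p.support) (j : Fin l) : restrictedCone d e σ p j ⊆ chamber d e σ j := by
  intro v hv
  have := hv 0 hp
  simp only [Finsupp.coe_zero, Pi.zero_apply, Nat.cast_zero] at this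
  change v - 0 ∈ _ at this
  rwa [sub_zero] at this

/-- Only the extreme values M of det(a,·) and N of det(b,·) on the exponents matter, where a, b span
the chamber. The apex solves det(a,u) = M, det(b,u) = N, that is u = (Na - Mb)/det(b,a). Since 0 is
an exponent, M ≤ 0 ≤ N, so u has nonnegative coordinates. -/
theorem exists_apex_restrictedCone (he : ∀ i, 0 < e i) (hσ : IsSlopeEnumeration d e σ)
    {p : MvPolynomial (Fin 2) ℤ} (hp : 0 ∈ p.support) (j : Fin l) :
    ∃ apex : ℚ × ℚ, 0 ≤ apex.1 ∧ 0 ≤ apex.2 ∧ restrictedCone d e σ p j =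
      {v | ∃ w ∈ chamber d e σ j, v = w + toRealPlane apex} := by
  obtain ⟨x, hx, hxmin⟩ := p.support.exists_min_image
    (fun c => detForm (degVec d e (σ j)) (latticePoint c)) ⟨0, hp⟩
  obtain ⟨y, hy, hymax⟩ := p.support.exists_max_image
    (fun c => detForm (nextVec d e σ j) (latticePoint c)) ⟨0, hp⟩
  have hzero : ∀ b, detForm b (latticePoint 0) = 0 := fun b => map_zero _
  have hx0 := hxmin 0 hp
  have hy0 := hymax 0 hp
  rw [hzero] at hx0 hy0
  have hD := detForm_nextVec_pos he hσ j
  have hb := nextVec_nonneg (d := d) (e := e) (σ := σ) j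
  have ha : 0 ≤ (degVec d e (σ j)).1 ∧ 0 ≤ (degVec d e (σ j)).2 := by simp [degVec]
  have hrc : ∀ v : ℝ × ℝ, v ∈ restrictedCone d e σ p j ↔
      realDet (degVec d e (σ j)) v ≤ detForm (degVec d e (σ j)) (latticePoint x) ∧
        detForm (nextVec d e σ j) (latticePoint y) ≤ realDet (nextVec d e σ j) v := by
    intro v
    rw [mem_restrictedCone_iff he hσ]
    constructor
    · exact fun h => ⟨(h x hx).1, (h y hy).2⟩
    · exact fun h c hc => ⟨h.1.trans (by exact_mod_cast hxmin c hc),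
        le_trans (by exact_mod_cast hymax c hc) h.2⟩
  have hch : ∀ v : ℝ × ℝ, v ∈ chamber d e σ j ↔
      realDet (degVec d e (σ j)) v ≤ 0 ∧ 0 ≤ realDet (nextVec d e σ j) v :=
    fun v => mem_chamber_iff he hσ
  generalize detForm (degVec d e (σ j)) (latticePoint x) = M at *
  generalize detForm (nextVec d e σ j) (latticePoint y) = N at *
  generalize degVec d e (σ j) = a at *
  generalize nextVec d e σ j = b at *
  rw [detForm_apply] at hD
  let D : ℤ := b.1 * a.2 - b.2 * a.1
  have hDQ : (0 : ℚ) < D := by exact_mod_cast hD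
  have hDR : (0 : ℝ) < D := by exact_mod_cast hD
  have hDeq : (D : ℝ) = b.1 * a.2 - b.2 * a.1 := by simp [D]
  refine ⟨(((N * a.1 + -M * b.1 : ℤ) : ℚ) / D, ((N * a.2 + -M * b.2 : ℤ) : ℚ) / D),
    div_nonneg (Int.cast_nonneg (add_nonneg (mul_nonneg hy0 ha.1)
      (mul_nonneg (neg_nonneg.2 hx0) hb.1))) hDQ.le,
    div_nonneg (Int.cast_nonneg (add_nonneg (mul_nonneg hy0 ha.2)
      (mul_nonneg (neg_nonneg.2 hx0) hb.2))) hDQ.le, ?_⟩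
  set u : ℝ × ℝ := toRealPlane (((N * a.1 + -M * b.1 : ℤ) : ℚ) / D,
    ((N * a.2 + -M * b.2 : ℤ) : ℚ) / D) with hu
  have hu1 : realDet a u = M := by
    simp only [hu, realDet, toRealPlane]
    push_cast
    field_simp
    rw [hDeq]
    ring
  have hu2 : realDet b u = N := by
    simp only [hu, realDet, toRealPlane]
    push_cast
    field_simp
    rw [hDeq]
    ring
  ext v
  rw [hrc]
  constructor
  · rintro ⟨h1, h2⟩
    refine ⟨v - u, ?_, (sub_add_cancel v u).symm⟩
    rw [hch, realDet_sub, realDet_sub, hu1, hu2]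
    exact ⟨sub_nonpos.2 h1, sub_nonneg.2 h2⟩
  · rintro ⟨w, hw, rfl⟩
    have hw' : w = w + u - u := by rw [add_sub_cancel_right]
    rw [hw', hch, realDet_sub, realDet_sub, hu1, hu2] at hw
    exact ⟨sub_nonpos.1 hw.1, sub_nonneg.1 hw.2⟩

/-- On each chamber the vector partition function is a quasi-polynomial. -/
theorem exists_quasiPolySpace_eq_on_chamber (r : ℕ) (he : ∀ i, 0 < e i)
    (hσ : IsSlopeEnumeration d e σ) (j : Fin l) :
    ∃ N : ℕ, 0 < N ∧ ((∀ i, e i = 1) → (j : ℕ) + 1 = l → N = 1) ∧ ∃ G ∈ quasiPolySpace N,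
      ∀ w, detForm (degVec d e (σ j)) w ≤ 0 → 0 ≤ detForm (nextVec d e σ j) w →
        coeffFunction (partitionSeries (r + 1) d e Finset.univ) w = G w := by
  by_cases h : (∀ i, e i = 1) ∧ (j : ℕ) + 1 = l
  · have hno : ∀ i, ¬ detForm (degVec d e (σ j)) (degVec d e i) < 0 := fun i hi =>
      absurd h.2 (detForm_neg_of_mem_rightRays he hσ hi).1.ne
    obtain ⟨G, hG, hGw⟩ := exists_eq_on_chamber r he (σ j) (𝒬 := quasiPolySpace 1) (by
      rintro b (rfl | ⟨i, -, hi, -⟩) i' hv τ g G hg hG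
      · have h1 := hG.mem_quasiPolySpace hv one_pos hg
        simpa [detForm_apply, degVec, h.1 i'] using h1
      · exact absurd hi (hno i)) (by
      rw [Finset.filter_false_of_mem fun i _ => hno i]
      exact hasRayRep_empty r d e ⟨by simp [degVec], by simpa [degVec] using he (σ j)⟩ (Or.inl rfl))
    exact ⟨1, one_pos, fun _ _ => rfl, G, hG, fun w h1 h2 =>
      hGw w h1 fun x hx => detForm_nonneg_of_mem_rightRays he hσ hx h1 h2⟩
  · obtain ⟨G, ⟨N, hN, hG⟩, hGw⟩ := exists_eq_on_chamber r he (σ j) (𝒬 := quasiPolyFunctions)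
      (fun b _ i hv τ g G hg hG => quasiPolyFunctions_stripSum hv hg hG)
      ((hasRayRep_partitionSeries r he _ (degVec d e (σ j)) (by simp [degVec])
        (by simpa [degVec] using he (σ j)) fun i hi => (Finset.mem_filter.1 hi).2.le).mono
        (by
          rintro b (rfl | ⟨i, -, hi⟩)
          · exact Or.inl rfl
          · exact Or.inr ⟨i, Finset.mem_univ i, hi⟩) fun _ hw => hw)
    lift N to ℕ using hN.le
    exact ⟨N, by exact_mod_cast hN, fun h1 h2 => absurd ⟨h1, h2⟩ h, G, hG, fun w h1 h2 =>
      hGw w h1 fun x hx => detForm_nonneg_of_mem_rightRays he hσ hx h1 h2⟩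

end Chamber

/-! ### Growth inside a chamber and assembly of the theorem -/

section Final

theorem eventually_mul_add_nonpos {u v : ℤ} (hv : v < 0) :
    ∀ᶠ t : ℕ in Filter.atTop, u + t * v ≤ 0 := by
  filter_upwards [Filter.eventually_ge_atTop u.toNat] with t ht
  have h1 : u ≤ t := Int.toNat_le.1 ht
  nlinarith [Int.natCast_nonneg t]

theorem detForm_add_mul (a : ℤ × ℤ) (x p : ℕ × ℕ) (t : ℕ) (c : ℤ × ℤ) :
    detForm a ((((x.1 + t * p.1 : ℕ) : ℤ), ((x.2 + t * p.2 : ℕ) : ℤ)) - c) =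
      detForm a (((x.1 : ℤ), (x.2 : ℤ)) - c) + t * detForm a ((p.1 : ℤ), (p.2 : ℤ)) := by
  simp only [detForm_apply, Prod.fst_sub, Prod.snd_sub]
  push_cast
  ring

variable {k A : Type*} [Field k] [CommRing A] [Algebra k A] {𝒜 : ℕ → Submodule k A}
  [GradedAlgebra 𝒜] {I : ℕ → Ideal A} {s l : ℕ} {d e : Fin s → ℕ} {σ : Fin l → Fin s}

theorem bigradedLength_le_finrank (hA : IsStandardGraded 𝒜) (hI : IsHomogeneousFiltration 𝒜 I)
    (m n : ℕ) : bigradedLength 𝒜 I m n ≤ Module.finrank k (𝒜 m) := by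
  rw [← bigradedLength_zero_right hI]
  exact antitone_nat_of_succ_le (f := bigradedLength 𝒜 I m)
    (bigradedLength_succ_right_le hA hI m) (Nat.zero_le n)

/-- In a domain the lengths grow with the largest possible order along some ray in the interior of
the chamber. -/
theorem exists_pow_le_bigradedLength [IsDomain A] (hA : IsStandardGraded 𝒜) {dim : ℕ}
    (hdim : ringKrullDim A = dim) (hdim_pos : 1 ≤ dim)
    (hmono : Monotone fun m => Module.finrank k (𝒜 m)) (hI : IsHomogeneousFiltration 𝒜 I)
    (he : ∀ i, 0 < e i) (hσ : IsSlopeEnumeration d e σ) (j : Fin l) {g : A}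
    (hg : g ∈ I (e (σ j))) (hg' : g ∈ 𝒜 (d (σ j))) (hg0 : g ≠ 0) :
    ∃ p ∈ {p : ℕ × ℕ | detForm (degVec d e (σ j)) ((p.1 : ℤ), (p.2 : ℤ)) < 0 ∧
        0 < detForm (nextVec d e σ j) ((p.1 : ℤ), (p.2 : ℤ))},
      ∃ κ : ℕ, ∀ t : ℕ, t ^ (dim - 1) ≤ κ * bigradedLength 𝒜 I (t * p.1) (t * p.2) := by
  obtain ⟨κ, hκ, hle⟩ := hA.exists_le_finrank hdim hdim_pos hmono
  have hD := detForm_nextVec_pos he hσ j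
  obtain ⟨hb1, hb2⟩ := nextVec_nonneg (d := d) (e := e) (σ := σ) j
  generalize nextVec d e σ j = b at *
  obtain ⟨b1, b2⟩ := b
  lift b1 to ℕ using hb1
  lift b2 to ℕ using hb2
  have he' := he (σ j)
  simp only [degVec]
  change 0 < (b1 : ℤ) * (e (σ j) : ℤ) - (b2 : ℤ) * (d (σ j) : ℤ) at hD
  generalize d (σ j) = δ at *
  generalize e (σ j) = ε at *
  obtain ⟨D, hD'⟩ : ∃ D : ℕ, b1 * ε = b2 * δ + D :=
    Nat.exists_eq_add_of_le (by zify; omega)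
  have hDpos : 0 < D := by zify at hD' ⊢; omega
  have hκε : (0 : ℤ) < κ * ε := by positivity
  -- The direction is κε times the sum of the spanning vectors (δ,ε) and (b1,b2). Its t-th multiple
  -- is tκ(ε+b2)·(δ,ε) + (tκD, 0), so multiplication by a power of g embeds A_{tκD} there.
  refine ⟨(κ * ε * (δ + b1), κ * ε * (ε + b2)), ⟨?_, ?_⟩, κ, fun t => ?_⟩
  · have : detForm ((δ : ℤ), (ε : ℤ))
        (((κ * ε * (δ + b1) : ℕ) : ℤ), ((κ * ε * (ε + b2) : ℕ) : ℤ)) =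
        -((κ * ε) * ((b1 : ℤ) * ε - b2 * δ)) := by
      simp only [detForm_apply]; push_cast; ring
    rw [this, neg_lt_zero]
    exact mul_pos hκε hD
  · have : detForm ((b1 : ℤ), (b2 : ℤ))
        (((κ * ε * (δ + b1) : ℕ) : ℤ), ((κ * ε * (ε + b2) : ℕ) : ℤ)) =
        (κ * ε) * ((b1 : ℤ) * ε - b2 * δ) := by
      simp only [detForm_apply]; push_cast; ring
    rw [this]
    exact mul_pos hκε hD
  · have h1 : t * (κ * ε * (δ + b1)) = t * κ * (ε + b2) * δ + t * κ * D := by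
      linear_combination t * κ * hD'
    have h2 : t * (κ * ε * (ε + b2)) = t * κ * (ε + b2) * ε := by ring
    rw [h1, h2]
    calc t ^ (dim - 1) ≤ (t + 1) ^ (dim - 1) := Nat.pow_le_pow_left (Nat.le_succ t) _
      _ ≤ κ * Module.finrank k (𝒜 (κ * t)) := hle t
      _ ≤ κ * Module.finrank k (𝒜 (t * κ * D)) :=
        Nat.mul_le_mul_left _ (hmono (by rw [mul_comm κ]; exact Nat.le_mul_of_pos_right _ hDpos))
      _ ≤ _ := Nat.mul_le_mul_left _ (finrank_le_bigradedLength hA hI hg hg' hg0 _ _)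

theorem IsHilbertNumerator.exists_leadingForm (hA : IsStandardGraded 𝒜) {dim : ℕ}
    (hdim : ringKrullDim A = dim) (hdim_pos : 1 ≤ dim) (hdepth : 0 < gradedDepth 𝒜)
    (hI : IsHomogeneousFiltration 𝒜 I) {r : ℕ} (he : ∀ i, 0 < e i)
    (hσ : IsSlopeEnumeration d e σ) {p : MvPolynomial (Fin 2) ℤ}
    (hp : IsHilbertNumerator 𝒜 I (r + 1) d e p) (j : Fin l) :
    ∃ (P : MvPolynomial (Fin 2) ℚ) (Q : QuasiPolynomial₂) (t : ℕ),
      P.IsHomogeneous t ∧ t ≤ dim - 1 ∧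
      (Q.degree < polyDegree P ∨ (P = 0 ∧ Q.degree = ⊥)) ∧
      (∀ m n : ℕ, ((m : ℝ), (n : ℝ)) ∈ restrictedCone d e σ p j →
        (bigradedLength 𝒜 I m n : ℚ) =
          MvPolynomial.eval ![(m : ℚ), (n : ℚ)] P + Q.eval m n) ∧
      ((∀ i, e i = 1) → (j : ℕ) + 1 = l → Q.IsPolynomial) ∧
      (IsDomain A → (∃ g ∈ I (e (σ j)), g ∈ 𝒜 (d (σ j)) ∧ g ≠ 0) →
        polyDegree P = ((dim - 1 : ℕ) : WithBot ℕ)) := by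
  have hmono := monotone_finrank hA hdepth hI
  obtain ⟨N, hN, hN1, G, hG, hGw⟩ := exists_quasiPolySpace_eq_on_chamber r he hσ j
  obtain ⟨f, hf, hfH⟩ := hp.exists_quasiPoly he (𝒬 := quasiPolySpace N)
    (fun f hf v => translation_mem_quasiPolySpace hf v)
    (C := {w | detForm (degVec d e (σ j)) w ≤ 0 ∧ 0 ≤ detForm (nextVec d e σ j) w}) hG
    fun w hw => hGw w hw.1 hw.2
  obtain ⟨q, hqN, hq⟩ := exists_quasiPolynomial₂ hN hf
  obtain ⟨C, hC⟩ := hA.exists_finrank_le hdim hdim_pos hmono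
  have hD := detForm_nextVec_pos he hσ j
  obtain ⟨hb1, hb2⟩ := nextVec_nonneg (d := d) (e := e) (σ := σ) j
  obtain ⟨P, Q, t, hQ, hP, ht, hdeg, heval, hfull⟩ := q.exists_leadingForm
    (H := bigradedLength 𝒜 I) (Ω := fun m n => ((m : ℝ), (n : ℝ)) ∈ restrictedCone d e σ p j)
    (fun m n hmn => by
      rw [hfH m n fun c hc => (natCast_mem_restrictedCone_iff he hσ).1 hmn c hc, hq])
    (bigradedLength_le_succ_left hA hdepth I) (bigradedLength_succ_right_le hA hI)
    (fun m n => (bigradedLength_le_finrank hA hI m n).trans (hC m))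
    -- Directions in the open chamber: a ray in such a direction eventually enters every translate
    -- of the cone, whatever its starting point.
    (S := {p : ℕ × ℕ | detForm (degVec d e (σ j)) ((p.1 : ℤ), (p.2 : ℤ)) < 0 ∧
      0 < detForm (nextVec d e σ j) ((p.1 : ℤ), (p.2 : ℤ))})
    (by
      rintro u ⟨hu1, hu2⟩ x
      simp only [natCast_mem_restrictedCone_iff he hσ]
      rw [Filter.eventually_all_finset]
      intro c _
      filter_upwards [eventually_mul_add_nonpos
        (u := detForm (degVec d e (σ j)) (((x.1 : ℤ), (x.2 : ℤ)) - latticePoint c)) hu1,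
        eventually_mul_add_nonpos
        (u := -detForm (nextVec d e σ j) (((x.1 : ℤ), (x.2 : ℤ)) - latticePoint c))
        (neg_neg_of_pos hu2)] with t h1 h2
      rw [detForm_add_mul, detForm_add_mul]
      exact ⟨h1, by linarith⟩)
    -- The sum of the two spanning vectors is an interior direction.
    (p₀ := (d (σ j) + (nextVec d e σ j).1.toNat, e (σ j) + (nextVec d e σ j).2.toNat))
    (by
      intro x
      have h1 : detForm (degVec d e (σ j)) (((d (σ j) + (nextVec d e σ j).1.toNat : ℕ) : ℤ),
          ((e (σ j) + (nextVec d e σ j).2.toNat : ℕ) : ℤ)) < 0 := by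
        push_cast
        rw [Int.toNat_of_nonneg hb1, Int.toNat_of_nonneg hb2]
        simp only [detForm_apply, degVec] at hD ⊢
        linarith
      have h2 : 0 < detForm (nextVec d e σ j) (((d (σ j) + (nextVec d e σ j).1.toNat : ℕ) : ℤ),
          ((e (σ j) + (nextVec d e σ j).2.toNat : ℕ) : ℤ)) := by
        push_cast
        rw [Int.toNat_of_nonneg hb1, Int.toNat_of_nonneg hb2]
        simp only [detForm_apply, degVec] at hD ⊢
        linarith
      -- The offset +1 turns the weak inequality into the strict one that defines S.
      filter_upwards [eventually_mul_add_nonpos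
        (u := detForm (degVec d e (σ j)) (((x.1 : ℤ), (x.2 : ℤ)) - 0) + 1) h1,
        eventually_mul_add_nonpos
        (u := -detForm (nextVec d e σ j) (((x.1 : ℤ), (x.2 : ℤ)) - 0) + 1)
        (neg_neg_of_pos h2)] with t h3 h4
      refine ⟨?_, ?_⟩
      · rw [← sub_zero (_, _)]
        refine (detForm_add_mul _ x (_, _) t 0).trans_lt ?_
        linarith
      · rw [← sub_zero (_, _)]
        refine lt_of_lt_of_eq ?_ (detForm_add_mul _ x (_, _) t 0).symm
        linarith)
  refine ⟨P, Q, t, hP, ht, hdeg, heval, fun h1 h2 => ?_, ?_⟩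
  · have hQ1 : Q.period = 1 := by rw [hQ, hqN, hN1 h1 h2]
    refine ⟨Q.constituent ⟨0, Q.period_pos⟩ ⟨0, Q.period_pos⟩, fun a b => ?_⟩
    congr 1 <;> ext <;> simp <;> omega
  · rintro hdom ⟨g, hg, hg', hg0⟩
    exact hfull (exists_pow_le_bigradedLength hA hdim hdim_pos hmono hI he hσ j hg hg' hg0)

end Final

theorem theorem3 {k A : Type*} [Field k] [CommRing A] [Algebra k A]
    (𝒜 : ℕ → Submodule k A) [GradedAlgebra 𝒜] (hA : IsStandardGraded 𝒜)
    (dim : ℕ) (hdim : ringKrullDim A = dim) (hdim_pos : 1 ≤ dim)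
    (hdepth : 0 < gradedDepth 𝒜)
    (I : ℕ → Ideal A) (hI : IsHomogeneousFiltration 𝒜 I)
    (r s l : ℕ) (d e : Fin s → ℕ) (he : ∀ i, 0 < e i)
    (σ : Fin l → Fin s) (hσ : IsSlopeEnumeration d e σ)
    (hR : (IsNoetherianFiltration I ∧
        ∃ (x : Fin r → A) (g : Fin s → A), IsGeneratingSystem 𝒜 I hI d e x g) ∨
      ∃ p : MvPolynomial (Fin 2) ℤ, IsHilbertNumerator 𝒜 I r d e p) :
    (∃ p : MvPolynomial (Fin 2) ℤ, IsHilbertNumerator 𝒜 I r d e p) ∧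
    ∀ p : MvPolynomial (Fin 2) ℤ, IsHilbertNumerator 𝒜 I r d e p → ∀ j : Fin l,
      (∃ apex : ℚ × ℚ, 0 ≤ apex.1 ∧ 0 ≤ apex.2 ∧
        restrictedCone d e σ p j =
          {v | ∃ w ∈ chamber d e σ j, v = w + toRealPlane apex}) ∧
      restrictedCone d e σ p j ⊆ chamber d e σ j ∧
      ∃ (P : MvPolynomial (Fin 2) ℚ) (Q : QuasiPolynomial₂) (t : ℕ),
        P.IsHomogeneous t ∧ t ≤ dim - 1 ∧
        (Q.degree < polyDegree P ∨ (P = 0 ∧ Q.degree = ⊥)) ∧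
        (∀ m n : ℕ, ((m : ℝ), (n : ℝ)) ∈ restrictedCone d e σ p j →
          (bigradedLength 𝒜 I m n : ℚ) =
            MvPolynomial.eval ![(m : ℚ), (n : ℚ)] P + Q.eval m n) ∧
        ((∀ i, e i = 1) → (j : ℕ) + 1 = l → Q.IsPolynomial) ∧
        (IsDomain A →
          (∃ (x : Fin r → A) (g : Fin s → A),
            IsGeneratingSystem 𝒜 I hI d e x g ∧ ∀ i, g i ≠ 0) →
          polyDegree P = ((dim - 1 : ℕ) : WithBot ℕ)) := by

  have : Nontrivial A := by
    rw [← not_subsingleton_iff_nontrivial]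
    intro h
    rw [ringKrullDim_eq_bot_of_subsingleton] at hdim
    exact WithBot.bot_ne_coe hdim
  refine ⟨?_, fun p hp j => ?_⟩
  · rcases hR with ⟨-, x, g, h⟩ | h
    · exact h.exists_numerator he
    · exact h
  have h0 := hp.zero_mem_support hA hI he
  -- A factor 1 - x is present in the denominator; the analysis of the partition function starts
  -- from it.
  obtain ⟨r, rfl⟩ := Nat.exists_eq_succ_of_ne_zero (hp.ne_zero hA hdepth hI he)
  refine ⟨exists_apex_restrictedCone he hσ h0 j, restrictedCone_subset_chamber σ h0 j, ?_⟩
  obtain ⟨P, Q, t, h1, h2, h3, h4, h5, h6⟩ :=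
    hp.exists_leadingForm hA hdim hdim_pos hdepth hI he hσ j
  refine ⟨P, Q, t, h1, h2, h3, h4, h5, ?_⟩
  rintro hdom ⟨x, g, hg, hg0⟩
  exact h6 hdom ⟨g (σ j), hg.g_mem _, hg.g_deg _, hg0 _⟩
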